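/- **Theorem 1.1.** For $q\ge 1$ and integers $m,n$ let $$\mathcal K(m,n;q)=\frac1{q^{1/2}}\sum_{\substack{b \bmod q\\ \gcd(b,q)=1}} e\!\left(\frac{mb+n\overline b}{q}\right),\qquad e(x)=e^{2\pi i x},\quad b\overline b\equiv 1 \bmod q .$$ There is an absolute constant $c>0$ such that for every $0<\lambda<1$ there are constants $H_1(\lambda)>0$ and $C(\lambda)>0$, depending only on $\lambda$, with the following property. Let $p$ be an odd prime, let $k>H_1(\lambda)$ be an integer, and put $q=p^k$. Let $a$ be an integer with $\gcd(a,p)=1$, let $M,N$ be integers with $q^\lambda<M,N<q$, and let $\alpha_1,\dots,\alpha_M$ and $\beta_1,\dots,\beta_N$ be complex numbers with $|\alpha_m|\le 1$ and $|\beta_n|\le 1$ for all $m,n$. Then $$\left|\sum_{m=1}^M\sum_{n=1}^N \alpha_m\beta_n\,\mathcal K(mn,a;q)\right|\le C(\lambda)\,MN\,q^{-c\lambda^3}.$$ -/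

import Mathlib

namespace Kloosterman

/-- The additive character `e(x) = exp(2πix)` of a real number `x`. -/
noncomputable def e (x : ℝ) : ℂ :=
  Complex.exp (2 * (Real.pi : ℂ) * Complex.I * (x : ℂ))

/-- The inverse of `b` modulo `q`, as a natural number: for `q ≥ 1` and `b` coprime to `q` it is the
element of `{0, …, q - 1}` whose product with `b` is congruent to `1` modulo `q`. -/
def modInv (q b : ℕ) : ℕ := ((b : ZMod q)⁻¹).val

theorem mul_modInv {q b : ℕ} (h : b.Coprime q) : b * modInv q b ≡ 1 [MOD q] := by
  rcases Nat.eq_zero_or_pos q with rfl | hq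
  · have hb : b = 1 := by simpa using h
    subst hb
    simp [modInv, Nat.ModEq]
  · have : NeZero q := ⟨hq.ne'⟩
    rw [← ZMod.natCast_eq_natCast_iff]
    push_cast
    rw [modInv, ZMod.natCast_zmod_val, ZMod.coe_mul_inv_eq_one b h]

/-- The normalised Kloosterman sum `K(m, n; q) = q^{-1/2} ∑* e((m b + n b̄) / q)`, where `b` runs over
the reduced residue classes modulo `q` and `b̄` is the inverse of `b` modulo `q`. -/
noncomputable def kloostermanSum (m n : ℤ) (q : ℕ) : ℂ :=
  (1 / (Real.sqrt q : ℂ)) *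
    ∑ b ∈ (Finset.range q).filter (fun b => b.Coprime q),
      e (((m * (b : ℤ) + n * (modInv q b : ℤ) : ℤ) : ℝ) / (q : ℝ))

/-- The bilinear sum `∑_{m = 1}^M ∑_{n = 1}^N α_m β_n K(mn, a; q)`. -/
noncomputable def bilinearSum (a : ℤ) (q : ℕ) (α β : ℕ → ℂ) (M N : ℕ) : ℂ :=
  ∑ m ∈ Finset.Icc 1 M, ∑ n ∈ Finset.Icc 1 N,
    α m * β n * kloostermanSum ((m : ℤ) * (n : ℤ)) a q

end Kloosterman

/-!
Write `q = p ^ k`, `D ≈ 1 / λ`, `τ ≈ k / (100 D)` and `B = p ^ τ`, so that both `M` and `N` exceed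
`B ^ 100`. Cauchy–Schwarz in `m` removes the coefficients and leaves the correlation sums `∑ₘ K(mn,
a; q) conj K(mn', a; q)`. The pairs with `n ≡ n'` modulo `B ^ 2` are few. For the others the sum
over `m` is averaged over the shifts `m ↦ m + p ^ (2τ) y x` with `y, x < B ^ 2`.

Stationary phase (`sum_units_eq_sum_stationary`) restricts the Kloosterman sum `K(μ, a; q)` to the
units `u` at which `μ u + a / u` is nearly stationary, and shows that `K(μ γ², a; q)` is a sum of
the characters `ψ (γ h(u))` over the same `u`, with `h(u) = μ u + a / u` (`klSum_mul_sq`). For `m`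
prime to `p` the shifted argument is `m γ²` times `n`, where `γ` is the square root of `1 + p ^ (2τ)
y x / m`. This square root is the power with exponent `(p ^ (k - 1) + 1) / 2`, and its binomial
expansion stops at degree `r = 51 D` because `p ^ (2τ (r + 1)) = 0` modulo `q`. Hence the
correlation is a bounded combination of sums over `y, x < B ^ 2` of `ψ (∑ⱼ Aⱼ yʲ xʲ)`
(`norm_sum_correlation_le`). Here `Aⱼ` is, up to small powers of `p`, a unit times `W p ^ (2τ j)`
with `W = h(u) - h'(u')`, and the stationarity of `u` and `u'` together with `n ≢ n'` modulo `p ^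
(2τ)` forces `p ^ (2τ) ∤ W`. So the additive order of `Aⱼ` lies between `B ^ j` and `B ^ (3j)` for a
positive proportion of the degrees `j ≤ r` (`addOrderOf_coeff_bounds`).

Such double sums are estimated by Korobov's method (`exists_double_sum_bound`): two applications of
Hölder's inequality bound a high power of the sum by the square of Vinogradov's mean value times the
product over `j` of the bilinear forms `∑_v |∑_u ψ (Aⱼ u v)|` with `u, v ≪ B ^ (2j)`, and each `j`
with the order of `Aⱼ` in the range above saves `B ^ j`. The total saving `B ^ (252 D ^ 2)` has to
exceed the loss in the mean value theorem. The latter (`meanValue_le`) is obtained by Linnik's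
`p`-adic method: tuples with `r` entries incongruent modulo an auxiliary prime of size `P ^ (1 / r)`
are counted by Newton's identities (`card_le_of_psum_modEq_pow`), the other entries are placed in
one residue class by Hölder's inequality, and translation and dilation invariance lead to a mean
value with `r` fewer variables and range `P ^ (1 - 1 / r)`. After `5 r` steps from `r ^ 2` variables
the excess over the expected exponent has decreased by a factor `e ^ (-5)`, which makes the loss at
most `B ^ (126 D ^ 2)`. Since the sum is raised to a power of order `D ^ 4`, the saving is `B` to a
power of order `D ^ (-2)`, which is `q` to a power of order `D ^ (-3)`, hence of order `λ ^ 3`.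
-/

namespace Kloosterman

open Finset

/-! ### Additive energy and Hölder's inequality -/

theorem norm_sq_sum_addChar {β G : Type*} [Fintype β] [AddCommGroup G] [Finite G]
    (χ : AddChar G ℂ) (Ψ : β → G) :
    ((‖∑ b, χ (Ψ b)‖ ^ 2 : ℝ) : ℂ) = ∑ w : β × β, χ (Ψ w.1 - Ψ w.2) := by
  rw [Complex.ofReal_pow, ← Complex.mul_conj', map_sum, sum_mul_sum, ← univ_product_univ,
    sum_product]
  refine sum_congr rfl fun b _ => sum_congr rfl fun b' _ => ?_
  rw [AddChar.map_sub_eq_div, div_eq_mul_inv, ← AddChar.map_neg_eq_inv,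
    AddChar.map_neg_eq_conj]

section Energy

variable {β G : Type*} [Fintype β]

/-- The additive energy of a map `Ψ : β → G`: the number of pairs `(b, b')` with `Ψ b = Ψ b'`. -/
noncomputable def energy (Ψ : β → G) : ℕ := by
  classical exact #{w : β × β | Ψ w.1 = Ψ w.2}

theorem energy_eq_sum [DecidableEq G] (Ψ : β → G) (T : Finset G) (hT : ∀ b, Ψ b ∈ T) :
    energy Ψ = ∑ g ∈ T, #{b : β | Ψ b = g} ^ 2 := by
  classical
  unfold energy
  rw [card_eq_sum_card_fiberwise (f := fun w : β × β => Ψ w.1) (t := T) (fun w _ => hT w.1)]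
  refine sum_congr rfl fun g _ => ?_
  rw [sq, ← card_product]
  congr 1
  ext w
  simp only [mem_filter, mem_univ, true_and, mem_product]
  constructor
  · rintro ⟨h1, h2⟩; exact ⟨h2, by rw [← h1, h2]⟩
  · rintro ⟨h1, h2⟩; exact ⟨by rw [h1, h2], h1⟩

/-- The equation `Ψ b = Ψ b' + c` has at most as many solutions as the one with `c = 0`, by
Cauchy–Schwarz. -/
theorem card_shifted_le_energy [AddCommGroup G] [DecidableEq G] (Ψ : β → G) (c : G) :
    #{w : β × β | Ψ w.1 = Ψ w.2 + c} ≤ energy Ψ := by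
  classical
  set T : Finset G := univ.image Ψ with hT
  have hmem : ∀ b, Ψ b ∈ T := fun b => mem_image_of_mem _ (mem_univ b)
  set ρ : G → ℕ := fun g => #{b : β | Ψ b = g} with hρ
  have hoff : ∀ g, g ∉ T → ρ g = 0 := by
    intro g hg
    simp only [hρ, card_eq_zero, filter_eq_empty_iff]
    intro b _ hb
    exact hg (hb ▸ hmem b)
  have h1 : #{w : β × β | Ψ w.1 = Ψ w.2 + c} = ∑ g ∈ T, ρ g * ρ (g - c) := by
    rw [card_eq_sum_card_fiberwise (f := fun w : β × β => Ψ w.1) (t := T) (fun w _ => hmem w.1)]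
    refine sum_congr rfl fun g _ => ?_
    rw [hρ, ← card_product]
    congr 1
    ext w
    simp only [mem_filter, mem_univ, true_and, mem_product]
    constructor
    · rintro ⟨h1, h2⟩; exact ⟨h2, by rw [← h2, h1]; abel⟩
    · rintro ⟨h1, h2⟩; exact ⟨by rw [h1, h2]; abel, h1⟩
  have h2 : energy Ψ = ∑ g ∈ T, ρ g ^ 2 := energy_eq_sum Ψ T hmem
  have h3 : ∑ g ∈ T, ρ (g - c) ^ 2 ≤ ∑ g ∈ T, ρ g ^ 2 := by
    rw [← sum_image (f := fun g => ρ g ^ 2) (g := fun g => g - c) (s := T)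
      (fun x _ y _ h => by simpa using h)]
    calc ∑ g ∈ T.image (fun g => g - c), ρ g ^ 2
        ≤ ∑ g ∈ (T.image (fun g => g - c)) ∪ T, ρ g ^ 2 :=
          sum_le_sum_of_subset subset_union_left
      _ = ∑ g ∈ T, ρ g ^ 2 := by
          symm
          apply sum_subset subset_union_right
          intro g _ hg
          rw [hoff g hg]; rfl
  have h4 : 2 * ∑ g ∈ T, ρ g * ρ (g - c) ≤ ∑ g ∈ T, ρ g ^ 2 + ∑ g ∈ T, ρ (g - c) ^ 2 := by
    rw [mul_sum, ← sum_add_distrib]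
    refine sum_le_sum fun g _ => ?_
    rw [← mul_assoc]
    exact two_mul_le_add_sq _ _
  rw [h1, h2]
  omega

theorem energy_le_card_sq (Ψ : β → G) : energy Ψ ≤ Fintype.card β ^ 2 := by
  classical
  unfold energy
  refine (card_le_univ _).trans ?_
  rw [Fintype.card_prod, sq]

theorem energy_congr {G' : Type*} (Ψ : β → G) (Ψ' : β → G')
    (h : ∀ b b', Ψ b = Ψ b' ↔ Ψ' b = Ψ' b') : energy Ψ = energy Ψ' := by
  classical
  unfold energy
  congr 1
  ext w
  simp [h]

theorem energy_le_of_injective {β' : Type*} [Fintype β'] (Ψ : β → G) (Ψ' : β' → G)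
    (f : β → β') (hf : Function.Injective f) (h : ∀ b b', Ψ b = Ψ b' → Ψ' (f b) = Ψ' (f b')) :
    energy Ψ ≤ energy Ψ' := by
  classical
  unfold energy
  refine card_le_card_of_injOn (fun w => (f w.1, f w.2)) ?_ ?_
  · intro w hw
    simp only [coe_filter, mem_univ, true_and, Set.mem_ofPred_eq] at hw ⊢
    exact h _ _ hw
  · rintro ⟨a, b⟩ _ ⟨c, d⟩ _ h
    simp only [Prod.mk.injEq] at h
    rw [hf h.1, hf h.2]

/-- Parseval: the energy is the mean square of the character sums. -/
theorem card_mul_energy [AddCommGroup G] [Fintype G] (Ψ : β → G) :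
    (Fintype.card G : ℝ) * energy Ψ = ∑ ψ : AddChar G ℂ, ‖∑ b, ψ (Ψ b)‖ ^ 2 := by
  classical
  have h : ((Fintype.card G : ℝ) * energy Ψ : ℂ)
      = ∑ ψ : AddChar G ℂ, ((‖∑ b, ψ (Ψ b)‖ ^ 2 : ℝ) : ℂ) := by
    simp_rw [norm_sq_sum_addChar]
    rw [sum_comm]
    simp_rw [AddChar.sum_apply_eq_ite, sub_eq_zero]
    rw [← sum_filter, sum_const, nsmul_eq_mul, mul_comm]
    simp [energy]
  have h' : (((Fintype.card G : ℝ) * energy Ψ : ℝ) : ℂ)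
      = ((∑ ψ : AddChar G ℂ, ‖∑ b, ψ (Ψ b)‖ ^ 2 : ℝ) : ℂ) := by
    push_cast at h ⊢
    exact h
  exact_mod_cast h'

end Energy

section Hoelder

variable {α X H : Type*} [Fintype α] [Fintype X] [Fintype H] [DecidableEq H]

theorem sum_addChar_prod_pi {Y G : Type*} [Fintype Y] [AddCommGroup G] (Φ : α → G) (φ : Y → G)
    (s : ℕ) (ψ : AddChar G ℂ) :
    ∑ w : α × (Fin s → Y), ψ (Φ w.1 + ∑ i, φ (w.2 i))
      = (∑ a, ψ (Φ a)) * (∑ y, ψ (φ y)) ^ s := by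
  rw [Fintype.sum_pow, ← univ_product_univ, sum_product, sum_mul]
  refine sum_congr rfl fun a _ => ?_
  rw [mul_sum]
  refine sum_congr rfl fun y _ => ?_
  have h : ∀ S : Finset (Fin s), ψ (∑ i ∈ S, φ (y i)) = ∏ i ∈ S, ψ (φ (y i)) := by
    classical
    intro S
    induction S using Finset.induction_on with
    | empty => simp
    | insert i S hi ih => rw [sum_insert hi, prod_insert hi, AddChar.map_add_eq_mul, ih]
  rw [AddChar.map_add_eq_mul, h]

/-- Hölder's inequality over the classes of `cls`, applied to `∑ ψ (φ x)` for each character `ψ` and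
translated into energies by Parseval's identity. Only the `s` variables in `X` are restricted to a
common class; the weight `Φ` is untouched. -/
theorem energy_hoelder_finite {G : Type*} [AddCommGroup G] [Fintype G] (Φ : α → G) (φ : X → G)
    (cls : X → H) (s : ℕ) (hs : 0 < s) :
    energy (fun w : α × (Fin s → X) => Φ w.1 + ∑ i, φ (w.2 i))
      ≤ Fintype.card H ^ (2 * s - 1) *
        ∑ h : H, energy (fun w : α × (Fin s → {x // cls x = h}) => Φ w.1 + ∑ i, φ (w.2 i)) := by
  have hG : (0 : ℝ) < Fintype.card G := by exact_mod_cast Fintype.card_pos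
  have key : (Fintype.card G : ℝ) *
      energy (fun w : α × (Fin s → X) => Φ w.1 + ∑ i, φ (w.2 i))
      ≤ (Fintype.card G : ℝ) * ((Fintype.card H : ℝ) ^ (2 * s - 1) *
        ∑ h : H, (energy (fun w : α × (Fin s → {x // cls x = h}) =>
          Φ w.1 + ∑ i, φ (w.2 i)) : ℝ)) := by
    rw [mul_left_comm, mul_sum]
    simp_rw [card_mul_energy, sum_addChar_prod_pi]
    rw [sum_comm, mul_sum]
    refine sum_le_sum fun ψ _ => ?_
    have fac : ∀ h : H, ∑ b : α × (Fin s → {x // cls x = h}), ψ (Φ b.1 + ∑ i, φ (b.2 i))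
        = (∑ a, ψ (Φ a)) * (∑ y : {x // cls x = h}, ψ (φ y)) ^ s := fun h =>
      sum_addChar_prod_pi Φ (fun y : {x // cls x = h} => φ y) s ψ
    simp_rw [fac, norm_mul, mul_pow]
    rw [← mul_sum, mul_left_comm]
    refine mul_le_mul_of_nonneg_left ?_ (by positivity)
    have hsplit : ∑ y, ψ (φ y) = ∑ h : H, ∑ y : {x // cls x = h}, ψ (φ y) := by
      rw [← Fintype.sum_fiberwise cls]
    rw [norm_pow, ← pow_mul, mul_comm s 2, hsplit]
    have e2 : 2 * s = (2 * s - 1) + 1 := by omega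
    calc ‖∑ h : H, ∑ y : {x // cls x = h}, ψ (φ y)‖ ^ (2 * s)
        ≤ (∑ h : H, ‖∑ y : {x // cls x = h}, ψ (φ y)‖) ^ (2 * s) := by
          gcongr; exact norm_sum_le _ _
      _ ≤ (Fintype.card H : ℝ) ^ (2 * s - 1) *
            ∑ h : H, ‖∑ y : {x // cls x = h}, ψ (φ y)‖ ^ (2 * s) := by
          rw [e2]
          have := pow_sum_le_card_mul_sum_pow (s := (univ : Finset H))
            (f := fun h => ‖∑ y : {x // cls x = h}, ψ (φ y)‖) (fun _ _ => norm_nonneg _)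
            (2 * s - 1)
          simpa using this
      _ = _ := by
          congr 1
          refine sum_congr rfl fun h _ => ?_
          rw [norm_pow, ← pow_mul, mul_comm s 2]
  have := le_of_mul_le_mul_left key hG
  exact_mod_cast this

/-- Hölder's inequality over the classes of `cls`, for the number of solutions of a system of
equations in `ℤ ^ r`. -/
theorem energy_hoelder {r : ℕ} (Φ : α → Fin r → ℤ) (φ : X → Fin r → ℤ)
    (cls : X → H) (s : ℕ) (hs : 0 < s) :
    energy (fun w : α × (Fin s → X) => Φ w.1 + ∑ i, φ (w.2 i))
      ≤ Fintype.card H ^ (2 * s - 1) *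
        ∑ h : H, energy (fun w : α × (Fin s → {x // cls x = h}) => Φ w.1 + ∑ i, φ (w.2 i)) := by
  classical
  -- modulo a `Q` exceeding all differences that occur, congruence is equality
  obtain ⟨Q, hQ0, hQ⟩ : ∃ Q : ℕ, 0 < Q ∧ ∀ w w' : α × (Fin s → X), ∀ j,
      |(Φ w.1 + ∑ i, φ (w.2 i)) j - (Φ w'.1 + ∑ i, φ (w'.2 i)) j| < Q := by
    set F : (α × (Fin s → X)) × (α × (Fin s → X)) × Fin r → ℕ := fun t =>
      ((Φ t.1.1 + ∑ i, φ (t.1.2 i)) t.2.2 - (Φ t.2.1.1 + ∑ i, φ (t.2.1.2 i)) t.2.2).natAbs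
    refine ⟨univ.sup F + 1, by omega, fun w w' j => ?_⟩
    have := le_sup (f := F) (mem_univ (w, w', j))
    have h2 : F (w, w', j)
      = ((Φ w.1 + ∑ i, φ (w.2 i)) j - (Φ w'.1 + ∑ i, φ (w'.2 i)) j).natAbs := rfl
    rw [Int.abs_eq_natAbs, ← h2]
    exact_mod_cast Nat.lt_succ_of_le this
  have : NeZero Q := ⟨hQ0.ne'⟩
  have hcast : ∀ w w' : α × (Fin s → X),
      (Φ w.1 + ∑ i, φ (w.2 i) = Φ w'.1 + ∑ i, φ (w'.2 i)) ↔
      ((fun j => (Φ w.1 j : ZMod Q)) + ∑ i, (fun j => (φ (w.2 i) j : ZMod Q))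
        = (fun j => (Φ w'.1 j : ZMod Q)) + ∑ i, (fun j => (φ (w'.2 i) j : ZMod Q))) := by
    intro w w'
    have e1 : ∀ w : α × (Fin s → X), ((fun j => (Φ w.1 j : ZMod Q)) +
        ∑ i, (fun j => (φ (w.2 i) j : ZMod Q)))
        = fun j => (((Φ w.1 + ∑ i, φ (w.2 i)) j : ℤ) : ZMod Q) := by
      intro w; ext j; simp
    rw [e1, e1]
    constructor
    · intro h; rw [h]
    · intro h
      ext j
      have hj := congrFun h j
      rw [← sub_eq_zero, ← Int.cast_sub, ZMod.intCast_zmod_eq_zero_iff_dvd] at hj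
      have := Int.eq_zero_of_abs_lt_dvd hj (hQ w w' j)
      omega
  have hl := energy_hoelder_finite (fun a => fun j => (Φ a j : ZMod Q))
    (fun x => fun j => (φ x j : ZMod Q)) cls s hs
  rw [energy_congr _ _ hcast]
  refine hl.trans (le_of_eq ?_)
  congr 1
  refine sum_congr rfl fun h _ => ?_
  refine energy_congr _ _ fun w w' => ?_
  exact (hcast (w.1, fun i => (w.2 i : X)) (w'.1, fun i => (w'.2 i : X))).symm

end Hoelder

/-! ### Newton's identities and Linnik's congruences -/

section Newton

variable {R : Type*} [CommRing R]

/-- Newton's identities: equal power sums up to degree `r` force equal elementary symmetric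
functions, provided `1, …, r` are invertible. -/
theorem aeval_esymm_eq_of_psum_eq {r : ℕ} (hr : ∀ k : ℕ, 0 < k → k ≤ r → IsUnit (k : R))
    (u v : Fin r → R) (h : ∀ j, 0 < j → j ≤ r → ∑ i, u i ^ j = ∑ i, v i ^ j) (k : ℕ)
    (hk : k ≤ r) :
    MvPolynomial.aeval u (MvPolynomial.esymm (Fin r) R k)
      = MvPolynomial.aeval v (MvPolynomial.esymm (Fin r) R k) := by
  induction k using Nat.strong_induction_on with
  | _ k ih =>
    rcases Nat.eq_zero_or_pos k with rfl | hk0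
    · simp
    · have key : ∀ w : Fin r → R, (k : R) * MvPolynomial.aeval w (MvPolynomial.esymm (Fin r) R k)
          = (-1) ^ (k + 1) * ∑ a ∈ antidiagonal k with a.1 < k,
            (-1) ^ a.1 * MvPolynomial.aeval w (MvPolynomial.esymm (Fin r) R a.1)
              * ∑ i, w i ^ a.2 := by
        intro w
        have := congrArg (MvPolynomial.aeval w) (MvPolynomial.mul_esymm_eq_sum (Fin r) R k)
        simpa [MvPolynomial.psum, map_sum] using this
      apply (hr k hk0 hk).mul_left_cancel
      rw [key u, key v]
      congr 1
      refine sum_congr rfl fun a ha => ?_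
      simp only [mem_filter, HasAntidiagonal.mem_antidiagonal] at ha
      rw [ih a.1 ha.2 (by omega), h a.2 (by omega) (by omega)]

/-- Equal power sums make `∏ (X - uᵢ)` and `∏ (X - vᵢ)` the same polynomial, so each `uₗ` is a root
of the latter. -/
theorem prod_sub_eq_zero_of_psum_eq {r : ℕ} (hr : ∀ k : ℕ, 0 < k → k ≤ r → IsUnit (k : R))
    (u v : Fin r → R) (h : ∀ j, 0 < j → j ≤ r → ∑ i, u i ^ j = ∑ i, v i ^ j) (l : Fin r) :
    ∏ i, (u l - v i) = 0 := by
  have key : ∀ w : Fin r → R, ∏ i, (Polynomial.X - Polynomial.C (w i))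
      = ∑ j ∈ range (r + 1), (-1) ^ j * (Polynomial.C (MvPolynomial.aeval w
          (MvPolynomial.esymm (Fin r) R j)) * Polynomial.X ^ (r - j)) := by
    intro w
    have := Multiset.prod_X_sub_X_eq_sum_esymm (univ.val.map w)
    simp only [Multiset.map_map, Multiset.card_map, card_val, card_univ, Fintype.card_fin] at this
    simp only [MvPolynomial.aeval_esymm_eq_multiset_esymm]
    exact this
  have h2 : ∏ i, (Polynomial.X - Polynomial.C (u i)) = ∏ i, (Polynomial.X - Polynomial.C (v i)) := by
    rw [key, key]
    refine sum_congr rfl fun j hj => ?_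
    rw [aeval_esymm_eq_of_psum_eq hr u v h j (by simpa [Nat.lt_succ_iff] using hj)]
  have h3 := congrArg (Polynomial.eval (u l)) h2
  rw [Polynomial.eval_prod, Polynomial.eval_prod] at h3
  simp only [Polynomial.eval_sub, Polynomial.eval_X, Polynomial.eval_C] at h3
  rw [← h3]
  exact prod_eq_zero (mem_univ l) (sub_self _)

end Newton

section Linnik

variable {p r : ℕ}

/-- If the coordinates of each tuple in `S` are incongruent modulo `p` and all power sums agree
modulo `p ^ r`, then the tuples are rearrangements of one another: modulo `p` at most one factor of
`∏ (xₗ - yᵢ)` can vanish, so that one is divisible by `p ^ r`. -/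
theorem card_le_of_psum_modEq (hp : p.Prime) (hpr : r < p) (S : Finset (Fin r → ℤ))
    (hdist : ∀ x ∈ S, ∀ i j, (p : ℤ) ∣ x i - x j → i = j)
    (hinj : ∀ x ∈ S, ∀ y ∈ S, ∀ i j, ((p ^ r : ℕ) : ℤ) ∣ x i - y j → x i = y j)
    (hsum : ∀ x ∈ S, ∀ y ∈ S, ∀ j, 0 < j → j ≤ r →
      ((p ^ r : ℕ) : ℤ) ∣ ∑ i, x i ^ j - ∑ i, y i ^ j) :
    #S ≤ r ^ r := by
  classical
  rcases S.eq_empty_or_nonempty with rfl | ⟨y, hy⟩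
  · simp
  have hunit : ∀ k : ℕ, 0 < k → k ≤ r → IsUnit (k : ZMod (p ^ r)) := by
    intro k hk hkr
    rw [ZMod.isUnit_iff_coprime]
    apply Nat.Coprime.pow_right
    exact (hp.coprime_iff_not_dvd.2 fun h => by have := Nat.le_of_dvd hk h; omega).symm
  -- every coordinate of a solution is a coordinate of the solution `y`
  have hmem : ∀ x ∈ S, ∀ l, ∃ i, x l = y i := by
    intro x hx l
    have h1 : ((∏ i, (x l - y i) : ℤ) : ZMod (p ^ r)) = 0 := by
      have := prod_sub_eq_zero_of_psum_eq hunit (fun i => (x i : ZMod (p ^ r)))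
        (fun i => (y i : ZMod (p ^ r))) (fun j hj hjr => by
          have := (ZMod.intCast_zmod_eq_zero_iff_dvd _ _).2 (hsum x hx y hy j hj hjr)
          push_cast at this
          exact sub_eq_zero.1 this) l
      push_cast
      exact this
    rw [ZMod.intCast_zmod_eq_zero_iff_dvd] at h1
    by_cases hd : ∃ i, (p : ℤ) ∣ x l - y i
    · obtain ⟨i, hi⟩ := hd
      refine ⟨i, hinj x hx y hy l i ?_⟩
      rw [← mul_prod_erase univ (fun i => x l - y i) (mem_univ i)] at h1
      refine IsCoprime.dvd_of_dvd_mul_right ?_ h1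
      push_cast
      refine IsCoprime.pow_left (IsCoprime.prod_right fun j hj => ?_)
      rw [(Nat.prime_iff_prime_int.1 hp).coprime_iff_not_dvd]
      intro hj2
      have h3 : (p : ℤ) ∣ y j - y i := by
        have := dvd_sub hi hj2
        simpa using this
      exact (mem_erase.1 hj).1 (hdist y hy j i h3)
    · exfalso
      push Not at hd
      have h2 : (p : ℤ) ∣ ∏ i, (x l - y i) := by
        refine dvd_trans ?_ h1
        push_cast
        exact dvd_pow_self _ (by have := l.2; omega)
      obtain ⟨i, _, hi⟩ := ((Nat.prime_iff_prime_int.1 hp).dvd_finsetProd_iff _).1 h2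
      exact hd i hi
  have hsub : S ⊆ (univ : Finset (Fin r → Fin r)).image (fun g i => y (g i)) := by
    intro x hx
    choose g hg using hmem x hx
    exact mem_image.2 ⟨g, mem_univ _, by ext i; exact (hg i).symm⟩
  calc #S ≤ #((univ : Finset (Fin r → Fin r)).image (fun g i => y (g i))) := card_le_card hsub
    _ ≤ _ := card_image_le
    _ = r ^ r := by simp

/-- Linnik's lemma: the number of solutions, with coordinates incongruent modulo `p`, of the
congruences `∑ xᵢ ^ j ≡ c_j` modulo `p ^ j`. -/
theorem card_le_of_psum_modEq_pow (hp : p.Prime) (hpr : r < p) (S : Finset (Fin r → ℤ))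
    (c : ℕ → ℤ)
    (hdist : ∀ x ∈ S, ∀ i j, (p : ℤ) ∣ x i - x j → i = j)
    (hinj : ∀ x ∈ S, ∀ y ∈ S, ∀ i j, ((p ^ r : ℕ) : ℤ) ∣ x i - y j → x i = y j)
    (hsum : ∀ x ∈ S, ∀ j, 0 < j → j ≤ r → ((p ^ j : ℕ) : ℤ) ∣ ∑ i, x i ^ j - c j) :
    #S ≤ r ^ r * p ^ (r * (r - 1) / 2) := by
  classical
  have hne : ∀ n, NeZero (p ^ n) := fun n => ⟨pow_ne_zero _ hp.ne_zero⟩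
  have : ∀ n, Fintype (ZMod (p ^ n)) := fun n => ZMod.fintype _
  -- the lift of the `j`-th congruence to a congruence modulo `p ^ r`
  let F : (Fin r → ℤ) → ((j : Fin r) → ZMod (p ^ (r - 1 - (j : ℕ)))) := fun x j =>
    (((∑ i, x i ^ ((j : ℕ) + 1) - c (j + 1)) / ((p ^ ((j : ℕ) + 1) : ℕ) : ℤ) : ℤ) :
      ZMod (p ^ (r - 1 - (j : ℕ))))
  have hfib : ∀ b ∈ (univ : Finset ((j : Fin r) → ZMod (p ^ (r - 1 - (j : ℕ))))),
      #{x ∈ S | F x = b} ≤ r ^ r := by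
    intro b _
    refine card_le_of_psum_modEq hp hpr _ (fun x hx => hdist x (mem_filter.1 hx).1)
      (fun x hx y hy => hinj x (mem_filter.1 hx).1 y (mem_filter.1 hy).1) ?_
    intro x hx y hy j hj hjr
    rw [mem_filter] at hx hy
    obtain ⟨j, rfl⟩ : ∃ i, j = i + 1 := ⟨j - 1, by omega⟩
    have hF : F x ⟨j, by omega⟩ = F y ⟨j, by omega⟩ := by rw [hx.2, hy.2]
    obtain ⟨d, hd⟩ := hsum x hx.1 (j + 1) hj hjr
    obtain ⟨d', hd'⟩ := hsum y hy.1 (j + 1) hj hjr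
    have hpj : ((p ^ (j + 1) : ℕ) : ℤ) ≠ 0 := by exact_mod_cast (hne (j + 1)).out
    simp only [F, hd, hd', Int.mul_ediv_cancel_left _ hpj] at hF
    rw [← sub_eq_zero, ← Int.cast_sub, ZMod.intCast_zmod_eq_zero_iff_dvd] at hF
    have e : ∑ i, x i ^ (j + 1) - ∑ i, y i ^ (j + 1) = ((p ^ (j + 1) : ℕ) : ℤ) * (d - d') := by
      rw [mul_sub, ← hd, ← hd']; ring
    rw [e]
    have e2 : p ^ r = p ^ (j + 1) * p ^ (r - 1 - j) := by rw [← pow_add]; congr 1; omega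
    rw [e2, Nat.cast_mul]
    exact mul_dvd_mul_left _ hF
  have h1 := card_le_mul_card_image_of_maps_to (s := S) (f := F) (fun x _ => mem_univ _) (r ^ r) hfib
  refine h1.trans (le_of_eq ?_)
  congr 1
  rw [card_univ, Fintype.card_pi]
  simp_rw [ZMod.card]
  rw [prod_pow_eq_pow_sum, Fin.sum_univ_eq_sum_range (fun j => r - 1 - j) r, sum_range_reflect
    (fun j => j) r, sum_range_id]

end Linnik

/-! ### Mean values: well-conditioned variables -/

/-- The point `(x, x², …, x ^ r)` of the moment curve. -/
def moments (r : ℕ) (x : ℤ) : Fin r → ℤ := fun j => x ^ ((j : ℕ) + 1)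

/-- Vinogradov's mean value: the number of pairs of `s`-tuples with entries in `{0, …, P - 1}` whose
power sums agree in the degrees `1, …, r`. -/
noncomputable def meanValue (s r P : ℕ) : ℕ :=
  energy fun x : Fin s → Fin P => ∑ i, moments r ((x i : ℕ) : ℤ)

/-- Cauchy–Schwarz for a cover of the domain by finitely many sets. -/
theorem energy_le_of_cover {β ι G : Type*} [Fintype β] [Fintype ι] (Ψ : β → G)
    (A : ι → β → Prop) [∀ i, DecidablePred (A i)] (hA : ∀ b, ∃ i, A i b) :
    energy Ψ ≤ Fintype.card ι * ∑ i, energy (fun b : {b // A i b} => Ψ b) := by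
  classical
  set T : Finset G := univ.image Ψ with hT
  have hmem : ∀ b, Ψ b ∈ T := fun b => mem_image_of_mem _ (mem_univ b)
  rw [energy_eq_sum Ψ T hmem]
  simp_rw [fun i => energy_eq_sum (fun b : {b // A i b} => Ψ b) T (fun b => hmem b)]
  rw [sum_comm, mul_sum]
  refine sum_le_sum fun g _ => ?_
  have h1 : #{b : β | Ψ b = g} ≤ ∑ i : ι, #{b : {b // A i b} | Ψ b = g} := by
    have h2 : ({b : β | Ψ b = g} : Finset β) ⊆
        (univ : Finset ι).biUnion fun i => (({b : {b // A i b} | Ψ b = g} : Finset _).map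
          (Function.Embedding.subtype _)) := by
      intro b hb
      obtain ⟨i, hi⟩ := hA b
      simp only [mem_filter, mem_univ, true_and] at hb
      simp only [mem_biUnion, mem_univ, true_and, mem_map, mem_filter]
      exact ⟨i, ⟨b, hi⟩, hb, rfl⟩
    refine (card_le_card h2).trans (card_biUnion_le.trans (le_of_eq ?_))
    simp
  calc #{b : β | Ψ b = g} ^ 2 ≤ (∑ i : ι, #{b : {b // A i b} | Ψ b = g}) ^ 2 :=
        Nat.pow_le_pow_left h1 2
    _ ≤ _ := by
        have := sq_sum_le_card_mul_sum_sq (s := (univ : Finset ι))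
          (f := fun i => #{b : {b // A i b} | Ψ b = g})
        simpa using this

/-- Translation invariance of the Vinogradov system. -/
theorem sum_pow_sub_eq {ι : Type*} [Fintype ι] {r : ℕ} (u v : ι → ℤ) (h : ℤ)
    (huv : ∀ j, 0 < j → j ≤ r → ∑ i, u i ^ j = ∑ i, v i ^ j) (j : ℕ) (hj : j ≤ r) :
    ∑ i, (u i - h) ^ j = ∑ i, (v i - h) ^ j := by
  have key : ∀ w : ι → ℤ, ∑ i, (w i - h) ^ j
      = ∑ m ∈ range (j + 1), (∑ i, w i ^ m) * ((-h) ^ (j - m) * (j.choose m : ℤ)) := by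
    intro w
    simp_rw [sub_eq_add_neg, add_pow, sum_mul]
    rw [sum_comm]
    simp_rw [mul_assoc]
  rw [key, key]
  refine sum_congr rfl fun m hm => ?_
  rcases Nat.eq_zero_or_pos m with rfl | hm0
  · simp
  · rw [huv m hm0 (by have := mem_range.1 hm; omega)]

/-- The `r`-tuples with entries in `{0, …, P - 1}` that are pairwise incongruent modulo `p`. -/
def IncongruentTuple (r P p : ℕ) : Type :=
  {x : Fin r → Fin P // ∀ i j, (p : ℤ) ∣ ((x i : ℕ) : ℤ) - ((x j : ℕ) : ℤ) → i = j}

noncomputable instance (r P p : ℕ) : Fintype (IncongruentTuple r P p) := by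
  classical exact inferInstanceAs (Fintype {x : Fin r → Fin P //
    ∀ i j, (p : ℤ) ∣ ((x i : ℕ) : ℤ) - ((x j : ℕ) : ℤ) → i = j})

theorem card_incongruentTuple_le (r P p : ℕ) :
    Fintype.card (IncongruentTuple r P p) ≤ P ^ r := by
  classical
  have := Fintype.card_le_of_injective (fun x : IncongruentTuple r P p => x.1)
    Subtype.val_injective
  simpa using this

/-- Linnik's lemma for pairs: the second tuple is free, the first then satisfies congruences modulo
`p ^ j` in each degree `j ≤ r`. -/
theorem card_incongruentTuple_pairs_le {r P p : ℕ} (hp : p.Prime) (hrp : r < p) (hP : P ≤ p ^ r)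
    (h : ℤ) (T : Finset (IncongruentTuple r P p × IncongruentTuple r P p))
    (hT : ∀ w ∈ T, ∀ j, 0 < j → j ≤ r → ((p ^ j : ℕ) : ℤ) ∣
      ∑ i, (((w.1.1 i : ℕ) : ℤ) - h) ^ j - ∑ i, (((w.2.1 i : ℕ) : ℤ) - h) ^ j) :
    #T ≤ r ^ r * p ^ (r * (r - 1) / 2) * P ^ r := by
  classical
  have hfib : ∀ b ∈ (univ : Finset (IncongruentTuple r P p)),
      #{w ∈ T | w.2 = b} ≤ r ^ r * p ^ (r * (r - 1) / 2) := by
    intro b _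
    have hinj : Set.InjOn (fun (w : IncongruentTuple r P p × IncongruentTuple r P p) (i : Fin r) =>
        ((w.1.1 i : ℕ) : ℤ) - h) ({w ∈ T | w.2 = b} : Finset _) := by
      intro w hw w' hw' hww
      simp only [coe_filter, Set.mem_ofPred_eq] at hw hw'
      refine Prod.ext (Subtype.ext (funext fun i => Fin.ext ?_)) (by rw [hw.2, hw'.2])
      have := congrFun hww i
      simp only [sub_left_inj, Nat.cast_inj] at this
      exact this
    rw [← card_image_of_injOn hinj]
    refine card_le_of_psum_modEq_pow hp hrp _ (fun j => ∑ i, (((b.1 i : ℕ) : ℤ) - h) ^ j) ?_ ?_ ?_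
    · intro x hx i j hij
      obtain ⟨w, _, rfl⟩ := mem_image.1 hx
      simp only [sub_sub_sub_cancel_right] at hij
      exact w.1.2 i j hij
    · intro x hx y hy i j hij
      obtain ⟨w, _, rfl⟩ := mem_image.1 hx
      obtain ⟨w', _, rfl⟩ := mem_image.1 hy
      simp only [sub_sub_sub_cancel_right] at hij
      have h1 := (w.1.1 i).2
      have h2 := (w'.1.1 j).2
      have := Int.eq_zero_of_abs_lt_dvd hij (by rw [abs_lt]; constructor <;> omega)
      dsimp only
      omega
    · intro x hx j hj hjr
      obtain ⟨w, hw, rfl⟩ := mem_image.1 hx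
      rw [mem_filter] at hw
      have := hT w hw.1 j hj hjr
      rwa [hw.2] at this
  have h1 := card_le_mul_card_image_of_maps_to (s := T) (f := fun w => w.2)
    (t := univ) (fun x _ => mem_univ _) _ hfib
  refine h1.trans ?_
  gcongr
  rw [card_univ]
  exact card_incongruentTuple_le r P p

/-- The contribution of one residue class `h` modulo `p`: translating by `h` and dividing by `p`
leaves a system of the same shape in shorter intervals, and congruences modulo `p ^ j` for the
well-conditioned variables. -/
theorem energy_residueClass_le {r P p : ℕ} (s : ℕ) (hp : p.Prime) (hrp : r < p) (hP : P ≤ p ^ r)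
    (h : ℕ) :
    energy (fun w : IncongruentTuple r P p × (Fin s → {x : Fin P // (x : ℕ) % p = h}) =>
      ∑ i, moments r ((w.1.1 i : ℕ) : ℤ) + ∑ i, moments r (((w.2 i : Fin P) : ℕ) : ℤ))
      ≤ r ^ r * p ^ (r * (r - 1) / 2) * P ^ r * meanValue s r (P / p + 1) := by
  classical
  let A := IncongruentTuple r P p
  let Y := Fin s → {x : Fin P // (x : ℕ) % p = h}
  let Φ : A → Fin r → ℤ := fun a => ∑ i, moments r (((a.1 i : ℕ) : ℤ) - h)
  let Θ : Y → Fin r → ℤ := fun x => ∑ i, moments r ((((x i : Fin P) : ℕ) : ℤ) - h)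
  have hΘ : ∀ (x : Y) (j : Fin r), Θ x j
      = (p : ℤ) ^ ((j : ℕ) + 1) * ∑ i, ((((x i : Fin P) : ℕ) / p : ℕ) : ℤ) ^ ((j : ℕ) + 1) := by
    intro x j
    simp only [Θ, Finset.sum_apply, moments]
    rw [mul_sum]
    refine sum_congr rfl fun i _ => ?_
    rw [← mul_pow]
    congr 1
    have h1 := Nat.div_add_mod ((x i : Fin P) : ℕ) p
    rw [(x i).2] at h1
    have h2 : (((x i : Fin P) : ℕ) : ℤ) = p * ((((x i : Fin P) : ℕ) / p : ℕ) : ℤ) + h := by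
      exact_mod_cast h1.symm
    rw [h2]; ring
  -- the system after translation by `h`
  have hshift : ∀ w w' : A × Y,
      ∑ i, moments r ((w.1.1 i : ℕ) : ℤ) + ∑ i, moments r (((w.2 i : Fin P) : ℕ) : ℤ)
        = ∑ i, moments r ((w'.1.1 i : ℕ) : ℤ) + ∑ i, moments r (((w'.2 i : Fin P) : ℕ) : ℤ) →
      Φ w.1 + Θ w.2 = Φ w'.1 + Θ w'.2 := by
    intro w w' hw
    have hs := sum_pow_sub_eq (r := r)
      (Sum.elim (fun i => ((w.1.1 i : ℕ) : ℤ)) (fun i => (((w.2 i : Fin P) : ℕ) : ℤ)))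
      (Sum.elim (fun i => ((w'.1.1 i : ℕ) : ℤ)) (fun i => (((w'.2 i : Fin P) : ℕ) : ℤ))) h
      (by
        intro j hj hjr
        have := congrFun hw ⟨j - 1, by omega⟩
        simpa [moments, Nat.sub_add_cancel hj] using this)
    ext j
    have := hs (j + 1) (by have := j.2; omega)
    simpa [Φ, Θ, moments] using this
  set W : Finset ((A × Y) × (A × Y)) := {w | Φ w.1.1 + Θ w.1.2 = Φ w.2.1 + Θ w.2.2} with hW
  have h0 : energy (fun w : A × Y =>
      ∑ i, moments r ((w.1.1 i : ℕ) : ℤ) + ∑ i, moments r (((w.2 i : Fin P) : ℕ) : ℤ)) ≤ #W := by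
    unfold energy
    refine card_le_card fun w hw => ?_
    simp only [mem_filter, mem_univ, true_and] at hw
    simp only [hW, mem_filter, mem_univ, true_and]
    exact hshift _ _ hw
  set T : Finset (A × A) := W.image (fun w => (w.1.1, w.2.1)) with hT
  have hTcard : #T ≤ r ^ r * p ^ (r * (r - 1) / 2) * P ^ r := by
    refine card_incongruentTuple_pairs_le hp hrp hP h T ?_
    intro t ht j hj hjr
    obtain ⟨w, hw, rfl⟩ := mem_image.1 ht
    simp only [hW, mem_filter, mem_univ, true_and] at hw
    have h1 := congrFun hw ⟨j - 1, by omega⟩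
    simp only [Pi.add_apply, hΘ] at h1
    simp only [Φ, moments, Finset.sum_apply, Nat.sub_add_cancel hj] at h1
    refine ⟨∑ i, ((((w.2.2 i : Fin P) : ℕ) / p : ℕ) : ℤ) ^ j
      - ∑ i, ((((w.1.2 i : Fin P) : ℕ) / p : ℕ) : ℤ) ^ j, ?_⟩
    push_cast at h1 ⊢
    linarith
  have hfib : ∀ t ∈ T, #{w ∈ W | (w.1.1, w.2.1) = t} ≤ meanValue s r (P / p + 1) := by
    intro t _
    have h1 : #{w ∈ W | (w.1.1, w.2.1) = t}
        ≤ #{x : Y × Y | Θ x.1 = Θ x.2 + (Φ t.2 - Φ t.1)} := by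
      refine card_le_card_of_injOn (fun w => (w.1.2, w.2.2)) ?_ ?_
      · intro w hw
        simp only [coe_filter, Set.mem_ofPred_eq, hW, mem_filter, mem_univ, true_and] at hw ⊢
        obtain ⟨h1, rfl⟩ := hw
        dsimp only
        rw [← add_sub_assoc, add_comm (Θ w.2.2), ← h1, add_sub_cancel_left]
      · rintro ⟨⟨a, x⟩, ⟨b, y⟩⟩ hw ⟨⟨a', x'⟩, ⟨b', y'⟩⟩ hw' hww
        simp only [coe_filter, Set.mem_ofPred_eq, hW, mem_filter, mem_univ, true_and] at hw hw'
        obtain ⟨_, rfl⟩ := hw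
        obtain ⟨_, h2⟩ := hw'
        simp only [Prod.mk.injEq] at hww h2 ⊢
        exact ⟨⟨h2.1.symm, hww.1⟩, h2.2.symm, hww.2⟩
    refine h1.trans ((card_shifted_le_energy Θ _).trans ?_)
    unfold meanValue
    refine energy_le_of_injective _ _
      (fun (x : Y) i => (⟨((x i : Fin P) : ℕ) / p,
        Nat.lt_succ_of_le (Nat.div_le_div_right (x i : Fin P).2.le)⟩ : Fin (P / p + 1))) ?_ ?_
    · intro x y hxy
      ext i
      have h1 := congrFun hxy i
      simp only [Fin.mk.injEq] at h1
      rw [← Nat.div_add_mod ((x i : Fin P) : ℕ) p, ← Nat.div_add_mod ((y i : Fin P) : ℕ) p, h1,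
        (x i).2, (y i).2]
    · intro x y hxy
      ext j
      have h1 := congrFun hxy j
      rw [hΘ, hΘ] at h1
      have h2 : (p : ℤ) ^ ((j : ℕ) + 1) ≠ 0 := pow_ne_zero _ (by exact_mod_cast hp.ne_zero)
      simpa [moments] using mul_left_cancel₀ h2 h1
  refine h0.trans ?_
  have h3 := card_le_mul_card_image_of_maps_to (s := W) (f := fun w => (w.1.1, w.2.1))
    (t := T) (fun w hw => mem_image_of_mem _ hw) _ hfib
  refine h3.trans ?_
  rw [mul_comm]
  gcongr

/-- The contribution of the solutions in which `r` of the variables are pairwise incongruent modulo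
`p`: by Hölder the other `s` variables may be taken in one residue class. -/
theorem energy_incongruent_le {r P p : ℕ} (s : ℕ) (hs : 0 < s) (hp : p.Prime) (hrp : r < p)
    (hP : P ≤ p ^ r) :
    energy (fun w : IncongruentTuple r P p × (Fin s → Fin P) =>
      ∑ i, moments r ((w.1.1 i : ℕ) : ℤ) + ∑ i, moments r ((w.2 i : ℕ) : ℤ))
      ≤ p ^ (2 * s) * (r ^ r * p ^ (r * (r - 1) / 2) * P ^ r * meanValue s r (P / p + 1)) := by
  classical
  let cls : Fin P → Fin p := fun x => ⟨(x : ℕ) % p, Nat.mod_lt _ hp.pos⟩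
  have h1 := energy_hoelder (fun a : IncongruentTuple r P p => ∑ i, moments r ((a.1 i : ℕ) : ℤ))
    (fun x : Fin P => moments r ((x : ℕ) : ℤ)) cls s hs
  refine h1.trans ?_
  rw [Fintype.card_fin]
  calc _ ≤ p ^ (2 * s - 1) * ∑ _h : Fin p,
        (r ^ r * p ^ (r * (r - 1) / 2) * P ^ r * meanValue s r (P / p + 1)) := by
        gcongr with h _
        refine le_trans ?_ (energy_residueClass_le s hp hrp hP h)
        refine energy_le_of_injective _ _
          (fun w => (w.1, fun i => ⟨(w.2 i).1, Fin.ext_iff.1 (w.2 i).2⟩)) ?_ ?_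
        · rintro ⟨a, x⟩ ⟨b, y⟩ h
          simp only [Prod.mk.injEq] at h
          refine Prod.ext h.1 (funext fun i => Subtype.ext ?_)
          have := congrFun h.2 i
          simp only [Subtype.mk.injEq] at this
          exact this
        · intro b b' h; exact h
    _ = _ := by
        rw [sum_const, card_univ, Fintype.card_fin, smul_eq_mul, ← mul_assoc, ← pow_succ]
        congr 2
        omega

/-! ### Mean values: auxiliary primes and the recursion -/

/-- `L` distinct primes in the interval `(y, 2 ^ L y]`, by Bertrand's postulate. -/
theorem exists_primes (y L : ℕ) (hy : 0 < y) :
    ∃ pr : Fin L → ℕ, Function.Injective pr ∧ ∀ i, (pr i).Prime ∧ y < pr i ∧ pr i ≤ 2 ^ L * y := by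
  have h : ∀ i : ℕ, ∃ p : ℕ, p.Prime ∧ 2 ^ i * y < p ∧ p ≤ 2 * (2 ^ i * y) := fun i =>
    Nat.exists_prime_lt_and_le_two_mul _ (by positivity)
  choose f hf1 hf2 hf3 using h
  have hmono : StrictMono f := strictMono_nat_of_lt_succ fun i => by
    refine (hf3 i).trans_lt ?_
    have := hf2 (i + 1)
    rwa [pow_succ', mul_assoc] at this
  refine ⟨fun i => f i, fun i j hij => Fin.ext (hmono.injective hij), fun i =>
    ⟨hf1 i, lt_of_le_of_lt ?_ (hf2 i), (hf3 i).trans ?_⟩⟩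
  · exact Nat.le_mul_of_pos_left _ (by positivity)
  · rw [← mul_assoc, ← pow_succ']
    exact Nat.mul_le_mul_right _ (Nat.pow_le_pow_right (by norm_num) i.2)

/-- Among `r ^ 3` primes exceeding `P ^ (1 / r)`, one separates any `r` distinct integers of
`{0, …, P - 1}`. -/
theorem exists_prime_incongruent {r P y L : ℕ} (hr : 0 < r) (hP : P ≤ y ^ r) (hL : r ^ 3 ≤ L)
    (hy : 0 < y)
    (pr : Fin L → ℕ) (hinj : Function.Injective pr) (hpr : ∀ i, (pr i).Prime ∧ y < pr i)
    (x : Fin r → Fin P) (hx : Function.Injective x) :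
    ∃ l, ∀ i j, (pr l : ℤ) ∣ ((x i : ℕ) : ℤ) - ((x j : ℕ) : ℤ) → i = j := by
  classical
  by_contra hcon
  push Not at hcon
  set O : Finset (Fin r × Fin r) := (univ : Finset (Fin r)).offDiag with hO
  set D : ℕ := ∏ t ∈ O, (((x t.1 : ℕ) : ℤ) - ((x t.2 : ℕ) : ℤ)).natAbs with hD
  have hD0 : D ≠ 0 := by
    rw [hD, prod_ne_zero_iff]
    intro t ht h0
    rw [hO, mem_offDiag] at ht
    apply ht.2.2
    apply hx
    apply Fin.ext
    omega
  have hDP : D ≤ P ^ (r ^ 2) := by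
    calc D ≤ ∏ _t ∈ O, P := by
          refine prod_le_prod' fun t _ => ?_
          have h1 := (x t.1).2
          have h2 := (x t.2).2
          omega
      _ = P ^ #O := by rw [prod_const]
      _ ≤ P ^ (r ^ 2) := by
          refine Nat.pow_le_pow_right ?_ ?_
          · exact (Nat.zero_le _).trans_lt (x ⟨0, hr⟩).2
          · rw [hO, offDiag_card, card_univ, Fintype.card_fin, sq]
            exact Nat.sub_le _ _
  have hdvd : ∏ l : Fin L, pr l ∣ D := by
    have himg : ∏ l : Fin L, pr l = ∏ q ∈ univ.image pr, q :=
      (prod_image (f := fun q => q) fun a _ b _ h => hinj h).symm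
    rw [himg]
    refine prod_primes_dvd _ (fun q hq => ?_) (fun q hq => ?_)
    · obtain ⟨l, _, rfl⟩ := mem_image.1 hq
      exact (hpr l).1.prime
    · obtain ⟨l, _, rfl⟩ := mem_image.1 hq
      obtain ⟨i, j, hij, hne⟩ := hcon l
      have h1 : pr l ∣ (((x i : ℕ) : ℤ) - ((x j : ℕ) : ℤ)).natAbs := Int.natCast_dvd.1 hij
      exact h1.trans (dvd_prod_of_mem (fun t : Fin r × Fin r =>
        (((x t.1 : ℕ) : ℤ) - ((x t.2 : ℕ) : ℤ)).natAbs)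
        (show (i, j) ∈ O from mem_offDiag.2 ⟨mem_univ _, mem_univ _, hne⟩))
  have hlow : y ^ L < ∏ l : Fin L, pr l := by
    have hLpos : 0 < L := lt_of_lt_of_le (by positivity) hL
    calc y ^ L = ∏ _l : Fin L, y := by simp
      _ < ∏ l : Fin L, pr l :=
        prod_lt_prod_of_nonempty (fun _ _ => hy) (fun l _ => (hpr l).2)
          ⟨⟨0, hLpos⟩, mem_univ _⟩
  have h1 := Nat.le_of_dvd (Nat.pos_of_ne_zero hD0) hdvd
  have h2 : P ^ (r ^ 2) ≤ y ^ L := by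
    calc P ^ (r ^ 2) ≤ (y ^ r) ^ (r ^ 2) := Nat.pow_le_pow_left hP _
      _ = y ^ (r ^ 3) := by rw [← pow_mul]; congr 1; ring
      _ ≤ y ^ L := Nat.pow_le_pow_right hy hL
  omega

/-- The `n`-tuples with at most `r` distinct entries number at most `r ^ n P ^ r`. -/
theorem card_few_values_le (n r P : ℕ) (hn : 0 < n) :
    #{x : Fin n → Fin P | #(univ.image x) < r + 1} ≤ r ^ n * P ^ r := by
  classical
  have hsub : ({x : Fin n → Fin P | #(univ.image x) < r + 1} : Finset _) ⊆
      (univ : Finset ((Fin n → Fin r) × (Fin r → Fin P))).image (fun t i => t.2 (t.1 i)) := by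
    intro x hx
    simp only [mem_filter, mem_univ, true_and, Nat.lt_succ_iff] at hx
    obtain ⟨f⟩ := Function.Embedding.nonempty_of_card_le
      (α := {v // v ∈ univ.image x}) (β := Fin r) (by rw [Fintype.card_coe, Fintype.card_fin]; exact hx)
    refine mem_image.2 ⟨(fun i => f ⟨x i, mem_image_of_mem _ (mem_univ i)⟩,
      Function.extend f Subtype.val (fun _ => x ⟨0, hn⟩)), mem_univ _, ?_⟩
    ext i
    dsimp only
    rw [f.injective.extend_apply]
  refine (card_le_card hsub).trans (card_image_le.trans (le_of_eq ?_))
  simp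

theorem energy_few_values_le (n r P : ℕ) (hn : 0 < n) {G : Type*} (Ψ : (Fin n → Fin P) → G) :
    energy (fun b : {x : Fin n → Fin P // #(univ.image x) < r + 1} => Ψ b)
      ≤ (r ^ n * P ^ r) ^ 2 := by
  refine (energy_le_card_sq _).trans (Nat.pow_le_pow_left ?_ 2)
  rw [Fintype.card_subtype]
  exact card_few_values_le n r P hn

/-- The recursive inequality of Linnik's method. The tuples with fewer than `r` distinct entries are
counted trivially; any other tuple has, for one of boundedly many choices of a prime `p` and of `r`
positions, entries at these positions that are pairwise incongruent modulo `p`. -/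
theorem meanValue_step (r s L : ℕ) (hr : 0 < r) (hs : 0 < s) (hL : r ^ 3 ≤ L) :
    ∃ n : ℕ, ∀ P y : ℕ, 0 < y → r ≤ y → P ≤ y ^ r → ∀ K : ℕ,
      (∀ p : ℕ, p.Prime → y < p → p ≤ 2 ^ L * y →
        p ^ (2 * s) * (r ^ r * p ^ (r * (r - 1) / 2) * P ^ r * meanValue s r (P / p + 1)) ≤ K) →
      meanValue (s + r) r P ≤ n * ((r ^ (s + r) * P ^ (r - 1)) ^ 2 + n * K) := by
  classical
  -- an element of `E` singles out the `r` positions, arranged as `Sum.inl`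
  let E := Fin r ⊕ Fin s ≃ Fin (s + r)
  obtain ⟨n, hn⟩ : ∃ n, n = Nat.card (Option (E × Fin L)) := ⟨_, rfl⟩
  have hn' : Nat.card (E × Fin L) ≤ n := by
    rw [hn, Finite.card_option]; exact Nat.le_succ _
  refine ⟨n, fun P y hy hry hPy K hK => ?_⟩
  obtain ⟨pr, hinj, hpr⟩ := exists_primes y L hy
  obtain ⟨A, hA0, hA1⟩ : ∃ A : Option (E × Fin L) → (Fin (s + r) → Fin P) → Prop,
      (∀ x, A none x ↔ #(univ.image x) < (r - 1) + 1) ∧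
      ∀ t x, A (some t) x ↔ ∀ i j, (pr t.2 : ℤ) ∣ ((x (t.1 (Sum.inl i)) : ℕ) : ℤ)
        - ((x (t.1 (Sum.inl j)) : ℕ) : ℤ) → i = j :=
    ⟨fun o x => match o with
      | none => #(univ.image x) < (r - 1) + 1
      | some t => ∀ i j, (pr t.2 : ℤ) ∣ ((x (t.1 (Sum.inl i)) : ℕ) : ℤ)
        - ((x (t.1 (Sum.inl j)) : ℕ) : ℤ) → i = j, fun _ => Iff.rfl, fun _ _ => Iff.rfl⟩
  have hA : ∀ x, ∃ o, A o x := by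
    intro x
    by_cases hx : #(univ.image x) < (r - 1) + 1
    · exact ⟨none, (hA0 x).2 hx⟩
    · have hx' : r ≤ #(univ.image x) := by omega
      obtain ⟨f⟩ := Function.Embedding.nonempty_of_card_le
        (α := Fin r) (β := {v // v ∈ univ.image x}) (by rw [Fintype.card_coe, Fintype.card_fin]; exact hx')
      have hpre : ∀ i : Fin r, ∃ a, x a = f i := fun i => by
        obtain ⟨a, _, ha⟩ := mem_image.1 (f i).2
        exact ⟨a, ha⟩
      choose g hg using hpre
      have hxg : Function.Injective (x ∘ g) := by
        intro i j hij
        simp only [Function.comp_apply, hg] at hij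
        exact f.injective (Subtype.ext hij)
      have hg' : Function.Injective g := fun i j hij => hxg (by simp [hij])
      obtain ⟨l, hl⟩ := exists_prime_incongruent hr hPy hL hy pr hinj
        (fun i => ⟨(hpr i).1, (hpr i).2.1⟩) (x ∘ g) hxg
      have hcard : Fintype.card (Fin r ⊕ Fin s) = Fintype.card (Fin (s + r)) := by
        simp [add_comm]
      obtain ⟨e, he⟩ : ∃ e : E, ∀ i, e (Sum.inl i) = g i := by
        obtain ⟨e, he⟩ := Set.MapsTo.exists_equiv_extend_of_card_eq (α := Fin r ⊕ Fin s)
          (t := (univ : Finset (Fin (s + r)))) (by simpa using hcard)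
          (s := Set.range Sum.inl) (f := Sum.elim g (fun _ => g ⟨0, hr⟩))
          (fun _ _ => by simp) (by
            rintro _ ⟨i, rfl⟩ _ ⟨j, rfl⟩ hij
            simp only [Sum.elim_inl] at hij
            rw [hg' hij])
        refine ⟨e.trans (Equiv.subtypeUnivEquiv (fun x => mem_univ x)), fun i => ?_⟩
        exact he (Sum.inl i) ⟨i, rfl⟩
      refine ⟨some (e, l), (hA1 _ _).2 ?_⟩
      intro i j hij
      rw [he, he] at hij
      exact hl i j hij
  have hbound : ∀ t : E × Fin L, energy (fun b : {x // A (some t) x} =>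
      ∑ i, moments r ((b.1 i : ℕ) : ℤ)) ≤ K := by
    intro t
    obtain ⟨hp, hyp, hpL⟩ := hpr t.2
    refine le_trans ?_ (hK (pr t.2) hp hyp hpL)
    refine le_trans ?_ (energy_incongruent_le (r := r) (P := P) s hs hp (by omega)
      (hPy.trans (Nat.pow_le_pow_left hyp.le _)))
    refine energy_le_of_injective _ _ (fun b => (⟨fun i => b.1 (t.1 (Sum.inl i)), (hA1 _ _).1 b.2⟩,
      fun i => b.1 (t.1 (Sum.inr i)))) ?_ ?_
    · intro b b' h
      have h1 := congrArg Prod.fst h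
      have h2 := congrArg Prod.snd h
      refine Subtype.ext (funext fun a => ?_)
      obtain ⟨c, rfl⟩ := t.1.surjective a
      rcases c with i | i
      · exact congrFun (congrArg Subtype.val h1) i
      · exact congrFun h2 i
    · intro b b' h
      have e : ∀ b : Fin (s + r) → Fin P, ∑ i, moments r ((b i : ℕ) : ℤ)
          = ∑ i, moments r ((b (t.1 (Sum.inl i)) : ℕ) : ℤ)
            + ∑ i, moments r ((b (t.1 (Sum.inr i)) : ℕ) : ℤ) := by
        intro b
        rw [← Equiv.sum_comp t.1, Fintype.sum_sum_type]
      rw [e, e] at h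
      exact h
  have h1 := energy_le_of_cover (fun x : Fin (s + r) → Fin P => ∑ i, moments r ((x i : ℕ) : ℤ)) A hA
  rw [← Nat.card_eq_fintype_card, ← hn, Fintype.sum_option] at h1
  refine h1.trans (Nat.mul_le_mul_left _ (add_le_add ?_ ?_))
  · have h2 := energy_few_values_le (s + r) (r - 1) P (by omega)
      (fun x : Fin (s + r) → Fin P => ∑ i, moments r ((x i : ℕ) : ℤ))
    have h3 : energy (fun b : {x // A none x} => ∑ i, moments r ((b.1 i : ℕ) : ℤ))
        ≤ energy (fun b : {x : Fin (s + r) → Fin P // #(univ.image x) < r - 1 + 1} =>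
          ∑ i, moments r ((b.1 i : ℕ) : ℤ)) :=
      energy_le_of_injective _ _ (fun b => ⟨b.1, (hA0 _).1 b.2⟩)
        (fun b b' h => Subtype.ext (Subtype.mk.inj h)) (fun b b' h => h)
    have h4 : ((r - 1) ^ (s + r) * P ^ (r - 1)) ^ 2 ≤ (r ^ (s + r) * P ^ (r - 1)) ^ 2 :=
      Nat.pow_le_pow_left (Nat.mul_le_mul_right _ (Nat.pow_le_pow_left (Nat.sub_le _ _) _)) _
    exact h3.trans (h2.trans h4)
  · refine (sum_le_sum fun t _ => hbound t).trans ?_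
    rw [sum_const, card_univ, smul_eq_mul, ← Nat.card_eq_fintype_card]
    exact Nat.mul_le_mul_right _ hn'

/-! ### Vinogradov's mean value theorem -/

/-- One step of Linnik's method reduces the excess `η` over the conjectured exponent `2 s - κ` by
the factor `1 - 1 / r`, at the cost of `r` further variables. The condition `r ^ 2 ≤ s` makes the
tuples with few distinct entries negligible. -/
theorem meanValue_step_rpow (r s : ℕ) (hr : 0 < r) (hs : r ^ 2 ≤ s) (κ η C : ℝ)
    (hκ : κ = r * (r + 1) / 2) (hη0 : 0 ≤ η) (hηκ : η ≤ κ) (hC : 0 < C)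
    (h : ∀ P : ℕ, 0 < P → (meanValue s r P : ℝ) ≤ C * (P : ℝ) ^ (2 * s - κ + η)) :
    ∃ C' : ℝ, 0 < C' ∧ ∀ P : ℕ, 0 < P →
      (meanValue (s + r) r P : ℝ) ≤ C' * (P : ℝ) ^ (2 * (s + r) - κ + η * (1 - 1 / r)) := by
  have hr1 : (1 : ℝ) ≤ r := by exact_mod_cast hr
  have hsr : (r : ℝ) ^ 2 ≤ s := by exact_mod_cast hs
  have hκr : κ ≤ (r : ℝ) ^ 2 := by rw [hκ]; nlinarith
  set L := r ^ 3 with hL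
  set E : ℝ := 2 * s - κ + η with hE
  set F : ℝ := 2 * (s + r) - κ + η * (1 - 1 / r) with hF
  set K₀ : ℝ := 2 ^ L * (2 * r) with hK₀
  have hK₀pos : 0 < K₀ := by positivity
  have hE0 : 0 ≤ E := by nlinarith
  have hηr : 0 ≤ η * (1 - 1 / r) := by
    apply mul_nonneg hη0
    rw [sub_nonneg, div_le_one (by linarith)]
    exact hr1
  have hs0 : 0 < s := lt_of_lt_of_le (by positivity) hs
  obtain ⟨n, hn⟩ := meanValue_step r s L hr hs0 le_rfl
  set C₁ : ℝ := r ^ r * C * (1 + K₀) ^ E * K₀ ^ ((r : ℝ) ^ 2 - η) with hC₁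
  have hC₁pos : 0 < C₁ := by
    have : 0 < 1 + K₀ := by linarith
    positivity
  refine ⟨n * ((r : ℝ) ^ (2 * (s + r)) + n * C₁) + 1, by positivity, fun P hP => ?_⟩
  have hP1 : (1 : ℝ) ≤ P := by exact_mod_cast hP
  have hP0 : (0 : ℝ) < P := by linarith
  -- the primes have size `P ^ (1 / r)` up to a constant, so that `p ^ r` exceeds `P`
  set X : ℝ := (P : ℝ) ^ (1 / (r : ℝ)) with hX
  have hX1 : 1 ≤ X := Real.one_le_rpow hP1 (by positivity)
  have hXP : X ≤ P := by
    calc X ≤ (P : ℝ) ^ (1 : ℝ) := by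
          apply Real.rpow_le_rpow_of_exponent_le hP1
          rw [div_le_one (by linarith)]; exact hr1
      _ = P := Real.rpow_one _
  have hXr : X ^ r = P := by
    rw [hX, ← Real.rpow_natCast, ← Real.rpow_mul hP0.le, one_div_mul_cancel (by positivity),
      Real.rpow_one]
  -- the factor `r` ensures that the primes above `y` exceed `r`
  set y : ℕ := r * ⌈X⌉₊ with hy
  have hceil : X ≤ (⌈X⌉₊ : ℝ) := Nat.le_ceil X
  have hceil2 : (⌈X⌉₊ : ℝ) ≤ 2 * X := by
    have := (Nat.ceil_lt_add_one (by linarith : 0 ≤ X)).le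
    linarith
  have hceil0 : 0 < ⌈X⌉₊ := Nat.ceil_pos.2 (by linarith)
  have hXy : X ≤ y := by
    rw [hy]; push_cast
    nlinarith
  have hyX : (y : ℝ) ≤ 2 * r * X := by
    rw [hy]; push_cast
    nlinarith
  have hPy : P ≤ y ^ r := by
    have : (P : ℝ) ≤ (y : ℝ) ^ r := by
      rw [← hXr]; gcongr
    exact_mod_cast this
  have hF2 : 2 * ((r : ℝ) - 1) ≤ F := by
    rw [hF]; nlinarith
  have key := hn P y (by positivity) (Nat.le_mul_of_pos_right _ hceil0) hPy
    ⌊C₁ * (P : ℝ) ^ F⌋₊ (by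
      intro p hp hyp hpy
      apply Nat.le_floor
      push_cast
      have hXp : X ≤ p := hXy.trans (by exact_mod_cast hyp.le)
      have hpX : (p : ℝ) ≤ K₀ * X := by
        have : (p : ℝ) ≤ 2 ^ L * y := by exact_mod_cast hpy
        refine this.trans ?_
        rw [hK₀, mul_assoc]
        gcongr
      have hp0 : (0 : ℝ) < p := by linarith
      have hV : (meanValue s r (P / p + 1) : ℝ) ≤ C * ((1 + K₀) * (P / p)) ^ E := by
        refine (h _ (Nat.succ_pos _)).trans ?_
        gcongr
        have h1 : (((P / p : ℕ) : ℝ)) ≤ (P : ℝ) / p := Nat.cast_div_le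
        have h2 : 1 ≤ K₀ * (P / p) := by
          rw [← mul_div_assoc, one_le_div hp0]
          exact hpX.trans (by gcongr)
        push_cast
        linarith
      have hexp : ((r * (r - 1) / 2 : ℕ) : ℝ) = (r : ℝ) ^ 2 - κ := by
        have h2 : 2 * (r * (r - 1) / 2) = r * (r - 1) :=
          Nat.mul_div_cancel' (Nat.even_mul_pred_self r).two_dvd
        have h3 : (2 : ℝ) * ((r * (r - 1) / 2 : ℕ) : ℝ) = r * (r - 1) := by
          rw [← Nat.cast_pred hr]
          exact_mod_cast h2
        rw [hκ]; linarith
      calc (p : ℝ) ^ (2 * s) * ((r : ℝ) ^ r * (p : ℝ) ^ (r * (r - 1) / 2) * (P : ℝ) ^ r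
            * (meanValue s r (P / p + 1) : ℝ))
          ≤ (p : ℝ) ^ (2 * s) * ((r : ℝ) ^ r * (p : ℝ) ^ (r * (r - 1) / 2) * (P : ℝ) ^ r
            * (C * ((1 + K₀) * (P / p)) ^ E)) := by gcongr
        _ = (r : ℝ) ^ r * C * (1 + K₀) ^ E * (p : ℝ) ^ ((r : ℝ) ^ 2 - η)
            * (P : ℝ) ^ ((r : ℝ) + E) := by
          have e1 : (p : ℝ) ^ ((r : ℝ) ^ 2 - η)
              = (p : ℝ) ^ (2 * s) * (p : ℝ) ^ (r * (r - 1) / 2) / (p : ℝ) ^ E := by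
            rw [← Real.rpow_natCast (p : ℝ) (2 * s), ← Real.rpow_natCast (p : ℝ) (r * (r - 1) / 2),
              ← Real.rpow_add hp0, ← Real.rpow_sub hp0, hexp, hE]
            congr 1
            push_cast; ring
          rw [e1, Real.rpow_add hP0, Real.rpow_natCast, Real.mul_rpow (by positivity) (by positivity),
            Real.div_rpow hP0.le hp0.le]
          ring
        _ ≤ (r : ℝ) ^ r * C * (1 + K₀) ^ E * (K₀ * X) ^ ((r : ℝ) ^ 2 - η)
            * (P : ℝ) ^ ((r : ℝ) + E) := by
          gcongr
          linarith
        _ = C₁ * (P : ℝ) ^ F := by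
          have e2 : (P : ℝ) ^ F = X ^ ((r : ℝ) ^ 2 - η) * (P : ℝ) ^ ((r : ℝ) + E) := by
            rw [hX, ← Real.rpow_mul hP0.le, ← Real.rpow_add hP0]
            congr 1
            rw [hF, hE]
            field_simp
            ring
          rw [e2, Real.mul_rpow hK₀pos.le (by linarith), hC₁]
          ring)
  have key' : (meanValue (s + r) r P : ℝ)
      ≤ n * (((r : ℝ) ^ (s + r) * (P : ℝ) ^ (r - 1)) ^ 2 + n * (⌊C₁ * (P : ℝ) ^ F⌋₊ : ℝ)) := by
    exact_mod_cast key
  have hfl : (⌊C₁ * (P : ℝ) ^ F⌋₊ : ℝ) ≤ C₁ * (P : ℝ) ^ F := Nat.floor_le (by positivity)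
  have hfew : ((P : ℝ) ^ (r - 1)) ^ 2 ≤ (P : ℝ) ^ F := by
    rw [← pow_mul, ← Real.rpow_natCast]
    apply Real.rpow_le_rpow_of_exponent_le hP1
    push_cast
    rw [Nat.cast_pred hr]
    linarith
  calc (meanValue (s + r) r P : ℝ)
      ≤ n * (((r : ℝ) ^ (s + r) * (P : ℝ) ^ (r - 1)) ^ 2 + n * (⌊C₁ * (P : ℝ) ^ F⌋₊ : ℝ)) := key'
    _ ≤ n * ((r : ℝ) ^ (2 * (s + r)) * (P : ℝ) ^ F + n * (C₁ * (P : ℝ) ^ F)) := by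
        gcongr
        rw [mul_pow, ← pow_mul, mul_comm (s + r) 2]
        gcongr
    _ = n * ((r : ℝ) ^ (2 * (s + r)) + n * C₁) * (P : ℝ) ^ F := by ring
    _ ≤ _ := by
        gcongr
        linarith

/-- Vinogradov's mean value theorem, in the form given by `m` steps of Linnik's method starting from
the trivial bound for `r ^ 2` variables. -/
theorem meanValue_le (r : ℕ) (hr : 0 < r) (m : ℕ) :
    ∃ C : ℝ, 0 < C ∧ ∀ P : ℕ, 0 < P → (meanValue (r * (r + m)) r P : ℝ)
      ≤ C * (P : ℝ) ^ (2 * ((r * (r + m) : ℕ) : ℝ) - r * (r + 1) / 2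
        + (r * (r + 1) / 2) * (1 - 1 / (r : ℝ)) ^ m) := by
  have hr1 : (1 : ℝ) ≤ r := by exact_mod_cast hr
  induction m with
  | zero =>
    refine ⟨1, one_pos, fun P _ => ?_⟩
    have h1 := energy_le_card_sq
      (fun x : Fin (r * (r + 0)) → Fin P => ∑ i, moments r ((x i : ℕ) : ℤ))
    simp only [Fintype.card_pi, Fintype.card_fin, prod_const, card_univ] at h1
    have h2 : (meanValue (r * (r + 0)) r P : ℝ) ≤ ((P : ℝ) ^ (r * (r + 0))) ^ 2 := by
      exact_mod_cast h1
    refine h2.trans (le_of_eq ?_)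
    rw [← pow_mul, ← Real.rpow_natCast, one_mul]
    congr 1
    push_cast
    ring
  | succ m ih =>
    obtain ⟨C, hC, h⟩ := ih
    have hθ0 : 0 ≤ 1 - 1 / (r : ℝ) := by
      rw [sub_nonneg, div_le_one (by linarith)]; exact hr1
    have hθ1 : 1 - 1 / (r : ℝ) ≤ 1 := by
      have : 0 ≤ 1 / (r : ℝ) := by positivity
      linarith
    obtain ⟨C', hC', h'⟩ := meanValue_step_rpow r (r * (r + m)) hr (by nlinarith) _
      ((r * (r + 1) / 2) * (1 - 1 / (r : ℝ)) ^ m) C rfl (by positivity)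
      (mul_le_of_le_one_right (by positivity) (pow_le_one₀ hθ0 hθ1)) hC h
    refine ⟨C', hC', fun P hP => ?_⟩
    have e : r * (r + (m + 1)) = r * (r + m) + r := by ring
    rw [e]
    refine (h' P hP).trans (le_of_eq ?_)
    congr 2
    push_cast
    ring

/-! ### Double exponential sums and mean values -/

/-- The difference of the power sums, in degrees `1, …, r`, of two `s`-tuples. -/
def momentDiff (r s P : ℕ) (w : (Fin s → Fin P) × (Fin s → Fin P)) : Fin r → ℤ :=
  ∑ i, moments r ((w.1 i : ℕ) : ℤ) - ∑ i, moments r ((w.2 i : ℕ) : ℤ)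

/-- Each vector is attained by `momentDiff` at most `meanValue s r P` times, and only vectors in the
box `∏ⱼ [-s Pʲ, s Pʲ]` are attained. -/
theorem sum_momentDiff_le {r s P : ℕ} (f : (Fin r → ℤ) → ℝ) (hf : ∀ u, 0 ≤ f u)
    (I : Fin r → Finset ℤ)
    (hI : ∀ j : Fin r, Icc (-((s * P ^ ((j : ℕ) + 1) : ℕ) : ℤ)) ((s * P ^ ((j : ℕ) + 1) : ℕ) : ℤ) ⊆ I j) :
    ∑ w, f (momentDiff r s P w) ≤ meanValue s r P * ∑ u ∈ Fintype.piFinset I, f u := by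
  classical
  have hmem : ∀ w ∈ (univ : Finset ((Fin s → Fin P) × (Fin s → Fin P))),
      momentDiff r s P w ∈ Fintype.piFinset I := by
    intro w _
    rw [Fintype.mem_piFinset]
    intro j
    apply hI j
    have hb : ∀ x : Fin s → Fin P, 0 ≤ ∑ i, ((x i : ℕ) : ℤ) ^ ((j : ℕ) + 1) ∧
        ∑ i, ((x i : ℕ) : ℤ) ^ ((j : ℕ) + 1) ≤ ((s * P ^ ((j : ℕ) + 1) : ℕ) : ℤ) := by
      intro x
      refine ⟨sum_nonneg fun i _ => by positivity, ?_⟩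
      calc ∑ i, ((x i : ℕ) : ℤ) ^ ((j : ℕ) + 1) ≤ ∑ _i : Fin s, (P : ℤ) ^ ((j : ℕ) + 1) := by
            gcongr with i _
            exact_mod_cast (x i).2.le
        _ = _ := by simp
    have h1 := hb w.1
    have h2 := hb w.2
    simp only [momentDiff, moments, Pi.sub_apply, Finset.sum_apply, mem_Icc]
    constructor <;> linarith [h1.1, h1.2, h2.1, h2.2]
  rw [← sum_fiberwise_of_maps_to hmem, mul_sum]
  refine sum_le_sum fun u _ => ?_
  rw [sum_congr rfl (g := fun _ => f u) (fun w hw => by rw [(mem_filter.1 hw).2]), sum_const,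
    nsmul_eq_mul]
  refine mul_le_mul_of_nonneg_right ?_ (hf u)
  have h := card_shifted_le_energy
    (fun x : Fin s → Fin P => ∑ i, moments r ((x i : ℕ) : ℤ)) u
  have e : ({w | momentDiff r s P w = u} : Finset ((Fin s → Fin P) × (Fin s → Fin P)))
      = ({w | ∑ i, moments r ((w.1 i : ℕ) : ℤ) = ∑ i, moments r ((w.2 i : ℕ) : ℤ) + u} :
        Finset ((Fin s → Fin P) × (Fin s → Fin P))) := by
    ext w
    simp only [mem_filter, mem_univ, true_and, momentDiff, sub_eq_iff_eq_add']
  rw [e]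
  exact_mod_cast h

section DoubleSum

variable {q : ℕ} [NeZero q]

local notation "ψ" => (ZMod.stdAddChar : AddChar (ZMod q) ℂ)

/-- The linear combination `v ↦ ψ (∑ⱼ bⱼ vⱼ)` as an additive character. -/
noncomputable def linChar {r : ℕ} (b : Fin r → ZMod q) : AddChar (Fin r → ZMod q) ℂ where
  toFun v := ψ (∑ j, b j * v j)
  map_zero_eq_one' := by simp
  map_add_eq_mul' u v := by
    simp only [Pi.add_apply, mul_add, sum_add_distrib, AddChar.map_add_eq_mul]

theorem norm_pow_eq_sum_momentDiff {r : ℕ} (s P : ℕ) (b : Fin r → ZMod q) :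
    ((‖∑ y : Fin P, ψ (∑ j, b j * ((y : ℕ) : ZMod q) ^ ((j : ℕ) + 1))‖ ^ (2 * s) : ℝ) : ℂ)
      = ∑ w, ψ (∑ j, b j * (momentDiff r s P w j : ZMod q)) := by
  set φ : Fin P → Fin r → ZMod q := fun y j => ((y : ℕ) : ZMod q) ^ ((j : ℕ) + 1) with hφ
  have h1 := sum_addChar_prod_pi (α := Unit) (fun _ => (0 : Fin r → ZMod q)) φ s (linChar b)
  have h2 : ∑ x : Fin s → Fin P, linChar b (∑ i, φ (x i)) = (∑ y, linChar b (φ y)) ^ s := by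
    rw [← univ_product_univ, sum_product] at h1
    simpa using h1
  have h3 := norm_sq_sum_addChar (linChar b) (fun x : Fin s → Fin P => ∑ i, φ (x i))
  rw [h2, norm_pow, ← pow_mul, mul_comm s 2] at h3
  refine h3.trans (sum_congr rfl fun w _ => ?_)
  change ψ _ = ψ _
  congr 1
  refine sum_congr rfl fun j _ => ?_
  congr 1
  simp [momentDiff, moments, φ]

/-- Double Hölder and completion: the sum over `x, y` of `ψ (∑ aⱼ xʲ yʲ)` is controlled by the mean
value and by the one-dimensional bilinear forms `∑_v ‖∑_u ψ (aⱼ u v)‖`. -/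
theorem norm_double_sum_pow_le {r : ℕ} (s P : ℕ) (hs : 0 < s) (a : Fin r → ZMod q)
    (I : Fin r → Finset ℤ)
    (hI : ∀ j : Fin r, Icc (-((s * P ^ ((j : ℕ) + 1) : ℕ) : ℤ)) ((s * P ^ ((j : ℕ) + 1) : ℕ) : ℤ) ⊆ I j) :
    ‖∑ y : Fin P, ∑ x : Fin P,
        ψ (∑ j, a j * ((y : ℕ) : ZMod q) ^ ((j : ℕ) + 1) * ((x : ℕ) : ZMod q) ^ ((j : ℕ) + 1))‖
        ^ (2 * s * (2 * s))
      ≤ ((P : ℝ) ^ (2 * s - 1)) ^ (2 * s) * (((P : ℝ) ^ (2 * s)) ^ (2 * s - 1)) *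
        ((meanValue s r P : ℝ) * ((meanValue s r P : ℝ) *
          ∏ j : Fin r, ∑ v ∈ Icc (-((s * P ^ ((j : ℕ) + 1) : ℕ) : ℤ)) ((s * P ^ ((j : ℕ) + 1) : ℕ) : ℤ),
            ‖∑ u ∈ I j, ψ (a j * (u : ZMod q) * (v : ZMod q))‖)) := by
  classical
  set S := ∑ y : Fin P, ∑ x : Fin P,
    ψ (∑ j, a j * ((y : ℕ) : ZMod q) ^ ((j : ℕ) + 1) * ((x : ℕ) : ZMod q) ^ ((j : ℕ) + 1)) with hS
  set g : (Fin r → ℤ) → ℂ := fun u =>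
    ∑ y : Fin P, ψ (∑ j, a j * (u j : ZMod q) * ((y : ℕ) : ZMod q) ^ ((j : ℕ) + 1)) with hg
  have e2 : 2 * s = (2 * s - 1) + 1 := by omega
  have holder : ∀ {ι : Type} [Fintype ι] (f : ι → ℝ), (∀ i, 0 ≤ f i) →
      (∑ i, f i) ^ (2 * s) ≤ (Fintype.card ι : ℝ) ^ (2 * s - 1) * ∑ i, f i ^ (2 * s) := by
    intro ι _ f hf
    have := pow_sum_le_card_mul_sum_pow (s := (univ : Finset ι)) (f := f) (fun i _ => hf i)
      (2 * s - 1)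
    rw [← e2] at this
    simpa using this
  -- Hölder in `y`, then expansion of the power of the sum over `x`
  have step1 : ‖S‖ ^ (2 * s) ≤ (P : ℝ) ^ (2 * s - 1) * ∑ w, ‖g (momentDiff r s P w)‖ := by
    have h1 : ‖S‖ ^ (2 * s) ≤ (P : ℝ) ^ (2 * s - 1) * ∑ y : Fin P, ‖∑ x : Fin P,
        ψ (∑ j, a j * ((y : ℕ) : ZMod q) ^ ((j : ℕ) + 1) * ((x : ℕ) : ZMod q) ^ ((j : ℕ) + 1))‖
          ^ (2 * s) := by
      refine (pow_le_pow_left₀ (norm_nonneg _) (norm_sum_le _ _) _).trans ?_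
      have := holder (fun y : Fin P => ‖∑ x : Fin P,
        ψ (∑ j, a j * ((y : ℕ) : ZMod q) ^ ((j : ℕ) + 1) * ((x : ℕ) : ZMod q) ^ ((j : ℕ) + 1))‖)
        (fun _ => norm_nonneg _)
      simpa using this
    refine h1.trans (mul_le_mul_of_nonneg_left ?_ (by positivity))
    have h2 : ((∑ y : Fin P, ‖∑ x : Fin P,
        ψ (∑ j, a j * ((y : ℕ) : ZMod q) ^ ((j : ℕ) + 1) * ((x : ℕ) : ZMod q) ^ ((j : ℕ) + 1))‖
          ^ (2 * s) : ℝ) : ℂ) = ∑ w, g (momentDiff r s P w) := by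
      rw [Complex.ofReal_sum]
      simp_rw [norm_pow_eq_sum_momentDiff s P]
      rw [sum_comm]
      refine sum_congr rfl fun w _ => sum_congr rfl fun y _ => ?_
      congr 1
      refine sum_congr rfl fun j _ => ?_
      ring
    have h3 := congrArg norm h2
    rw [Complex.norm_of_nonneg (sum_nonneg fun _ _ => by positivity)] at h3
    rw [h3]
    exact norm_sum_le _ _
  -- Hölder once more, and completion to all `u` in the box
  have step2 : (∑ w, ‖g (momentDiff r s P w)‖) ^ (2 * s)
      ≤ ((P : ℝ) ^ (2 * s)) ^ (2 * s - 1) * ∑ w, ‖g (momentDiff r s P w)‖ ^ (2 * s) := by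
    have := holder (fun w => ‖g (momentDiff r s P w)‖) (fun _ => norm_nonneg _)
    have hc : (Fintype.card ((Fin s → Fin P) × (Fin s → Fin P)) : ℝ) = (P : ℝ) ^ (2 * s) := by
      simp [two_mul, pow_add]
    rwa [hc] at this
  have step3 : ∑ w, ‖g (momentDiff r s P w)‖ ^ (2 * s)
      ≤ meanValue s r P * ∑ u ∈ Fintype.piFinset I, ‖g u‖ ^ (2 * s) :=
    sum_momentDiff_le (fun u => ‖g u‖ ^ (2 * s)) (fun _ => by positivity) I hI
  -- expansion of the power of the sum over `y`; the sums over the coordinates `uⱼ` now separate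
  have step4 : ∑ u ∈ Fintype.piFinset I, ‖g u‖ ^ (2 * s)
      ≤ ∑ w, ∏ j : Fin r, ‖∑ u ∈ I j, ψ (a j * (u : ZMod q) * (momentDiff r s P w j : ZMod q))‖ := by
    have h2 : ((∑ u ∈ Fintype.piFinset I, ‖g u‖ ^ (2 * s) : ℝ) : ℂ)
        = ∑ w, ∏ j : Fin r, ∑ u ∈ I j, ψ (a j * (u : ZMod q) * (momentDiff r s P w j : ZMod q)) := by
      rw [Complex.ofReal_sum]
      simp_rw [hg, norm_pow_eq_sum_momentDiff s P]
      rw [sum_comm]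
      refine sum_congr rfl fun w _ => ?_
      rw [prod_univ_sum]
      refine sum_congr rfl fun u _ => ?_
      have h : ∀ (J : Finset (Fin r)) (f : Fin r → ZMod q), ψ (∑ i ∈ J, f i) = ∏ i ∈ J, ψ (f i) := by
        intro J f
        induction J using Finset.induction_on with
        | empty => simp
        | insert i J hi ih => rw [sum_insert hi, prod_insert hi, AddChar.map_add_eq_mul, ih]
      rw [h]
    have h3 := congrArg norm h2
    rw [Complex.norm_of_nonneg (sum_nonneg fun _ _ => by positivity)] at h3
    rw [h3]
    refine (norm_sum_le _ _).trans (le_of_eq ?_)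
    simp_rw [norm_prod]
  have step5 : ∑ w, ∏ j : Fin r, ‖∑ u ∈ I j, ψ (a j * (u : ZMod q) * (momentDiff r s P w j : ZMod q))‖
      ≤ meanValue s r P *
        ∏ j : Fin r, ∑ v ∈ Icc (-((s * P ^ ((j : ℕ) + 1) : ℕ) : ℤ)) ((s * P ^ ((j : ℕ) + 1) : ℕ) : ℤ),
            ‖∑ u ∈ I j, ψ (a j * (u : ZMod q) * (v : ZMod q))‖ := by
    rw [prod_univ_sum]
    exact sum_momentDiff_le
      (fun v => ∏ j : Fin r, ‖∑ u ∈ I j, ψ (a j * (u : ZMod q) * (v j : ZMod q))‖)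
      (fun _ => by positivity) _ (fun j => subset_rfl)
  rw [pow_mul]
  calc (‖S‖ ^ (2 * s)) ^ (2 * s)
      ≤ ((P : ℝ) ^ (2 * s - 1) * ∑ w, ‖g (momentDiff r s P w)‖) ^ (2 * s) := by gcongr
    _ = ((P : ℝ) ^ (2 * s - 1)) ^ (2 * s) * (∑ w, ‖g (momentDiff r s P w)‖) ^ (2 * s) := by
        rw [mul_pow]
    _ ≤ ((P : ℝ) ^ (2 * s - 1)) ^ (2 * s) * (((P : ℝ) ^ (2 * s)) ^ (2 * s - 1) *
          ∑ w, ‖g (momentDiff r s P w)‖ ^ (2 * s)) := by gcongr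
    _ ≤ ((P : ℝ) ^ (2 * s - 1)) ^ (2 * s) * (((P : ℝ) ^ (2 * s)) ^ (2 * s - 1) *
          (meanValue s r P * (meanValue s r P *
        ∏ j : Fin r, ∑ v ∈ Icc (-((s * P ^ ((j : ℕ) + 1) : ℕ) : ℤ)) ((s * P ^ ((j : ℕ) + 1) : ℕ) : ℤ),
            ‖∑ u ∈ I j, ψ (a j * (u : ZMod q) * (v : ZMod q))‖))) := by
        gcongr
        exact step3.trans (mul_le_mul_of_nonneg_left (step4.trans step5) (by positivity))
    _ = _ := by ring

end DoubleSum

/-! ### Completion and Korobov's estimate -/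

section Completion

variable {q : ℕ} [NeZero q]

local notation "ψ" => (ZMod.stdAddChar : AddChar (ZMod q) ℂ)

/-- Orthogonality over an interval whose length is a multiple of the additive order of `a`. -/
theorem norm_sum_interval_le (a : ZMod q) (t v : ℤ) (m : ℕ) :
    ‖∑ u ∈ Ico t (t + (addOrderOf a * m : ℕ)), ψ (a * (u : ZMod q) * (v : ZMod q))‖
      ≤ if (addOrderOf a : ℤ) ∣ v then ((addOrderOf a * m : ℕ) : ℝ) else 0 := by
  split_ifs with hv
  · refine (norm_sum_le _ _).trans ?_
    simp only [AddChar.norm_apply, sum_const, Int.card_Ico, nsmul_eq_mul, mul_one,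
      add_sub_cancel_left, Int.toNat_natCast, le_refl]
  · have himg : Ico t (t + (addOrderOf a * m : ℕ))
        = (range (addOrderOf a * m)).image (fun i : ℕ => t + (i : ℤ)) := by
      ext u
      simp only [mem_Ico, mem_image, mem_range]
      constructor
      · intro h; exact ⟨(u - t).toNat, by omega, by omega⟩
      · rintro ⟨i, hi, rfl⟩; omega
    rw [himg, sum_image (fun i _ j _ h => by simpa using h)]
    have hz : ∀ i : ℕ, ψ (a * ((t + (i : ℤ) : ℤ) : ZMod q) * (v : ZMod q))
        = ψ (a * (t : ZMod q) * (v : ZMod q)) * ψ (a * (v : ZMod q)) ^ i := by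
      intro i
      rw [← AddChar.map_nsmul_eq_pow, ← AddChar.map_add_eq_mul]
      congr 1
      push_cast
      rw [nsmul_eq_mul]; ring
    simp_rw [hz]
    rw [← mul_sum]
    have hne : ψ (a * (v : ZMod q)) ≠ 1 := by
      intro h
      apply hv
      rw [addOrderOf_dvd_iff_zsmul_eq_zero, zsmul_eq_mul, mul_comm]
      exact ZMod.injective_stdAddChar (h.trans (AddChar.map_zero_eq_one _).symm)
    have hpow : ψ (a * (v : ZMod q)) ^ (addOrderOf a * m) = 1 := by
      rw [← AddChar.map_nsmul_eq_pow, mul_nsmul, ← smul_mul_assoc,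
        addOrderOf_nsmul_eq_zero, zero_mul, smul_zero, AddChar.map_zero_eq_one]
    have hgeom : ∑ i ∈ range (addOrderOf a * m), ψ (a * (v : ZMod q)) ^ i = 0 := by
      have := geom_sum_mul (ψ (a * (v : ZMod q))) (addOrderOf a * m)
      rw [hpow, sub_self] at this
      exact (mul_eq_zero.1 this).resolve_right (sub_ne_zero.2 hne)
    rw [hgeom]; simp

theorem card_multiples_le (d U : ℕ) (hd : 0 < d) :
    #{v ∈ Icc (-(U : ℤ)) U | (d : ℤ) ∣ v} ≤ 2 * (U / d) + 1 := by
  have h : #{v ∈ Icc (-(U : ℤ)) U | (d : ℤ) ∣ v}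
      ≤ #(Icc (-((U / d : ℕ) : ℤ)) ((U / d : ℕ) : ℤ)) := by
    refine card_le_card_of_injOn (fun v => v / d) ?_ ?_
    · intro v hv
      simp only [coe_filter, mem_Icc, Set.mem_ofPred_eq] at hv
      obtain ⟨⟨h1, h2⟩, k, rfl⟩ := hv
      have hd' : (0 : ℤ) < d := by exact_mod_cast hd
      simp only [coe_Icc, Set.mem_Icc]
      rw [Int.mul_ediv_cancel_left _ hd'.ne']
      push_cast
      have h3 : k ≤ (U : ℤ) / d := by
        rw [Int.le_ediv_iff_mul_le hd']; linarith [mul_comm (d : ℤ) k]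
      have h4 : -k ≤ (U : ℤ) / d := by
        rw [Int.le_ediv_iff_mul_le hd']; linarith [mul_comm (d : ℤ) k]
      exact ⟨by linarith, h3⟩
    · intro v hv w hw hvw
      simp only [coe_filter, mem_Icc, Set.mem_ofPred_eq] at hv hw
      obtain ⟨_, k, rfl⟩ := hv
      obtain ⟨_, l, rfl⟩ := hw
      have hd' : (d : ℤ) ≠ 0 := by exact_mod_cast hd.ne'
      simp only [Int.mul_ediv_cancel_left _ hd'] at hvw
      rw [hvw]
  refine h.trans (le_of_eq ?_)
  rw [Int.card_Icc]
  omega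

/-- If the additive order of `a` lies between `b` and `b ^ 3`, lengthening the range of `u` to a
multiple of the order saves a factor `b` over the trivial bound `b ^ 4` for the bilinear form. -/
theorem sum_norm_completed_le (a : ZMod q) (s b : ℕ) (hs : 0 < s) (hb : 0 < b)
    (h1 : b ≤ addOrderOf a) (h2 : addOrderOf a ≤ b ^ 3) :
    ∃ I : Finset ℤ, Icc (-((s * b ^ 2 : ℕ) : ℤ)) ((s * b ^ 2 : ℕ) : ℤ) ⊆ I ∧
      (∑ v ∈ Icc (-((s * b ^ 2 : ℕ) : ℤ)) ((s * b ^ 2 : ℕ) : ℤ),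
        ‖∑ u ∈ I, ψ (a * (u : ZMod q) * (v : ZMod q))‖) * b ≤ 12 * (s : ℝ) ^ 2 * (b : ℝ) ^ 4 := by
  set d := addOrderOf a with hd
  have hd0 : 0 < d := by omega
  set U := s * b ^ 2 with hU
  set m := (2 * U + 1) / d + 1 with hm
  have hdm1 : 2 * U + 1 < d * m := by
    rw [hm]; exact Nat.lt_mul_div_succ _ hd0
  have hdm2 : d * m ≤ 2 * U + 1 + d := by
    rw [hm, mul_add, mul_one]
    exact Nat.add_le_add_right (Nat.mul_div_le _ _) _
  refine ⟨Ico (-(U : ℤ)) (-(U : ℤ) + (d * m : ℕ)), ?_, ?_⟩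
  · intro u hu
    rw [mem_Icc] at hu
    rw [mem_Ico]
    omega
  · have hsum : ∑ v ∈ Icc (-(U : ℤ)) (U : ℤ),
        ‖∑ u ∈ Ico (-(U : ℤ)) (-(U : ℤ) + (d * m : ℕ)), ψ (a * (u : ZMod q) * (v : ZMod q))‖
        ≤ (2 * (U / d : ℝ) + 1) * (2 * U + 1 + d) := by
      refine (sum_le_sum fun v _ => norm_sum_interval_le a (-(U : ℤ)) v m).trans ?_
      rw [← sum_filter, sum_const, nsmul_eq_mul, ← hd]
      have h3 := card_multiples_le d U hd0
      have h4 : ((#{v ∈ Icc (-(U : ℤ)) U | (d : ℤ) ∣ v} : ℕ) : ℝ) ≤ 2 * (U / d : ℝ) + 1 := by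
        have h5 : (((U / d : ℕ)) : ℝ) ≤ (U : ℝ) / d := Nat.cast_div_le
        have h6 : ((#{v ∈ Icc (-(U : ℤ)) U | (d : ℤ) ∣ v} : ℕ) : ℝ) ≤ 2 * ((U / d : ℕ) : ℝ) + 1 := by
          exact_mod_cast h3
        linarith
      have h7 : ((d * m : ℕ) : ℝ) ≤ 2 * U + 1 + d := by exact_mod_cast hdm2
      gcongr
    refine (mul_le_mul_of_nonneg_right hsum (by positivity)).trans ?_
    have hs1 : (1 : ℝ) ≤ s := by exact_mod_cast hs
    have hb1 : (1 : ℝ) ≤ b := by exact_mod_cast hb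
    have hd1 : (b : ℝ) ≤ d := by exact_mod_cast h1
    have hd2 : (d : ℝ) ≤ (b : ℝ) ^ 3 := by exact_mod_cast h2
    have hdp : (0 : ℝ) < d := by linarith
    have hUr : (U : ℝ) = s * (b : ℝ) ^ 2 := by rw [hU]; push_cast; ring
    have hU0 : (0 : ℝ) ≤ U := by positivity
    have hbd : (b : ℝ) / d ≤ 1 := by rw [div_le_one hdp]; exact hd1
    have e : (2 * (U / d : ℝ) + 1) * (2 * U + 1 + d) * b
        = (4 * (U : ℝ) ^ 2 + 2 * U) * (b / d) + 4 * U * b + b + d * b := by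
      field_simp; ring
    rw [e]
    have hX1 : (b : ℝ) ≤ (s : ℝ) ^ 2 * (b : ℝ) ^ 4 := by
      calc (b : ℝ) = 1 * (b : ℝ) ^ 1 := by ring
        _ ≤ _ := by
          gcongr
          · exact one_le_pow₀ hs1
          · norm_num
    have hX2 : (U : ℝ) * b ≤ (s : ℝ) ^ 2 * (b : ℝ) ^ 4 := by
      calc (U : ℝ) * b = (s : ℝ) ^ 1 * (b : ℝ) ^ 3 := by rw [hUr]; ring
        _ ≤ _ := by
          gcongr
          · norm_num
          · norm_num
    have hX3 : (U : ℝ) ≤ U * b := le_mul_of_one_le_right hU0 hb1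
    have hX4 : (d : ℝ) * b ≤ (s : ℝ) ^ 2 * (b : ℝ) ^ 4 := by
      calc (d : ℝ) * b ≤ (b : ℝ) ^ 3 * b := by gcongr
        _ = 1 * (b : ℝ) ^ 4 := by ring
        _ ≤ _ := by
          gcongr
          exact one_le_pow₀ hs1
    have hX5 : (U : ℝ) ^ 2 = (s : ℝ) ^ 2 * (b : ℝ) ^ 4 := by rw [hUr]; ring
    have hX6 : (4 * (U : ℝ) ^ 2 + 2 * U) * (b / d) ≤ 4 * (U : ℝ) ^ 2 + 2 * U :=
      mul_le_of_le_one_right (by positivity) hbd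
    linarith

theorem sum_norm_trivial_le (a : ZMod q) (s b : ℕ) (hs : 0 < s) (hb : 0 < b) :
    (∑ v ∈ Icc (-((s * b ^ 2 : ℕ) : ℤ)) ((s * b ^ 2 : ℕ) : ℤ),
        ‖∑ u ∈ Icc (-((s * b ^ 2 : ℕ) : ℤ)) ((s * b ^ 2 : ℕ) : ℤ),
          ψ (a * (u : ZMod q) * (v : ZMod q))‖) ≤ 12 * (s : ℝ) ^ 2 * (b : ℝ) ^ 4 := by
  set U := s * b ^ 2 with hU
  have hU1 : 1 ≤ U := Nat.mul_pos hs (pow_pos hb 2)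
  have hcard : ((#(Icc (-(U : ℤ)) (U : ℤ)) : ℕ) : ℝ) ≤ 3 * U := by
    rw [Int.card_Icc]
    have : ((U : ℤ) + 1 - -(U : ℤ)).toNat ≤ 3 * U := by omega
    exact_mod_cast this
  calc _ ≤ ∑ _v ∈ Icc (-(U : ℤ)) (U : ℤ), (3 * U : ℝ) := by
        refine sum_le_sum fun v _ => (norm_sum_le _ _).trans ?_
        simp only [AddChar.norm_apply, sum_const, nsmul_eq_mul, mul_one]
        exact hcard
    _ ≤ 3 * U * (3 * U) := by
        rw [sum_const, nsmul_eq_mul]; gcongr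
    _ = 9 * (s : ℝ) ^ 2 * (b : ℝ) ^ 4 := by rw [hU]; push_cast; ring
    _ ≤ _ := by gcongr; norm_num

/-- Korobov's estimate for double sums: each coefficient `aⱼ` whose additive order lies between
`B ^ j` and `B ^ (3 j)` gains a factor `B ^ j` over the trivial bound. -/
theorem exists_double_sum_bound (r : ℕ) (hr : 0 < r) (m s : ℕ) (hsm : s = r * (r + m)) :
    ∃ C : ℝ, 0 < C ∧ ∀ (q : ℕ) [NeZero q] (B : ℕ), 0 < B → ∀ (a : Fin r → ZMod q)
      (good : Finset (Fin r)),
      (∀ j ∈ good, B ^ ((j : ℕ) + 1) ≤ addOrderOf (a j) ∧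
        addOrderOf (a j) ≤ (B ^ ((j : ℕ) + 1)) ^ 3) →
      ‖∑ y : Fin (B ^ 2), ∑ x : Fin (B ^ 2), (ZMod.stdAddChar : AddChar (ZMod q) ℂ)
        (∑ j, a j * ((y : ℕ) : ZMod q) ^ ((j : ℕ) + 1) * ((x : ℕ) : ZMod q) ^ ((j : ℕ) + 1))‖
        ^ (2 * s * (2 * s)) * (B : ℝ) ^ (∑ j ∈ good, ((j : ℕ) + 1))
      ≤ C * (B : ℝ) ^ (16 * (s : ℝ) ^ 2 + 4 * ((r * (r + 1) / 2) * (1 - 1 / (r : ℝ)) ^ m)) := by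
  classical
  obtain ⟨C, hC, hV⟩ := meanValue_le r hr m
  have hs : 0 < s := by rw [hsm]; positivity
  rw [← hsm] at hV
  refine ⟨C ^ 2 * (12 * (s : ℝ) ^ 2) ^ r, by positivity, ?_⟩
  intro q _ B hB a good hgood
  set η : ℝ := (r * (r + 1) / 2) * (1 - 1 / (r : ℝ)) ^ m with hη
  have hB0 : (0 : ℝ) < B := by exact_mod_cast hB
  -- completed intervals at the good indices, the original ones elsewhere
  have hI : ∀ j : Fin r, ∃ I : Finset ℤ,
      Icc (-((s * (B ^ 2) ^ ((j : ℕ) + 1) : ℕ) : ℤ)) ((s * (B ^ 2) ^ ((j : ℕ) + 1) : ℕ) : ℤ) ⊆ I ∧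
      (∑ v ∈ Icc (-((s * (B ^ 2) ^ ((j : ℕ) + 1) : ℕ) : ℤ)) ((s * (B ^ 2) ^ ((j : ℕ) + 1) : ℕ) : ℤ),
        ‖∑ u ∈ I, (ZMod.stdAddChar : AddChar (ZMod q) ℂ) (a j * (u : ZMod q) * (v : ZMod q))‖)
        * (if j ∈ good then (B : ℝ) ^ ((j : ℕ) + 1) else 1)
        ≤ 12 * (s : ℝ) ^ 2 * ((B : ℝ) ^ ((j : ℕ) + 1)) ^ 4 := by
    intro j
    have e : (B ^ 2) ^ ((j : ℕ) + 1) = (B ^ ((j : ℕ) + 1)) ^ 2 := by rw [← pow_mul, ← pow_mul, mul_comm]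
    rw [e]
    split_ifs with hj
    · have := sum_norm_completed_le (a j) s (B ^ ((j : ℕ) + 1)) hs (by positivity)
        (hgood j hj).1 (hgood j hj).2
      rw [Nat.cast_pow] at this
      exact this
    · refine ⟨_, subset_rfl, ?_⟩
      have := sum_norm_trivial_le (a j) s (B ^ ((j : ℕ) + 1)) hs (by positivity)
      rw [Nat.cast_pow] at this
      rw [mul_one]
      exact this
  choose I hI1 hI2 using hI
  have h1 := norm_double_sum_pow_le s (B ^ 2) hs a I hI1
  have h2 := hV (B ^ 2) (by positivity)
  set V : ℝ := (meanValue s r (B ^ 2) : ℝ) with hVdef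
  set S := ∑ y : Fin (B ^ 2), ∑ x : Fin (B ^ 2), (ZMod.stdAddChar : AddChar (ZMod q) ℂ)
        (∑ j, a j * ((y : ℕ) : ZMod q) ^ ((j : ℕ) + 1) * ((x : ℕ) : ZMod q) ^ ((j : ℕ) + 1))
  set Δ : Fin r → ℝ := fun j => ∑ v ∈ Icc (-((s * (B ^ 2) ^ ((j : ℕ) + 1) : ℕ) : ℤ))
    ((s * (B ^ 2) ^ ((j : ℕ) + 1) : ℕ) : ℤ),
        ‖∑ u ∈ I j, (ZMod.stdAddChar : AddChar (ZMod q) ℂ) (a j * (u : ZMod q) * (v : ZMod q))‖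
    with hΔ
  have hΔ0 : ∀ j, 0 ≤ Δ j := fun j => sum_nonneg fun _ _ => norm_nonneg _
  have hprod : (∏ j, Δ j) * (B : ℝ) ^ (∑ j ∈ good, ((j : ℕ) + 1))
      ≤ (12 * (s : ℝ) ^ 2) ^ r * (B : ℝ) ^ (2 * (r * (r + 1))) := by
    have e1 : (B : ℝ) ^ (∑ j ∈ good, ((j : ℕ) + 1))
        = ∏ j : Fin r, (if j ∈ good then (B : ℝ) ^ ((j : ℕ) + 1) else 1) := by
      rw [prod_ite_mem, univ_inter, prod_pow_eq_pow_sum]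
    rw [e1, ← prod_mul_distrib]
    refine (prod_le_prod (fun j _ => mul_nonneg (hΔ0 j) (by split_ifs <;> positivity))
      (fun j _ => hI2 j)).trans (le_of_eq ?_)
    rw [prod_mul_distrib, prod_const, card_univ, Fintype.card_fin, prod_pow, prod_pow_eq_pow_sum,
      ← pow_mul]
    congr 2
    rw [Fin.sum_univ_eq_sum_range (fun j => j + 1) r]
    have h3 : ∑ j ∈ range r, (j + 1) = ∑ j ∈ range (r + 1), j := by
      rw [sum_range_succ']; simp
    have h4 := sum_range_id_mul_two (r + 1)
    rw [h3]
    simp only [Nat.add_sub_cancel] at h4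
    linarith [mul_comm r (r + 1)]
  have hP : ((B ^ 2 : ℕ) : ℝ) = (B : ℝ) ^ 2 := by push_cast; ring
  rw [hP] at h1 h2
  have hVnn : 0 ≤ V := by positivity
  calc ‖S‖ ^ (2 * s * (2 * s)) * (B : ℝ) ^ (∑ j ∈ good, ((j : ℕ) + 1))
      ≤ ((((B : ℝ) ^ 2) ^ (2 * s - 1)) ^ (2 * s) * ((((B : ℝ) ^ 2) ^ (2 * s)) ^ (2 * s - 1)) *
        (V * (V * ∏ j, Δ j))) * (B : ℝ) ^ (∑ j ∈ good, ((j : ℕ) + 1)) := by gcongr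
    _ = (B : ℝ) ^ (2 * (2 * (2 * s - 1) * (2 * s))) * (V ^ 2 *
        ((∏ j, Δ j) * (B : ℝ) ^ (∑ j ∈ good, ((j : ℕ) + 1)))) := by ring
    _ ≤ (B : ℝ) ^ (2 * (2 * (2 * s - 1) * (2 * s))) *
        ((C * ((B : ℝ) ^ 2) ^ (2 * (s : ℝ) - r * (r + 1) / 2 + η)) ^ 2 *
        ((12 * (s : ℝ) ^ 2) ^ r * (B : ℝ) ^ (2 * (r * (r + 1))))) := by
        have := prod_nonneg (fun j (_ : j ∈ (univ : Finset (Fin r))) => hΔ0 j)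
        gcongr
    _ = C ^ 2 * (12 * (s : ℝ) ^ 2) ^ r * ((B : ℝ) ^ (2 * (2 * (2 * s - 1) * (2 * s))) *
        (((B : ℝ) ^ 2) ^ (2 * (s : ℝ) - r * (r + 1) / 2 + η)) ^ 2 *
          (B : ℝ) ^ (2 * (r * (r + 1)))) := by ring
    _ = _ := by
        congr 1
        rw [← Real.rpow_natCast (B : ℝ) 2, ← Real.rpow_mul hB0.le,
          ← Real.rpow_natCast ((B : ℝ) ^ _) 2, ← Real.rpow_mul hB0.le,
          ← Real.rpow_natCast (B : ℝ) (2 * (r * (r + 1))),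
          ← Real.rpow_natCast (B : ℝ) (2 * (2 * (2 * s - 1) * (2 * s))),
          ← Real.rpow_add hB0, ← Real.rpow_add hB0]
        congr 1
        have : ((2 * s - 1 : ℕ) : ℝ) = 2 * s - 1 := by
          rw [Nat.cast_sub (by omega)]; push_cast; ring
        push_cast
        rw [this]
        ring

end Completion

/-! ### Kloosterman sums modulo prime powers -/

/-- The Kloosterman sum as a sum over the units of `ZMod q`. -/
noncomputable def klSum (q : ℕ) [NeZero q] (μ a : ZMod q) : ℂ :=
  (1 / (Real.sqrt q : ℂ)) *
    ∑ u : (ZMod q)ˣ, (ZMod.stdAddChar : AddChar (ZMod q) ℂ) (μ * u + a * (u⁻¹ : (ZMod q)ˣ))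

theorem kloostermanSum_eq_klSum (q : ℕ) [NeZero q] (m a : ℤ) :
    kloostermanSum m a q = klSum q (m : ZMod q) (a : ZMod q) := by
  unfold kloostermanSum klSum
  congr 1
  symm
  refine sum_bij (fun u _ => (u : ZMod q).val) ?_ ?_ ?_ ?_
  · intro u _
    rw [mem_filter, mem_range]
    exact ⟨ZMod.val_lt _, ZMod.val_coe_unit_coprime u⟩
  · intro u _ v _ h
    exact Units.ext (ZMod.val_injective q h)
  · intro b hb
    rw [mem_filter, mem_range] at hb
    refine ⟨ZMod.unitOfCoprime b hb.2, mem_univ _, ?_⟩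
    rw [ZMod.coe_unitOfCoprime, ZMod.val_natCast_of_lt hb.1]
  · intro u _
    have h1 : (m : ZMod q) * u + (a : ZMod q) * ((u⁻¹ : (ZMod q)ˣ) : ZMod q)
        = ((m * ((u : ZMod q).val : ℤ) + a * (modInv q (u : ZMod q).val : ℤ) : ℤ) : ZMod q) := by
      push_cast
      rw [ZMod.natCast_zmod_val]
      congr 2
      unfold modInv
      rw [ZMod.natCast_zmod_val, ZMod.natCast_zmod_val, ZMod.inv_coe_unit]
    rw [h1, ZMod.stdAddChar_coe]
    unfold e
    congr 1
    push_cast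
    ring

theorem natCast_pow_eq_zero_of_le {p k i : ℕ} (hi : k ≤ i) : (p : ZMod (p ^ k)) ^ i = 0 := by
  rw [← Nat.cast_pow, ZMod.natCast_eq_zero_iff]
  exact pow_dvd_pow p hi

theorem norm_sqrt_factor_mul_sqrt_factor (p k : ℕ) :
    ‖(1 / (Real.sqrt ((p ^ k : ℕ) : ℝ) : ℂ))‖ * ‖(1 / (Real.sqrt ((p ^ k : ℕ) : ℝ) : ℂ))‖
      = 1 / ((p : ℝ) ^ k) := by
  rw [norm_div, norm_one, Complex.norm_real, Real.norm_of_nonneg (Real.sqrt_nonneg _),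
    div_mul_div_comm, one_mul, Real.mul_self_sqrt (by positivity)]
  push_cast
  rfl

section PrimePower

variable {p k : ℕ} [NeZero (p ^ k)]

local notation "R" => ZMod (p ^ k)
local notation "ψ" => (ZMod.stdAddChar : AddChar (ZMod (p ^ k)) ℂ)

theorem isUnit_or_eq_prime_mul (hp : p.Prime) (x : R) :
    IsUnit x ∨ ∃ y, x = p * y := by
  have hx : ((x.val : ℕ) : R) = x := ZMod.natCast_zmod_val x
  by_cases h : p ∣ x.val
  · right
    obtain ⟨c, hc⟩ := h
    exact ⟨c, by rw [← hx, hc]; push_cast; ring⟩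
  · left
    rw [← hx, ZMod.isUnit_iff_coprime]
    exact ((hp.coprime_iff_not_dvd.2 h).symm).pow_right k

theorem not_isUnit_prime_mul (hp : p.Prime) (hk : 0 < k) (y : R) : ¬ IsUnit ((p : R) * y) := by
  intro h
  have h1 : IsUnit ((p : R) ^ k) := (isUnit_of_mul_isUnit_left h).pow k
  rw [natCast_pow_eq_zero_of_le le_rfl] at h1
  have : Fact (1 < p ^ k) := ⟨Nat.one_lt_pow hk.ne' hp.one_lt⟩
  exact not_isUnit_zero h1

/-- The units `u` near which the phase `μ u + a / u` is stationary to precision `p ^ l`. -/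
noncomputable def stationary (p k l : ℕ) [NeZero (p ^ k)] (μ a : ZMod (p ^ k)) :
    Finset (ZMod (p ^ k))ˣ := by
  classical
  exact {u : (ZMod (p ^ k))ˣ | (p : ZMod (p ^ k)) ^ (k - l) * (μ * u - a * (u⁻¹ : (ZMod (p ^ k))ˣ)) = 0}

theorem mem_stationary {l : ℕ} {μ a : R} {u : Rˣ} : u ∈ stationary p k l μ a ↔
    (p : R) ^ (k - l) * (μ * u - a * (u⁻¹ : Rˣ)) = 0 := by
  classical
  unfold stationary
  simp

/-- Stationary phase: only the stationary units contribute. -/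
theorem sum_units_eq_sum_stationary {l : ℕ} (hl : 2 * l ≤ k) (μ a : R) (γ : Rˣ) :
    ∑ u : Rˣ, ψ (γ * (μ * u + a * (u⁻¹ : Rˣ)))
      = ∑ u ∈ stationary p k l μ a, ψ (γ * (μ * u + a * (u⁻¹ : Rˣ))) := by
  classical
  set ε : R := (p : R) ^ (k - l) with hε
  have hεε : ε * ε = 0 := by
    rw [hε, ← pow_add]
    exact natCast_pow_eq_zero_of_le (by omega)
  let w : R → Rˣ := fun y => ⟨1 + ε * y, 1 - ε * y, by linear_combination (-y ^ 2) * hεε,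
    by linear_combination (-y ^ 2) * hεε⟩
  have hshift : ∀ y : R, ∑ u : Rˣ, ψ (γ * (μ * u + a * (u⁻¹ : Rˣ)))
      = ∑ u : Rˣ, ψ (γ * (μ * u + a * (u⁻¹ : Rˣ)))
          * ψ (y * (γ * (ε * (μ * u - a * (u⁻¹ : Rˣ))))) := by
    intro y
    rw [← Equiv.sum_comp (Equiv.mulRight (w y))]
    refine sum_congr rfl fun u _ => ?_
    rw [← AddChar.map_add_eq_mul]
    congr 1
    have e1 : ((u * w y : Rˣ) : R) = u * (1 + ε * y) := rfl
    have e2 : (((u * w y)⁻¹ : Rˣ) : R) = (1 - ε * y) * (u⁻¹ : Rˣ) := by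
      rw [mul_inv_rev]; rfl
    rw [Equiv.coe_mulRight, e1, e2]
    ring
  have hsum : (Fintype.card R : ℂ) * ∑ u : Rˣ, ψ (γ * (μ * u + a * (u⁻¹ : Rˣ)))
      = (Fintype.card R : ℂ) *
        ∑ u ∈ stationary p k l μ a, ψ (γ * (μ * u + a * (u⁻¹ : Rˣ))) := by
    calc (Fintype.card R : ℂ) * ∑ u : Rˣ, ψ (γ * (μ * u + a * (u⁻¹ : Rˣ)))
        = ∑ _y : R, ∑ u : Rˣ, ψ (γ * (μ * u + a * (u⁻¹ : Rˣ))) := by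
          rw [sum_const, nsmul_eq_mul, card_univ]
      _ = ∑ y : R, ∑ u : Rˣ, ψ (γ * (μ * u + a * (u⁻¹ : Rˣ)))
          * ψ (y * (γ * (ε * (μ * u - a * (u⁻¹ : Rˣ))))) := sum_congr rfl fun y _ => hshift y
      _ = ∑ u : Rˣ, ψ (γ * (μ * u + a * (u⁻¹ : Rˣ)))
          * ∑ y : R, ψ (y * (γ * (ε * (μ * u - a * (u⁻¹ : Rˣ))))) := by
          rw [sum_comm]; simp_rw [mul_sum]
      _ = ∑ u : Rˣ, if u ∈ stationary p k l μ a then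
            (Fintype.card R : ℂ) * ψ (γ * (μ * u + a * (u⁻¹ : Rˣ))) else 0 := by
          refine sum_congr rfl fun u _ => ?_
          rw [AddChar.sum_mulShift _ (ZMod.isPrimitive_stdAddChar _)]
          simp only [mem_stationary, Units.mul_right_eq_zero, ← hε]
          split_ifs
          · ring
          · simp
      _ = _ := by
          rw [← sum_filter, mul_sum]
          congr 1
          ext u; simp
  have hc : (Fintype.card R : ℂ) ≠ 0 := by
    rw [Nat.cast_ne_zero]; exact Fintype.card_ne_zero
  exact mul_left_cancel₀ hc hsum

/-- Multiplying the argument by a square only rescales the phase at the stationary units. -/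
theorem klSum_mul_sq {l : ℕ} (hl : 2 * l ≤ k) (μ a : R) (γ : Rˣ) :
    klSum (p ^ k) (μ * (γ : R) ^ 2) a = (1 / (Real.sqrt ((p ^ k : ℕ) : ℝ) : ℂ)) *
      ∑ u ∈ stationary p k l μ a, ψ (γ * (μ * u + a * (u⁻¹ : Rˣ))) := by
  unfold klSum
  rw [← sum_units_eq_sum_stationary hl]
  congr 1
  rw [← Equiv.sum_comp (Equiv.mulRight γ⁻¹)]
  refine sum_congr rfl fun u _ => ?_
  congr 1
  rw [Equiv.coe_mulRight, mul_inv_rev, inv_inv]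
  push_cast
  have h : (γ : R) * ((γ⁻¹ : Rˣ) : R) = 1 := Units.mul_inv γ
  linear_combination (μ * γ * u) * h

theorem card_mul_pow_eq_zero_le (hp : p.Prime) {l : ℕ} (hl : l ≤ k) :
    #{x : R | (p : R) ^ (k - l) * x = 0} ≤ p ^ (k - l) := by
  classical
  rw [← card_range (p ^ (k - l))]
  have hdvd : ∀ x : R, (p : R) ^ (k - l) * x = 0 → p ^ l ∣ x.val := by
    intro x hx
    have h1 : ((p ^ (k - l) * x.val : ℕ) : R) = 0 := by
      push_cast; rw [ZMod.natCast_zmod_val]; exact hx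
    rw [ZMod.natCast_eq_zero_iff] at h1
    have h2 : p ^ k = p ^ (k - l) * p ^ l := by rw [← pow_add]; congr 1; omega
    replace h1 := h2.symm.dvd.trans h1
    exact Nat.dvd_of_mul_dvd_mul_left (pow_pos hp.pos _) h1
  refine card_le_card_of_injOn (fun x => x.val / p ^ l) ?_ ?_
  · intro x _
    rw [coe_range, Set.mem_Iio]
    apply Nat.div_lt_of_lt_mul
    rw [← pow_add]
    have := ZMod.val_lt x
    rwa [show l + (k - l) = k by omega]
  · intro x hx y hy hxy
    simp only [coe_filter, mem_univ, true_and, Set.mem_ofPred_eq] at hx hy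
    apply ZMod.val_injective
    rw [← Nat.div_mul_cancel (hdvd x hx), ← Nat.div_mul_cancel (hdvd y hy)]
    exact congrArg (· * p ^ l) hxy

/-- Stationary units satisfy `μ u² ≡ a` modulo `p ^ l`, which has at most two roots as `p` is odd.
-/
theorem card_stationary_le (hp : p.Prime) (hodd : Odd p) (hk : 0 < k) {l : ℕ} (hl : l ≤ k)
    (μ : R) {a : R} (ha : IsUnit a) : #(stationary p k l μ a) ≤ 2 * p ^ (k - l) := by
  classical
  rcases (stationary p k l μ a).eq_empty_or_nonempty with h | ⟨v, hv⟩
  · rw [h]; simp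
  set ε : R := (p : R) ^ (k - l) with hε
  have h2 : IsUnit (2 : R) := by
    have : IsUnit ((2 : ℕ) : R) := by
      rw [ZMod.isUnit_iff_coprime]
      exact (Nat.coprime_two_left.2 hodd).pow_right k
    simpa using this
  set T : Finset R := {x : R | ε * x = 0} with hT
  have hsub : (stationary p k l μ a).map ⟨Units.val, Units.val_injective⟩
      ⊆ T.image (fun x => (v : R) + x) ∪ T.image (fun x => -(v : R) + x) := by
    intro x hx
    simp only [mem_map, Function.Embedding.coeFn_mk] at hx
    obtain ⟨u, hu, rfl⟩ := hx
    rw [mem_stationary] at hu hv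
    have huu : (u : R) * ((u⁻¹ : Rˣ) : R) = 1 := Units.mul_inv u
    have hvv : (v : R) * ((v⁻¹ : Rˣ) : R) = 1 := Units.mul_inv v
    have hu' : ε * (μ * (u : R) ^ 2 - a) = 0 := by
      linear_combination (u : R) * hu + (ε * a) * huu
    have hv' : ε * (μ * (v : R) ^ 2 - a) = 0 := by
      linear_combination (v : R) * hv + (ε * a) * hvv
    have h3 : a * (ε * (((u : R) - v) * (u + v))) = 0 := by
      linear_combination (v : R) ^ 2 * hu' - (u : R) ^ 2 * hv'
    have h4 : ε * (((u : R) - v) * (u + v)) = 0 := ha.mul_right_eq_zero.1 h3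
    rw [mem_union, mem_image, mem_image]
    rcases isUnit_or_eq_prime_mul (k := k) hp ((u : R) - v) with h5 | ⟨y, hy⟩
    · right
      refine ⟨u + v, ?_, by ring⟩
      rw [hT, mem_filter]
      refine ⟨mem_univ _, h5.mul_right_eq_zero.1 ?_⟩
      linear_combination h4
    · rcases isUnit_or_eq_prime_mul (k := k) hp ((u : R) + v) with h6 | ⟨z, hz⟩
      · left
        refine ⟨u - v, ?_, by ring⟩
        rw [hT, mem_filter]
        refine ⟨mem_univ _, h6.mul_right_eq_zero.1 ?_⟩
        linear_combination h4
      · exfalso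
        refine not_isUnit_prime_mul hp hk (y + z) ?_
        have h7 : (p : R) * (y + z) = 2 * u := by linear_combination -hy - hz
        rw [h7]
        exact h2.mul u.isUnit
  have h8 : #T ≤ p ^ (k - l) := card_mul_pow_eq_zero_le hp hl
  rw [← card_map]
  refine (card_le_card hsub).trans ((card_union_le _ _).trans ?_)
  have h9 := card_image_le (s := T) (f := fun x => (v : R) + x)
  have h10 := card_image_le (s := T) (f := fun x => -(v : R) + x)
  omega

theorem isUnit_of_stationary_nonempty (hp : p.Prime) {l : ℕ} (hl0 : 0 < l) (hl : l ≤ k)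
    {μ a : R} (ha : IsUnit a) {u : Rˣ} (hu : u ∈ stationary p k l μ a) : IsUnit μ := by
  have hk : 0 < k := by omega
  rcases isUnit_or_eq_prime_mul (k := k) hp μ with h | ⟨y, rfl⟩
  · exact h
  · exfalso
    rw [mem_stationary] at hu
    have huu : (u : R) * ((u⁻¹ : Rˣ) : R) = 1 := Units.mul_inv u
    rcases isUnit_or_eq_prime_mul (k := k) hp ((p : R) * y * u - a * (u⁻¹ : Rˣ)) with h | ⟨z, hz⟩
    · have h0 : (p : R) ^ (k - l) = 0 := h.mul_left_eq_zero.1 hu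
      rw [← Nat.cast_pow, ZMod.natCast_eq_zero_iff] at h0
      have := (Nat.pow_dvd_pow_iff_le_right hp.one_lt).1 h0
      omega
    · refine not_isUnit_prime_mul hp hk (y * u - z) ?_
      have : (p : R) * (y * u - z) = a * (u⁻¹ : Rˣ) := by linear_combination hz
      rw [this]
      exact ha.mul (Units.isUnit _)

theorem stationary_eq_empty (hp : p.Prime) {l : ℕ} (hl0 : 0 < l) (hl : l ≤ k)
    {μ a : R} (ha : IsUnit a) (hμ : ¬ IsUnit μ) : stationary p k l μ a = ∅ := by
  rw [eq_empty_iff_forall_notMem]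
  exact fun u hu => hμ (isUnit_of_stationary_nonempty hp hl0 hl ha hu)

theorem klSum_eq_zero (hp : p.Prime) (hk : 2 ≤ k) {μ a : R} (ha : IsUnit a) (hμ : ¬ IsUnit μ) :
    klSum (p ^ k) μ a = 0 := by
  have h := klSum_mul_sq (p := p) (k := k) (l := 1) (by omega) μ a 1
  rw [stationary_eq_empty hp one_pos (by omega) ha hμ] at h
  simpa using h

theorem card_mul_card_stationary_le (hp : p.Prime) (hodd : Odd p) (hk : 0 < k) (μ μ' : R) {a : R}
    (ha : IsUnit a) : 1 / ((p : ℝ) ^ k) *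
      ((#(stationary p k (k / 2) μ a) : ℝ) * #(stationary p k (k / 2) μ' a)) ≤ 4 * p := by
  have h1 := card_stationary_le hp hodd hk (l := k / 2) (by omega) μ ha
  have h2 := card_stationary_le hp hodd hk (l := k / 2) (by omega) μ' ha
  have h3 : #(stationary p k (k / 2) μ a) * #(stationary p k (k / 2) μ' a) ≤ 4 * p * p ^ k := by
    calc _ ≤ (2 * p ^ (k - k / 2)) * (2 * p ^ (k - k / 2)) := Nat.mul_le_mul h1 h2
      _ = 4 * p ^ ((k - k / 2) + (k - k / 2)) := by rw [pow_add]; ring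
      _ ≤ 4 * p ^ (k + 1) := by
          exact Nat.mul_le_mul_left _ (Nat.pow_le_pow_right hp.pos (by omega))
      _ = _ := by ring
  have hp0 : (0 : ℝ) < p := by exact_mod_cast hp.pos
  rw [one_div, inv_mul_le_iff₀ (by positivity)]
  have : ((#(stationary p k (k / 2) μ a) : ℝ) * #(stationary p k (k / 2) μ' a))
      ≤ 4 * p * (p : ℝ) ^ k := by exact_mod_cast h3
  linarith

/-- The pointwise bound for the Kloosterman sum; the factor `p` is lost only for odd `k`, where
`l = k / 2` is rounded down. -/
theorem norm_klSum_sq_le (hp : p.Prime) (hodd : Odd p) (hk : 0 < k) (μ : R) {a : R}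
    (ha : IsUnit a) : ‖klSum (p ^ k) μ a‖ ^ 2 ≤ 4 * p := by
  have h := klSum_mul_sq (p := p) (k := k) (l := k / 2) (by omega) μ a 1
  rw [Units.val_one, one_pow, mul_one] at h
  rw [h, norm_mul, mul_pow, sq, norm_sqrt_factor_mul_sqrt_factor p k]
  refine le_trans ?_ (card_mul_card_stationary_le hp hodd hk μ μ ha)
  rw [← sq]
  gcongr
  refine (norm_sum_le _ _).trans ?_
  simp

/-- The frequencies `W = h(u) - h(u')` occurring in the correlation of two Kloosterman sums are
divisible by `p ^ ν` only if the arguments are congruent modulo `p ^ ν`. -/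
theorem mul_sub_eq_zero_of_stationary (hodd : Odd p) {l ν : ℕ}
    (hν : ν ≤ l) {μ μ' a : R} (ha : IsUnit a) {u u' : Rˣ}
    (hu : u ∈ stationary p k l μ a) (hu' : u' ∈ stationary p k l μ' a)
    (hW : (p : R) ^ (k - ν) * ((μ * u + a * (u⁻¹ : Rˣ)) - (μ' * u' + a * (u'⁻¹ : Rˣ))) = 0) :
    (p : R) ^ (k - ν) * (μ - μ') = 0 := by
  rw [mem_stationary] at hu hu'
  have h2 : IsUnit (2 : R) := by
    have : IsUnit ((2 : ℕ) : R) := by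
      rw [ZMod.isUnit_iff_coprime]
      exact (Nat.coprime_two_left.2 hodd).pow_right k
    simpa using this
  obtain ⟨c, hc⟩ : ∃ c : R, (p : R) ^ (k - ν) = c * (p : R) ^ (k - l) :=
    ⟨(p : R) ^ (k - ν - (k - l)), by rw [← pow_add]; congr 1; omega⟩
  have huu : (u : R) * ((u⁻¹ : Rˣ) : R) = 1 := Units.mul_inv u
  have huu' : (u' : R) * ((u'⁻¹ : Rˣ) : R) = 1 := Units.mul_inv u'
  set δ : R := (p : R) ^ (k - ν) with hδ
  have h3 : δ * (μ * u - a * (u⁻¹ : Rˣ)) = 0 := by rw [hc, mul_assoc, hu, mul_zero]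
  have h4 : δ * (μ' * u' - a * (u'⁻¹ : Rˣ)) = 0 := by rw [hc, mul_assoc, hu', mul_zero]
  have h5 : (2 * a) * (δ * ((u⁻¹ : Rˣ) - (u'⁻¹ : Rˣ) : R)) = 0 := by
    linear_combination hW - h3 + h4
  have h6 : δ * ((u⁻¹ : Rˣ) - (u'⁻¹ : Rˣ) : R) = 0 := (h2.mul ha).mul_right_eq_zero.1 h5
  have h7 : δ * ((u' : R) - u) = 0 := by
    linear_combination (u : R) * u' * h6 - δ * u' * huu + δ * u * huu'
  have h8 : 2 * (δ * (μ * u - μ' * u')) = 0 := by linear_combination hW + h3 - h4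
  have h9 : δ * (μ * u - μ' * u') = 0 := h2.mul_right_eq_zero.1 h8
  have h10 : (u : R) * (δ * (μ - μ')) = 0 := by linear_combination h9 + μ' * h7
  exact u.isUnit.mul_right_eq_zero.1 h10

end PrimePower

/-! ### Square roots modulo prime powers and polynomial phases -/

/-- The binomial expansion of `(1 + δ) ^ n` with nilpotent `δ`, truncated independently of `n`. -/
theorem one_add_pow_truncate {A : Type*} [CommRing A] (δ : A) (n r : ℕ) (hδ : δ ^ (r + 1) = 0) :
    (1 + δ) ^ n = 1 + ∑ j : Fin r, (n.choose ((j : ℕ) + 1) : A) * δ ^ ((j : ℕ) + 1) := by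
  have h1 : (1 + δ) ^ n = ∑ j ∈ range (n + 1), (n.choose j : A) * δ ^ j := by
    rw [add_comm, add_pow]
    refine sum_congr rfl fun j _ => ?_
    rw [one_pow, mul_one, mul_comm]
  have h2 : ∑ j ∈ range (n + 1), (n.choose j : A) * δ ^ j
      = ∑ j ∈ range (n + 1 + (r + 1)), (n.choose j : A) * δ ^ j := by
    refine sum_subset (range_mono (by omega)) fun j _ hj => ?_
    rw [mem_range, not_lt] at hj
    rw [Nat.choose_eq_zero_of_lt (by omega), Nat.cast_zero, zero_mul]
  have h3 : ∑ j ∈ range (r + 1), (n.choose j : A) * δ ^ j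
      = ∑ j ∈ range (n + 1 + (r + 1)), (n.choose j : A) * δ ^ j := by
    refine sum_subset (range_mono (by omega)) fun j _ hj => ?_
    rw [mem_range, not_lt] at hj
    rw [pow_eq_zero_of_le hj hδ, mul_zero]
  rw [h1, h2, ← h3, sum_range_succ', Fin.sum_univ_eq_sum_range
    (fun j => (n.choose (j + 1) : A) * δ ^ (j + 1)) r]
  simp [add_comm]

/-- The exponent `(p ^ (k - 1) + 1) / 2`: raising an element of `1 + p ℤ / p ^ k` to this power is
taking its square root. -/
def sqrtExp (p k : ℕ) : ℕ := (p ^ (k - 1) + 1) / 2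

theorem two_mul_sqrtExp {p : ℕ} (hodd : Odd p) (k : ℕ) : 2 * sqrtExp p k = p ^ (k - 1) + 1 :=
  Nat.mul_div_cancel' (hodd.pow.add_one).two_dvd

theorem sq_pow_sqrtExp {p k : ℕ} (hodd : Odd p) (hk : 0 < k) {x : ZMod (p ^ k)}
    (hx : (p : ZMod (p ^ k)) ∣ x - 1) :
    (x ^ sqrtExp p k) ^ 2 = x := by
  have h1 := dvd_sub_pow_of_dvd_sub hx (k - 1)
  rw [Nat.sub_add_cancel hk, natCast_pow_eq_zero_of_le le_rfl, zero_dvd_iff, one_pow,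
    sub_eq_zero] at h1
  rw [← pow_mul, mul_comm, two_mul_sqrtExp hodd, pow_succ, h1, one_mul]

section PrimePower

variable {p k : ℕ}

local notation "R" => ZMod (p ^ k)

/-- The binomial coefficients of the square root have small `p`-adic valuation: annihilating
`p ^ i * C(e, j)` already annihilates `p ^ (i + v)` with `p ^ v ≤ (2 j) ^ j`. -/
theorem exists_pow_mul_eq_zero_of_choose (hp : p.Prime) (hodd : Odd p) (hk : 0 < k) {i j : ℕ}
    (hi : 0 < i) (W : R)
    (h : (p : R) ^ i * (W * ((sqrtExp p k).choose j : R)) = 0) :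
    ∃ v : ℕ, p ^ v ≤ (2 * j) ^ j ∧ (p : R) ^ (i + v) * W = 0 := by
  set n := sqrtExp p k with hn
  set N : ℤ := ∏ l ∈ range j, (1 - 2 * (l : ℤ)) with hN
  have h2n : 2 * (n : R) = (p : R) ^ (k - 1) + 1 := by
    have := congrArg (Nat.cast : ℕ → R) (two_mul_sqrtExp hodd k)
    push_cast at this
    exact this
  have hpk : (p : R) ^ i * (p : R) ^ (k - 1) = 0 := by
    rw [← pow_add]; exact natCast_pow_eq_zero_of_le (by omega)
  have hfac : (2 : R) ^ j * ((j.factorial : R) * (n.choose j : R))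
      = ∏ l ∈ range j, ((p : R) ^ (k - 1) + (1 - 2 * (l : R))) := by
    rw [← Nat.cast_mul, ← Nat.descFactorial_eq_factorial_mul_choose,
      ← descPochhammer_eval_eq_descFactorial, descPochhammer_eval_eq_prod_range,
      ← card_range j, ← prod_const, card_range, ← prod_mul_distrib]
    refine prod_congr rfl fun l _ => ?_
    linear_combination h2n
  have hred : (p : R) ^ i * ∏ l ∈ range j, ((p : R) ^ (k - 1) + (1 - 2 * (l : R)))
      = (p : R) ^ i * (N : R) := by
    rw [hN]
    push_cast
    clear_value N
    clear hfac h hN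
    induction j with
    | zero => simp
    | succ j ih =>
      rw [prod_range_succ, prod_range_succ]
      linear_combination ((p : R) ^ (k - 1) + (1 - 2 * (j : R))) * ih
        + (∏ l ∈ range j, (1 - 2 * (l : R))) * hpk
  have hNW : (p : R) ^ i * ((N : R) * W) = 0 := by
    linear_combination (2 : R) ^ j * (j.factorial : R) * h - W * hred
      - (p : R) ^ i * W * hfac
  have hN0 : N ≠ 0 := by
    rw [hN, prod_ne_zero_iff]
    intro l _
    omega
  have hNle : N.natAbs ≤ (2 * j) ^ j := by
    have habs : N.natAbs = ∏ l ∈ range j, (1 - 2 * (l : ℤ)).natAbs :=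
      map_prod Int.natAbsHom _ _
    rw [habs]
    calc ∏ l ∈ range j, (1 - 2 * (l : ℤ)).natAbs ≤ ∏ _l ∈ range j, 2 * j := by
          refine prod_le_prod' fun l hl => ?_
          rw [mem_range] at hl
          omega
      _ = (2 * j) ^ j := by simp
  obtain ⟨v, N', hN', hvN⟩ := Nat.exists_eq_pow_mul_and_not_dvd (n := N.natAbs)
    (Int.natAbs_ne_zero.2 hN0) p hp.ne_one
  refine ⟨v, ?_, ?_⟩
  · refine le_trans ?_ hNle
    rw [hvN]
    refine Nat.le_mul_of_pos_right _ (Nat.pos_of_ne_zero ?_)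
    rintro rfl
    exact hN' (dvd_zero _)
  · have hunit : IsUnit (N' : R) := by
      rw [ZMod.isUnit_iff_coprime]
      exact ((hp.coprime_iff_not_dvd.2 hN').symm).pow_right k
    have habs : (p : R) ^ i * (((N.natAbs : ℕ) : R) * W) = 0 := by
      rcases Int.natAbs_eq N with h1 | h1
      · have : ((N.natAbs : ℕ) : R) = (N : R) := by
          conv_rhs => rw [h1]
          rw [Int.cast_natCast]
        rw [this]; exact hNW
      · have : ((N.natAbs : ℕ) : R) = -(N : R) := by
          conv_rhs => rw [h1]
          rw [Int.cast_neg, Int.cast_natCast, neg_neg]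
        rw [this]; linear_combination -hNW
    rw [hvN] at habs
    push_cast at habs
    apply hunit.mul_right_eq_zero.1
    rw [pow_add]
    linear_combination habs

/-- The additive order of the `j`-th coefficient lies between `p ^ (τ j)` and `p ^ (3 τ j)` when
`k / (5 τ) ≤ j ≤ k / (3 τ) - 1`. -/
theorem addOrderOf_coeff_bounds (hp : p.Prime) (hodd : Odd p) {τ j : ℕ} (hτ : 0 < τ) (hj : 0 < j)
    (h1 : k ≤ 5 * τ * j) (h2 : 3 * τ * (j + 1) ≤ k) (hjτ : (2 * j) ^ j ≤ 2 ^ τ)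
    {W c : R} (hW : (p : R) ^ (k - 2 * τ) * W ≠ 0) (hc : IsUnit c) :
    (p ^ τ) ^ j ≤ addOrderOf (W * ((sqrtExp p k).choose j : R) * ((p : R) ^ (2 * τ) * c) ^ j) ∧
    addOrderOf (W * ((sqrtExp p k).choose j : R) * ((p : R) ^ (2 * τ) * c) ^ j)
      ≤ ((p ^ τ) ^ j) ^ 3 := by
  set A : R := W * ((sqrtExp p k).choose j : R) * ((p : R) ^ (2 * τ) * c) ^ j with hA
  have hk : 0 < k := by
    have : 0 < 3 * τ * (j + 1) := by positivity
    omega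
  constructor
  · have hdvd : addOrderOf A ∣ p ^ k := by
      rw [addOrderOf_dvd_iff_nsmul_eq_zero, nsmul_eq_mul, Nat.cast_pow,
        natCast_pow_eq_zero_of_le le_rfl, zero_mul]
    obtain ⟨i, _, hi⟩ := (Nat.dvd_prime_pow hp).1 hdvd
    by_contra hlt
    push Not at hlt
    rw [hi, ← pow_mul] at hlt
    have hiτ : i < τ * j := (Nat.pow_lt_pow_iff_right hp.one_lt).1 hlt
    have h3 : (p : R) ^ (τ * j) * A = 0 := by
      have h4 : addOrderOf A ∣ p ^ (τ * j) := by rw [hi]; exact pow_dvd_pow _ hiτ.le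
      rw [addOrderOf_dvd_iff_nsmul_eq_zero, nsmul_eq_mul, Nat.cast_pow] at h4
      exact h4
    have h5 : (p : R) ^ (3 * τ * j) * (W * ((sqrtExp p k).choose j : R)) = 0 := by
      apply (hc.pow j).mul_right_eq_zero.1
      have e : (p : R) ^ (3 * τ * j) = (p : R) ^ (τ * j) * ((p : R) ^ (2 * τ)) ^ j := by
        rw [← pow_mul, ← pow_add]; congr 1; ring
      rw [e, ← h3, hA, mul_pow]
      ring
    obtain ⟨v, hv, h6⟩ := exists_pow_mul_eq_zero_of_choose hp hodd hk (by positivity) W h5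
    have hvτ : v ≤ τ := by
      have : p ^ v ≤ p ^ τ := hv.trans (hjτ.trans (Nat.pow_le_pow_left hp.two_le _))
      exact (Nat.pow_le_pow_iff_right hp.one_lt).1 this
    apply hW
    have e : k - 2 * τ = (k - 2 * τ - (3 * τ * j + v)) + (3 * τ * j + v) := by
      have : 3 * τ * (j + 1) = 3 * τ * j + 3 * τ := by ring
      omega
    rw [e, pow_add, mul_assoc, h6, mul_zero]
  · apply Nat.le_of_dvd (by have := hp.pos; positivity)
    rw [addOrderOf_dvd_iff_nsmul_eq_zero, nsmul_eq_mul, hA, mul_pow]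
    have h3 : (((p ^ τ) ^ j) ^ 3 : ℕ) * ((p : R) ^ (2 * τ)) ^ j = 0 := by
      push_cast
      rw [← pow_mul, ← pow_mul, ← pow_mul, ← pow_add]
      apply natCast_pow_eq_zero_of_le
      refine h1.trans (le_of_eq (by ring))
    linear_combination (W * ((sqrtExp p k).choose j : R) * c ^ j) * h3

variable [NeZero (p ^ k)]

local notation "ψ" => (ZMod.stdAddChar : AddChar (ZMod (p ^ k)) ℂ)

theorem isUnit_of_dvd_sub_one (hk : 0 < k) {x : R} (hx : (p : R) ∣ x - 1) : IsUnit x := by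
  have h1 := dvd_sub_pow_of_dvd_sub hx (k - 1)
  rw [Nat.sub_add_cancel hk, natCast_pow_eq_zero_of_le le_rfl, zero_dvd_iff, one_pow,
    sub_eq_zero] at h1
  by_cases h0 : p ^ (k - 1) = 0
  · exfalso
    have hp0 : p = 0 := by
      by_contra h
      exact pow_ne_zero _ h h0
    have := NeZero.ne (p ^ k)
    rw [hp0, zero_pow hk.ne'] at this
    exact this rfl
  · exact (isUnit_pow_iff h0).1 (h1 ▸ isUnit_one)

/-- Along the shifts `m + p ^ (2 τ) y x` the correlation of two Kloosterman sums is a bounded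
combination of phases that are polynomial in the product `y x`; the leading factor `W` of each phase
is not divisible by `p ^ (2 τ)` when `n` and `n'` are incongruent modulo `p ^ (2 τ)`. -/
theorem norm_sum_correlation_le (hp : p.Prime) (hodd : Odd p) {τ r P : ℕ} (hτ : 0 < τ)
    (hτk : 4 * τ ≤ k) (hr : k ≤ 2 * τ * (r + 1)) {a : R} (ha : IsUnit a) (n n' : ℤ)
    (hn : ¬ ((p ^ (2 * τ) : ℕ) : ℤ) ∣ n - n') (K : ℝ) (hK0 : 0 ≤ K)
    (hK : ∀ W c : R, (p : R) ^ (k - 2 * τ) * W ≠ 0 → IsUnit c →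
      ‖∑ y : Fin P, ∑ x : Fin P, ψ (∑ j : Fin r,
        (W * ((sqrtExp p k).choose ((j : ℕ) + 1) : R) * ((p : R) ^ (2 * τ) * c) ^ ((j : ℕ) + 1))
          * ((y : ℕ) : R) ^ ((j : ℕ) + 1) * ((x : ℕ) : R) ^ ((j : ℕ) + 1))‖ ≤ K) (m : ℕ) :
    ‖∑ y : Fin P, ∑ x : Fin P,
      klSum (p ^ k) (((m + p ^ (2 * τ) * (y * x) : ℕ) : R) * n) a *
        (starRingEnd ℂ) (klSum (p ^ k) (((m + p ^ (2 * τ) * (y * x) : ℕ) : R) * n') a)‖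
      ≤ 4 * p * K := by
  have hk : 0 < k := by omega
  have hp0 : (0 : ℝ) < p := by exact_mod_cast hp.pos
  rcases isUnit_or_eq_prime_mul (k := k) hp (m : R) with hm | ⟨y₀, hy₀⟩
  · -- write `m + p ^ (2 τ) y x = m γ²` with `γ` the square root of `1 + p ^ (2 τ) y x / m`
    obtain ⟨mu, hmu⟩ := hm
    set c : R := ((mu⁻¹ : Rˣ) : R) with hc
    have hmc : (m : R) * c = 1 := by rw [← hmu]; exact Units.mul_inv mu
    have hpt : (p : R) ∣ (p : R) ^ (2 * τ) := dvd_pow_self _ (by omega)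
    have hγ : ∀ z : R, ∃ γ : Rˣ, (γ : R) = (1 + (p : R) ^ (2 * τ) * c * z) ^ sqrtExp p k ∧
        (γ : R) ^ 2 = 1 + (p : R) ^ (2 * τ) * c * z := by
      intro z
      have hd : (p : R) ∣ (1 + (p : R) ^ (2 * τ) * c * z) - 1 := by
        rw [add_sub_cancel_left, mul_assoc]; exact hpt.mul_right _
      obtain ⟨γ, hγ⟩ := (isUnit_of_dvd_sub_one hk hd).pow (sqrtExp p k)
      exact ⟨γ, hγ, by rw [hγ, sq_pow_sqrtExp hodd hk hd]⟩
    choose γ hγ1 hγ2 using hγ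
    set U := stationary p k (k / 2) ((m : R) * n) a with hU
    set U' := stationary p k (k / 2) ((m : R) * n') a with hU'
    set h : Rˣ → R := fun u => (m : R) * n * u + a * (u⁻¹ : Rˣ) with hh
    set h' : Rˣ → R := fun u => (m : R) * n' * u + a * (u⁻¹ : Rˣ) with hh'
    set κ : ℂ := (1 / (Real.sqrt ((p ^ k : ℕ) : ℝ) : ℂ)) with hκ
    have hkl : ∀ (ν : ℤ) (y x : Fin P),
        klSum (p ^ k) (((m + p ^ (2 * τ) * (y * x) : ℕ) : R) * ν) a
          = κ * ∑ u ∈ stationary p k (k / 2) ((m : R) * ν) a,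
            ψ (γ (((y : ℕ) : R) * ((x : ℕ) : R)) * ((m : R) * ν * u + a * (u⁻¹ : Rˣ))) := by
      intro ν y x
      rw [← klSum_mul_sq (by omega), hγ2]
      congr 1
      push_cast
      linear_combination -(p : R) ^ (2 * τ) * ((y : ℕ) : R) * ((x : ℕ) : R) * ν * hmc
    have hprod : ∀ y x : Fin P, klSum (p ^ k) (((m + p ^ (2 * τ) * (y * x) : ℕ) : R) * n) a *
        (starRingEnd ℂ) (klSum (p ^ k) (((m + p ^ (2 * τ) * (y * x) : ℕ) : R) * n') a)
        = κ * (starRingEnd ℂ) κ * ∑ u ∈ U, ∑ u' ∈ U',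
          ψ (γ (((y : ℕ) : R) * ((x : ℕ) : R)) * (h u - h' u')) := by
      intro y x
      rw [hkl n y x, hkl n' y x, map_mul, map_sum, mul_mul_mul_comm, sum_mul_sum]
      congr 1
      refine sum_congr rfl fun u _ => sum_congr rfl fun u' _ => ?_
      rw [mul_sub, AddChar.map_sub_eq_div, div_eq_mul_inv, ← AddChar.map_neg_eq_inv,
        AddChar.map_neg_eq_conj]
    have hswap : ∑ y : Fin P, ∑ x : Fin P,
        klSum (p ^ k) (((m + p ^ (2 * τ) * (y * x) : ℕ) : R) * n) a *
          (starRingEnd ℂ) (klSum (p ^ k) (((m + p ^ (2 * τ) * (y * x) : ℕ) : R) * n') a)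
        = κ * (starRingEnd ℂ) κ * ∑ u ∈ U, ∑ u' ∈ U', ∑ y : Fin P, ∑ x : Fin P,
          ψ (γ (((y : ℕ) : R) * ((x : ℕ) : R)) * (h u - h' u')) := by
      simp_rw [hprod, ← mul_sum]
      congr 1
      calc _ = ∑ y : Fin P, ∑ u ∈ U, ∑ u' ∈ U', ∑ x : Fin P,
            ψ (γ (((y : ℕ) : R) * ((x : ℕ) : R)) * (h u - h' u')) := by
            refine sum_congr rfl fun y _ => ?_
            rw [sum_comm]
            refine sum_congr rfl fun u _ => ?_
            rw [sum_comm]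
        _ = _ := by
            rw [sum_comm]
            refine sum_congr rfl fun u _ => ?_
            rw [sum_comm]
    have hinner : ∀ u ∈ U, ∀ u' ∈ U', ‖∑ y : Fin P, ∑ x : Fin P,
          ψ (γ (((y : ℕ) : R) * ((x : ℕ) : R)) * (h u - h' u'))‖ ≤ K := by
      intro u hu u' hu'
      set W : R := h u - h' u' with hWdef
      have hW : (p : R) ^ (k - 2 * τ) * W ≠ 0 := by
        intro h0
        have h1 := mul_sub_eq_zero_of_stationary hodd (l := k / 2) (ν := 2 * τ) (by omega) ha
          hu hu' h0
        apply hn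
        have h2 : (p : R) ^ (k - 2 * τ) * ((n : R) - n') = 0 := by
          linear_combination c * h1 - (p : R) ^ (k - 2 * τ) * ((n : R) - n') * hmc
        have h3 : (((p ^ (k - 2 * τ) : ℕ) * (n - n') : ℤ) : R) = 0 := by
          push_cast; exact h2
        rw [ZMod.intCast_zmod_eq_zero_iff_dvd] at h3
        have e : ((p ^ k : ℕ) : ℤ) = ((p ^ (k - 2 * τ) : ℕ) : ℤ) * ((p ^ (2 * τ) : ℕ) : ℤ) := by
          rw [← Nat.cast_mul, ← pow_add]; congr 2; omega
        replace h3 := e.symm.dvd.trans h3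
        exact Int.dvd_of_mul_dvd_mul_left (by exact_mod_cast (pow_pos hp.pos _).ne') h3
      have hphase : ∀ y x : Fin P, ψ (γ (((y : ℕ) : R) * ((x : ℕ) : R)) * W)
          = ψ W * ψ (∑ j : Fin r, (W * ((sqrtExp p k).choose ((j : ℕ) + 1) : R)
            * ((p : R) ^ (2 * τ) * c) ^ ((j : ℕ) + 1))
          * ((y : ℕ) : R) ^ ((j : ℕ) + 1) * ((x : ℕ) : R) ^ ((j : ℕ) + 1)) := by
        intro y x
        have hδ : ((p : R) ^ (2 * τ) * c * (((y : ℕ) : R) * ((x : ℕ) : R))) ^ (r + 1) = 0 := by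
          rw [mul_pow, mul_pow, ← pow_mul, natCast_pow_eq_zero_of_le hr, zero_mul, zero_mul]
        rw [← AddChar.map_add_eq_mul, hγ1, one_add_pow_truncate _ _ r hδ, add_mul, one_mul, sum_mul]
        congr 2
        refine sum_congr rfl fun j _ => ?_
        simp only [mul_pow]
        ring
      simp_rw [hphase, ← mul_sum]
      rw [norm_mul, AddChar.norm_apply, one_mul]
      exact hK W c hW (Units.isUnit _)
    rw [hswap, norm_mul, norm_mul, RCLike.norm_conj, hκ, norm_sqrt_factor_mul_sqrt_factor p k]
    have hbound : ‖∑ u ∈ U, ∑ u' ∈ U', ∑ y : Fin P, ∑ x : Fin P,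
          ψ (γ (((y : ℕ) : R) * ((x : ℕ) : R)) * (h u - h' u'))‖ ≤ (#U : ℝ) * #U' * K := by
      calc _ ≤ ∑ u ∈ U, ∑ u' ∈ U', K := by
            refine (norm_sum_le _ _).trans (sum_le_sum fun u hu => ?_)
            exact (norm_sum_le _ _).trans (sum_le_sum fun u' hu' => hinner u hu u' hu')
        _ = _ := by simp only [sum_const, nsmul_eq_mul]; ring
    calc _ ≤ 1 / (p : ℝ) ^ k * ((#U : ℝ) * #U' * K) := by gcongr
      _ = 1 / (p : ℝ) ^ k * ((#U : ℝ) * #U') * K := by ring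
      _ ≤ 4 * p * K :=
        mul_le_mul_of_nonneg_right (card_mul_card_stationary_le hp hodd hk _ _ ha) hK0
  · -- all arguments are divisible by `p`, and the Kloosterman sums vanish
    have hz : ∀ y x : Fin P,
        klSum (p ^ k) (((m + p ^ (2 * τ) * (y * x) : ℕ) : R) * n) a = 0 := by
      intro y x
      refine klSum_eq_zero hp (by omega) ha ?_
      have e : (((m + p ^ (2 * τ) * (y * x) : ℕ) : R) * n)
          = (p : R) * ((y₀ + (p : R) ^ (2 * τ - 1) * (((y : ℕ) : R) * ((x : ℕ) : R))) * n) := by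
        have e2 : (p : R) ^ (2 * τ) = p * (p : R) ^ (2 * τ - 1) := by
          rw [← pow_succ']; congr 1; omega
        push_cast
        rw [hy₀, e2]
        ring
      rw [e]
      exact not_isUnit_prime_mul hp hk _
    simp_rw [hz]
    simp only [zero_mul, sum_const_zero, norm_zero]
    positivity

end PrimePower

/-! ### The correlation bound -/

/-- The correlation sums save a factor `B ^ (savingConst / D ^ 2)` over the trivial bound `B ^ 4`,
where `B = p ^ τ` and `k` is about `100 D τ`. With `r = 51 D` and `5 r` steps of Linnik's method the
mean value has `s = 6 r ^ 2 = 15606 D ^ 2` variables, the good coefficients gain `B ^ (252 D ^ 2)`,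
the mean value loses at most `B ^ (126 D ^ 2)`, and the sum is raised to the power `4 s ^ 2`. -/
noncomputable def savingConst : ℝ := 126 / (4 * 15606 ^ 2)

theorem savingConst_pos : 0 < savingConst := by unfold savingConst; norm_num

/-- The gain from the degrees `j` with `21 D ≤ j < 33 D`; these satisfy `k / (5 τ) ≤ j` and
`j + 1 ≤ k / (3 τ)` for `100 D τ ≤ k ≤ 101 D τ`. -/
theorem card_good_ge (D : ℕ) (hD : 0 < D) :
    252 * D ^ 2 ≤ ∑ j ∈ ({j | 21 * D ≤ (j : ℕ) + 1 ∧ (j : ℕ) + 2 ≤ 33 * D} : Finset (Fin (51 * D))),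
      ((j : ℕ) + 1) := by
  have h1 : 12 * D ≤ #{j : Fin (51 * D) | 21 * D ≤ (j : ℕ) + 1 ∧ (j : ℕ) + 2 ≤ 33 * D} := by
    have h2 : 12 * D = #(univ : Finset (Fin (12 * D))) := by simp
    rw [h2]
    refine card_le_card_of_injOn
      (fun i => (⟨21 * D - 1 + i, by have := i.2; omega⟩ : Fin (51 * D))) ?_ ?_
    · intro i _
      have := i.2
      simp only [coe_filter, mem_univ, true_and, Set.mem_ofPred_eq]
      omega
    · intro i _ j _ h
      simp only [Fin.mk.injEq] at h
      exact Fin.ext (by omega)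
  calc 252 * D ^ 2 = 12 * D * (21 * D) := by ring
    _ ≤ #{j : Fin (51 * D) | 21 * D ≤ (j : ℕ) + 1 ∧ (j : ℕ) + 2 ≤ 33 * D} * (21 * D) := by gcongr
    _ ≤ _ := by
      rw [← smul_eq_mul]
      exact card_nsmul_le_sum _ _ _ fun j hj => ((mem_filter.1 hj).2).1

/-- After `5 r` steps of Linnik's method the excess is at most `e ^ (-5) < 1 / 100` of its initial
value. -/
theorem mean_value_excess_le (D : ℕ) (hD : 0 < D) :
    4 * ((((51 * D : ℕ) : ℝ) * (((51 * D : ℕ) : ℝ) + 1) / 2)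
      * (1 - 1 / ((51 * D : ℕ) : ℝ)) ^ (5 * (51 * D))) ≤ 126 * (D : ℝ) ^ 2 := by
  set r : ℕ := 51 * D with hr
  have hr1 : (1 : ℝ) ≤ r := by exact_mod_cast (by omega : 1 ≤ r)
  have hD1 : (1 : ℝ) ≤ D := by exact_mod_cast hD
  have hrD : (r : ℝ) = 51 * D := by rw [hr]; push_cast; ring
  have h0 : 0 ≤ 1 - 1 / (r : ℝ) := by
    rw [sub_nonneg, div_le_one (by linarith)]; exact hr1
  have h1 : (1 - 1 / (r : ℝ)) ^ (5 * r) ≤ 1 / 100 := by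
    calc (1 - 1 / (r : ℝ)) ^ (5 * r) ≤ (Real.exp (-(1 / (r : ℝ)))) ^ (5 * r) := by
          gcongr
          have := Real.add_one_le_exp (-(1 / (r : ℝ)))
          linarith
      _ = (Real.exp 1 ^ 5)⁻¹ := by
          rw [← Real.exp_nat_mul, ← Real.exp_nat_mul, ← Real.exp_neg]
          congr 1
          push_cast
          field_simp
      _ ≤ 1 / 100 := by
          rw [one_div]
          apply inv_anti₀ (by norm_num)
          have h2 : (2.7 : ℝ) ≤ Real.exp 1 := by
            have := Real.exp_one_gt_d9; linarith
          calc (100 : ℝ) ≤ 2.7 ^ 5 := by norm_num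
            _ ≤ _ := by gcongr
  have h3 : (r : ℝ) * (r + 1) / 2 ≤ 1326 * (D : ℝ) ^ 2 := by
    rw [hrD]; nlinarith
  calc 4 * (((r : ℝ) * (r + 1) / 2) * (1 - 1 / (r : ℝ)) ^ (5 * r))
      ≤ 4 * ((1326 * (D : ℝ) ^ 2) * (1 / 100)) := by gcongr
    _ ≤ _ := by nlinarith [sq_nonneg (D : ℝ)]

/-- The correlation bound for shifts on the scale `B = p ^ τ`. The lower bound `T` for `τ` absorbs
the `p`-adic valuations of the binomial coefficients. -/
theorem exists_correlation_bound (D : ℕ) (hD : 0 < D) :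
    ∃ C : ℝ, 0 < C ∧ ∃ T : ℕ, ∀ (p k τ : ℕ) [NeZero (p ^ k)], p.Prime → Odd p → T ≤ τ →
      100 * D * τ ≤ k → k ≤ 101 * D * τ → ∀ a : ZMod (p ^ k), IsUnit a → ∀ n n' : ℤ,
      ¬ ((p ^ (2 * τ) : ℕ) : ℤ) ∣ n - n' → ∀ m : ℕ,
      ‖∑ y : Fin ((p ^ τ) ^ 2), ∑ x : Fin ((p ^ τ) ^ 2),
        klSum (p ^ k) (((m + p ^ (2 * τ) * (y * x) : ℕ) : ZMod (p ^ k)) * n) a *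
        (starRingEnd ℂ)
          (klSum (p ^ k) (((m + p ^ (2 * τ) * (y * x) : ℕ) : ZMod (p ^ k)) * n') a)‖
      ≤ 4 * p * (C * ((p ^ τ : ℕ) : ℝ) ^ (4 - savingConst / (D : ℝ) ^ 2)) := by
  set r : ℕ := 51 * D with hr
  have hr0 : 0 < r := by omega
  set s : ℕ := r * (r + 5 * r) with hs
  have hs0 : 0 < s := by positivity
  obtain ⟨C, hC, hbound⟩ := exists_double_sum_bound r hr0 (5 * r) s hs
  set N : ℕ := 2 * s * (2 * s) with hN
  have hN0 : 0 < N := by positivity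
  have hNr : (N : ℝ) = 4 * (s : ℝ) ^ 2 := by rw [hN]; push_cast; ring
  have hsD : (s : ℝ) = 15606 * (D : ℝ) ^ 2 := by rw [hs, hr]; push_cast; ring
  refine ⟨C ^ (1 / (N : ℝ)), by positivity, (2 * r) ^ r, ?_⟩
  intro p k τ _ hp hodd hT hk1 hk2 a ha n n' hn m
  have hτ0 : 0 < τ := lt_of_lt_of_le (by positivity) hT
  have hDτ : τ ≤ D * τ := Nat.le_mul_of_pos_left _ hD
  rw [mul_assoc] at hk1 hk2
  -- degree `r = 51 D` suffices because `p ^ (2 τ (r + 1))` vanishes modulo `p ^ k`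
  refine norm_sum_correlation_le hp hodd (r := r) hτ0 (by omega) ?_ ha n n' hn _ (by positivity)
    ?_ m
  · have : 2 * τ * (r + 1) = 102 * (D * τ) + 2 * τ := by rw [hr]; ring
    omega
  intro W c hW hc
  set B : ℕ := p ^ τ with hB
  have hB0 : 0 < B := pow_pos hp.pos _
  have hBr : (1 : ℝ) ≤ B := by exact_mod_cast hB0
  set good : Finset (Fin r) := {j : Fin r | 21 * D ≤ (j : ℕ) + 1 ∧ (j : ℕ) + 2 ≤ 33 * D} with hgood
  have h := hbound (p ^ k) B hB0 (fun j : Fin r =>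
    W * ((sqrtExp p k).choose ((j : ℕ) + 1) : ZMod (p ^ k))
      * ((p : ZMod (p ^ k)) ^ (2 * τ) * c) ^ ((j : ℕ) + 1)) good (by
    intro j hj
    obtain ⟨_, hj1, hj2⟩ := mem_filter.1 hj
    refine addOrderOf_coeff_bounds hp hodd hτ0 (Nat.succ_pos _) ?_ ?_ ?_ hW hc
    · calc k ≤ 101 * (D * τ) := hk2
        _ ≤ 5 * τ * (21 * D) := by nlinarith
        _ ≤ _ := by gcongr
    · calc 3 * τ * ((j : ℕ) + 1 + 1) ≤ 3 * τ * (33 * D) := by gcongr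
        _ ≤ 100 * (D * τ) := by nlinarith
        _ ≤ k := hk1
    · calc (2 * ((j : ℕ) + 1)) ^ ((j : ℕ) + 1) ≤ (2 * r) ^ ((j : ℕ) + 1) := by
            have := j.2
            gcongr
            omega
        _ ≤ (2 * r) ^ r := Nat.pow_le_pow_right (by omega) j.2
        _ ≤ τ := hT
        _ ≤ 2 ^ τ := Nat.lt_two_pow_self.le)
  set S := ∑ y : Fin (B ^ 2), ∑ x : Fin (B ^ 2), (ZMod.stdAddChar : AddChar (ZMod (p ^ k)) ℂ)
    (∑ j : Fin r, (W * ((sqrtExp p k).choose ((j : ℕ) + 1) : ZMod (p ^ k))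
      * ((p : ZMod (p ^ k)) ^ (2 * τ) * c) ^ ((j : ℕ) + 1))
          * ((y : ℕ) : ZMod (p ^ k)) ^ ((j : ℕ) + 1) * ((x : ℕ) : ZMod (p ^ k)) ^ ((j : ℕ) + 1))
  have hgain : (B : ℝ) ^ (252 * D ^ 2) ≤ (B : ℝ) ^ (∑ j ∈ good, ((j : ℕ) + 1)) :=
    pow_le_pow_right₀ hBr (card_good_ge D hD)
  have hη := mean_value_excess_le D hD
  rw [← hr] at hη
  have h1 : ‖S‖ ^ N * (B : ℝ) ^ (252 * D ^ 2)
      ≤ C * (B : ℝ) ^ (16 * (s : ℝ) ^ 2 + 126 * (D : ℝ) ^ 2) := by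
    calc ‖S‖ ^ N * (B : ℝ) ^ (252 * D ^ 2)
        ≤ ‖S‖ ^ N * (B : ℝ) ^ (∑ j ∈ good, ((j : ℕ) + 1)) := by gcongr
      _ ≤ _ := h
      _ ≤ _ := by gcongr
  have hBpos : (0 : ℝ) < B := by linarith
  have h2 : ‖S‖ ^ N ≤ C * (B : ℝ) ^ (16 * (s : ℝ) ^ 2 - 126 * (D : ℝ) ^ 2) := by
    have e : (B : ℝ) ^ (16 * (s : ℝ) ^ 2 + 126 * (D : ℝ) ^ 2)
        = (B : ℝ) ^ (16 * (s : ℝ) ^ 2 - 126 * (D : ℝ) ^ 2) * (B : ℝ) ^ (252 * D ^ 2) := by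
      rw [← Real.rpow_natCast (B : ℝ) (252 * D ^ 2), ← Real.rpow_add hBpos]
      congr 1
      push_cast; ring
    rw [e, ← mul_assoc] at h1
    exact le_of_mul_le_mul_right h1 (by positivity)
  refine (pow_le_pow_iff_left₀ (norm_nonneg _) (by positivity) hN0.ne').1 (h2.trans (le_of_eq ?_))
  rw [mul_pow, ← Real.rpow_natCast (C ^ _) N, ← Real.rpow_mul hC.le,
    one_div_mul_cancel (by positivity), Real.rpow_one, ← Real.rpow_natCast ((B : ℝ) ^ _) N,
    ← Real.rpow_mul hBpos.le]
  congr 2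
  have hD0 : (D : ℝ) ≠ 0 := by positivity
  rw [hNr, hsD]
  unfold savingConst
  field_simp
  ring

/-! ### Shifts, Cauchy–Schwarz and nearly diagonal pairs -/

theorem norm_sum_shift_sub_le (G : ℕ → ℂ) (A : ℝ) (hA : ∀ m, ‖G m‖ ≤ A) (M h : ℕ) :
    ‖∑ m ∈ Icc 1 M, G m - ∑ m ∈ Icc 1 M, G (m + h)‖ ≤ 2 * h * A := by
  induction h with
  | zero => simp
  | succ h ih =>
    have tel : ∀ M : ℕ, ∑ m ∈ Icc 1 M, G (m + h) - ∑ m ∈ Icc 1 M, G (m + (h + 1))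
        = G (h + 1) - G (M + h + 1) := by
      intro M
      induction M with
      | zero => simp
      | succ M ih2 =>
        rw [sum_Icc_succ_top (by omega), sum_Icc_succ_top (by omega), add_sub_add_comm, ih2,
          show M + 1 + h = M + h + 1 by ring, show M + 1 + (h + 1) = M + h + 1 + 1 by ring]
        ring
    have e : ∑ m ∈ Icc 1 M, G m - ∑ m ∈ Icc 1 M, G (m + (h + 1))
        = (∑ m ∈ Icc 1 M, G m - ∑ m ∈ Icc 1 M, G (m + h)) + (G (h + 1) - G (M + h + 1)) := by
      rw [← tel M]; ring
    rw [e]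
    have h1 := norm_add_le (∑ m ∈ Icc 1 M, G m - ∑ m ∈ Icc 1 M, G (m + h))
      (G (h + 1) - G (M + h + 1))
    have h2 := norm_sub_le (G (h + 1)) (G (M + h + 1))
    have h3 := hA (h + 1)
    have h4 := hA (M + h + 1)
    push_cast
    linarith

/-- A sum over an interval is controlled by its averages over short shifts. -/
theorem card_mul_norm_sum_le_of_shifts {ι : Type*} [Fintype ι] (G : ℕ → ℂ) (A E : ℝ)
    (hA : ∀ m, ‖G m‖ ≤ A) (M Hmax : ℕ) (h : ι → ℕ) (hh : ∀ i, h i ≤ Hmax)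
    (hE : ∀ m, ‖∑ i, G (m + h i)‖ ≤ E) :
    (Fintype.card ι : ℝ) * ‖∑ m ∈ Icc 1 M, G m‖
      ≤ M * E + (Fintype.card ι : ℝ) * (2 * Hmax * A) := by
  have hA0 : 0 ≤ A := (norm_nonneg _).trans (hA 0)
  have e : (Fintype.card ι : ℂ) * ∑ m ∈ Icc 1 M, G m
      = ∑ m ∈ Icc 1 M, ∑ i, G (m + h i)
        + ∑ i, (∑ m ∈ Icc 1 M, G m - ∑ m ∈ Icc 1 M, G (m + h i)) := by
    rw [sum_sub_distrib, sum_const, nsmul_eq_mul, card_univ, sum_comm]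
    ring
  have h1 : (Fintype.card ι : ℝ) * ‖∑ m ∈ Icc 1 M, G m‖
      = ‖(Fintype.card ι : ℂ) * ∑ m ∈ Icc 1 M, G m‖ := by
    rw [norm_mul, Complex.norm_natCast]
  rw [h1, e]
  refine (norm_add_le _ _).trans (add_le_add ?_ ?_)
  · refine (norm_sum_le _ _).trans ((sum_le_sum fun m _ => hE m).trans (le_of_eq ?_))
    simp
  · refine (norm_sum_le _ _).trans ((sum_le_sum (g := fun _ => 2 * (Hmax : ℝ) * A)
      fun i _ => ?_).trans (le_of_eq ?_))
    · refine (norm_sum_shift_sub_le G A hA M (h i)).trans ?_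
      have : (h i : ℝ) ≤ Hmax := by exact_mod_cast hh i
      gcongr
    · simp

/-- Cauchy–Schwarz removes the coefficients of a bilinear form. -/
theorem norm_bilinear_sq_le (I J : Finset ℕ) (K : ℕ → ℕ → ℂ) (α β : ℕ → ℂ)
    (hα : ∀ m ∈ I, ‖α m‖ ≤ 1) (hβ : ∀ n ∈ J, ‖β n‖ ≤ 1) :
    ‖∑ m ∈ I, ∑ n ∈ J, α m * β n * K m n‖ ^ 2
      ≤ #I * ∑ n ∈ J, ∑ n' ∈ J, ‖∑ m ∈ I, K m n * (starRingEnd ℂ) (K m n')‖ := by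
  have h1 : ‖∑ m ∈ I, ∑ n ∈ J, α m * β n * K m n‖ ≤ ∑ m ∈ I, ‖∑ n ∈ J, β n * K m n‖ := by
    refine (norm_sum_le _ _).trans (sum_le_sum fun m hm => ?_)
    simp_rw [mul_assoc]
    rw [← mul_sum, norm_mul]
    exact mul_le_of_le_one_left (norm_nonneg _) (hα m hm)
  have h2 : ((∑ m ∈ I, ‖∑ n ∈ J, β n * K m n‖ ^ 2 : ℝ) : ℂ)
      = ∑ n ∈ J, ∑ n' ∈ J, β n * (starRingEnd ℂ) (β n') *
        ∑ m ∈ I, K m n * (starRingEnd ℂ) (K m n') := by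
    rw [Complex.ofReal_sum]
    have h3 : ∀ m, ((‖∑ n ∈ J, β n * K m n‖ ^ 2 : ℝ) : ℂ)
        = ∑ n ∈ J, ∑ n' ∈ J, β n * (starRingEnd ℂ) (β n') * (K m n * (starRingEnd ℂ) (K m n')) := by
      intro m
      rw [Complex.ofReal_pow, ← Complex.mul_conj', map_sum, sum_mul_sum]
      refine sum_congr rfl fun n _ => sum_congr rfl fun n' _ => ?_
      rw [map_mul]; ring
    simp_rw [h3, mul_sum]
    rw [sum_comm]
    refine sum_congr rfl fun n _ => ?_
    rw [sum_comm]
  have h4 : ∑ m ∈ I, ‖∑ n ∈ J, β n * K m n‖ ^ 2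
      ≤ ∑ n ∈ J, ∑ n' ∈ J, ‖∑ m ∈ I, K m n * (starRingEnd ℂ) (K m n')‖ := by
    have h5 := congrArg norm h2
    rw [Complex.norm_of_nonneg (sum_nonneg fun _ _ => by positivity)] at h5
    rw [h5]
    refine (norm_sum_le _ _).trans (sum_le_sum fun n hn => ?_)
    refine (norm_sum_le _ _).trans (sum_le_sum fun n' hn' => ?_)
    rw [norm_mul, norm_mul, RCLike.norm_conj]
    exact mul_le_of_le_one_left (norm_nonneg _)
      (mul_le_one₀ (hβ n hn) (norm_nonneg _) (hβ n' hn'))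
  calc ‖∑ m ∈ I, ∑ n ∈ J, α m * β n * K m n‖ ^ 2
      ≤ (∑ m ∈ I, ‖∑ n ∈ J, β n * K m n‖) ^ 2 := by gcongr
    _ ≤ #I * ∑ m ∈ I, ‖∑ n ∈ J, β n * K m n‖ ^ 2 := sq_sum_le_card_mul_sum_sq
    _ ≤ _ := by gcongr

theorem card_congruent_le (N d : ℕ) (n : ℕ) :
    #{n' ∈ Icc 1 N | (d : ℤ) ∣ (n : ℤ) - (n' : ℕ)} ≤ N / d + 1 := by
  rw [← card_range (N / d + 1)]
  refine card_le_card_of_injOn (fun x => x / d) ?_ ?_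
  · intro x hx
    simp only [coe_filter, mem_Icc, Set.mem_ofPred_eq] at hx
    rw [coe_range, Set.mem_Iio, Nat.lt_succ_iff]
    exact Nat.div_le_div_right hx.1.2
  · intro x hx y hy hxy
    simp only [coe_filter, mem_Icc, Set.mem_ofPred_eq] at hx hy
    have h1 : (d : ℤ) ∣ (y : ℤ) - x := by
      have := dvd_sub hx.2 hy.2
      simpa using this
    have h2 : x % d = y % d := (Nat.modEq_iff_dvd.2 h1)
    rw [← Nat.div_add_mod x d, ← Nat.div_add_mod y d, h2]
    dsimp only at hxy
    rw [hxy]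

/-- Separation of the nearly diagonal pairs, those congruent modulo `d`, in a double sum. -/
theorem sum_sum_le_of_congruent (N d : ℕ) (hd : 0 < d) (hdN : d ≤ N) (f : ℕ → ℕ → ℝ) (F₁ F₂ : ℝ)
    (hF₁ : 0 ≤ F₁) (hF₂ : 0 ≤ F₂)
    (h1 : ∀ n n', f n n' ≤ F₁) (h2 : ∀ n n' : ℕ, ¬ (d : ℤ) ∣ (n : ℤ) - (n' : ℕ) → f n n' ≤ F₂) :
    ∑ n ∈ Icc 1 N, ∑ n' ∈ Icc 1 N, f n n' ≤ (N : ℝ) ^ 2 * (2 / d * F₁ + F₂) := by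
  have hd0 : (0 : ℝ) < d := by exact_mod_cast hd
  have hdN' : (d : ℝ) ≤ N := by exact_mod_cast hdN
  have h3 : ∀ n, ∑ n' ∈ Icc 1 N, f n n' ≤ N * (2 / d * F₁ + F₂) := by
    intro n
    calc ∑ n' ∈ Icc 1 N, f n n'
        ≤ ∑ n' ∈ Icc 1 N, ((if (d : ℤ) ∣ (n : ℤ) - (n' : ℕ) then F₁ else 0) + F₂) := by
          refine sum_le_sum fun n' _ => ?_
          split_ifs with hc
          · linarith [h1 n n']
          · linarith [h2 n n' hc]
      _ = #{n' ∈ Icc 1 N | (d : ℤ) ∣ (n : ℤ) - (n' : ℕ)} * F₁ + N * F₂ := by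
          rw [sum_add_distrib, ← sum_filter, sum_const, sum_const, nsmul_eq_mul, nsmul_eq_mul]
          simp
      _ ≤ (2 * (N / d : ℝ)) * F₁ + N * F₂ := by
          have h4 : ((#{n' ∈ Icc 1 N | (d : ℤ) ∣ (n : ℤ) - (n' : ℕ)} : ℕ) : ℝ)
              ≤ ((N / d : ℕ) : ℝ) + 1 := by exact_mod_cast card_congruent_le N d n
          have h5 : ((N / d : ℕ) : ℝ) ≤ (N : ℝ) / d := Nat.cast_div_le
          have h6 : 1 ≤ (N : ℝ) / d := by rw [one_le_div hd0]; exact hdN'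
          gcongr
          linarith
      _ = _ := by ring
  calc _ ≤ ∑ _n ∈ Icc 1 N, (N : ℝ) * (2 / d * F₁ + F₂) := sum_le_sum fun n _ => h3 n
    _ = _ := by simp; ring

/-! ### The bilinear form -/

section Correlation

variable {p k : ℕ} [NeZero (p ^ k)]

local notation "R" => ZMod (p ^ k)

theorem norm_klSum_mul_conj_le (hp : p.Prime) (hodd : Odd p) (hk : 0 < k) (μ μ' : R) {a : R}
    (ha : IsUnit a) :
    ‖klSum (p ^ k) μ a * (starRingEnd ℂ) (klSum (p ^ k) μ' a)‖ ≤ 4 * p := by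
  rw [norm_mul, RCLike.norm_conj]
  have h1 := norm_klSum_sq_le hp hodd hk μ ha
  have h2 := norm_klSum_sq_le hp hodd hk μ' ha
  nlinarith [sq_nonneg (‖klSum (p ^ k) μ a‖ - ‖klSum (p ^ k) μ' a‖)]

theorem norm_sum_correlation_trivial (hp : p.Prime) (hodd : Odd p) (hk : 0 < k) {a : R}
    (ha : IsUnit a) (M : ℕ) (n n' : ℤ) :
    ‖∑ m ∈ Icc 1 M, klSum (p ^ k) ((m : R) * n) a *
      (starRingEnd ℂ) (klSum (p ^ k) ((m : R) * n') a)‖ ≤ M * (4 * p) := by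
  refine (norm_sum_le _ _).trans ((sum_le_sum fun m _ =>
    norm_klSum_mul_conj_le hp hodd hk _ _ ha).trans (le_of_eq ?_))
  simp

/-- The correlation sum over `m ≤ M`, averaged over the shifts `m ↦ m + p ^ (2 τ) y x` with
`y, x < B ^ 2`, which do not exceed `B ^ 6`. -/
theorem norm_sum_correlation_le_of_shifts (hp : p.Prime) (hodd : Odd p) (hk : 0 < k) {a : R}
    (ha : IsUnit a) (M τ : ℕ) (n n' : ℤ) (C σ : ℝ)
    (h : ∀ m : ℕ, ‖∑ y : Fin ((p ^ τ) ^ 2), ∑ x : Fin ((p ^ τ) ^ 2),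
        klSum (p ^ k) (((m + p ^ (2 * τ) * (y * x) : ℕ) : R) * n) a *
        (starRingEnd ℂ) (klSum (p ^ k) (((m + p ^ (2 * τ) * (y * x) : ℕ) : R) * n') a)‖
      ≤ 4 * p * (C * ((p ^ τ : ℕ) : ℝ) ^ (4 - σ))) :
    ‖∑ m ∈ Icc 1 M, klSum (p ^ k) ((m : R) * n) a *
      (starRingEnd ℂ) (klSum (p ^ k) ((m : R) * n') a)‖
      ≤ 4 * p * (C * M * ((p ^ τ : ℕ) : ℝ) ^ (-σ) + 2 * ((p ^ τ : ℕ) : ℝ) ^ 6) := by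
  set B : ℕ := p ^ τ with hB
  have hB0 : 0 < B := pow_pos hp.pos _
  have hBr : (0 : ℝ) < B := by exact_mod_cast hB0
  set G : ℕ → ℂ := fun m => klSum (p ^ k) ((m : R) * n) a *
      (starRingEnd ℂ) (klSum (p ^ k) ((m : R) * n') a) with hG
  have h1 := card_mul_norm_sum_le_of_shifts (ι := Fin (B ^ 2) × Fin (B ^ 2)) G (4 * p)
    (4 * p * (C * (B : ℝ) ^ (4 - σ))) (fun m => norm_klSum_mul_conj_le hp hodd hk _ _ ha)
    M (B ^ 6) (fun t => p ^ (2 * τ) * (t.1 * t.2)) (by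
      rintro ⟨y, x⟩
      have e : B ^ 6 = p ^ (2 * τ) * (B ^ 2 * B ^ 2) := by rw [hB]; ring
      rw [e]
      exact Nat.mul_le_mul_left _ (Nat.mul_le_mul y.2.le x.2.le)) (by
      intro m
      rw [Fintype.sum_prod_type]
      exact h m)
  have hc : (Fintype.card (Fin (B ^ 2) × Fin (B ^ 2)) : ℝ) = (B : ℝ) ^ 4 := by
    simp; ring
  rw [hc] at h1
  have e4 : (B : ℝ) ^ (4 - σ) = (B : ℝ) ^ 4 * (B : ℝ) ^ (-σ) := by
    rw [sub_eq_add_neg, Real.rpow_add hBr]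
    congr 1
    exact_mod_cast Real.rpow_natCast (B : ℝ) 4
  rw [e4] at h1
  push_cast at h1
  refine le_of_mul_le_mul_left (h1.trans (le_of_eq ?_)) (pow_pos hBr 4)
  ring

/-- The bound for the bilinear form in terms of `B = p ^ τ`: the pairs `n, n'` congruent modulo
`B ^ 2` contribute a proportion `B ^ (-2)`, the boundary of the shifts `B ^ (-1)`, and the phases in
the remaining pairs save `B ^ (-σ)`, where `σ ≤ 1`. -/
theorem norm_bilinearSum_sq_le (hp : p.Prime) (hodd : Odd p) (hk : 0 < k) {a : ℤ}
    (ha : IsUnit (a : R)) (M N τ : ℕ) (C σ : ℝ) (hC : 0 < C) (hσ : σ ≤ 1)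
    (hM : (p ^ τ) ^ 7 ≤ M) (hN : (p ^ τ) ^ 2 ≤ N)
    (h : ∀ n n' : ℤ, ¬ ((p ^ (2 * τ) : ℕ) : ℤ) ∣ n - n' → ∀ m : ℕ,
      ‖∑ y : Fin ((p ^ τ) ^ 2), ∑ x : Fin ((p ^ τ) ^ 2),
        klSum (p ^ k) (((m + p ^ (2 * τ) * (y * x) : ℕ) : R) * n) a *
        (starRingEnd ℂ) (klSum (p ^ k) (((m + p ^ (2 * τ) * (y * x) : ℕ) : R) * n') a)‖
      ≤ 4 * p * (C * ((p ^ τ : ℕ) : ℝ) ^ (4 - σ)))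
    (α β : ℕ → ℂ) (hα : ∀ m ∈ Icc 1 M, ‖α m‖ ≤ 1) (hβ : ∀ n ∈ Icc 1 N, ‖β n‖ ≤ 1) :
    ‖bilinearSum a (p ^ k) α β M N‖ ^ 2
      ≤ 4 * (C + 4) * p * ((M : ℝ) * N) ^ 2 * ((p ^ τ : ℕ) : ℝ) ^ (-σ) := by
  have hp0 : (0 : ℝ) < p := by exact_mod_cast hp.pos
  have e2 : p ^ (2 * τ) = (p ^ τ) ^ 2 := by rw [← pow_mul, mul_comm]
  set B : ℕ := p ^ τ with hB
  have hB0 : 0 < B := pow_pos hp.pos _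
  have hB1 : (1 : ℝ) ≤ B := by exact_mod_cast hB0
  have hBr : (0 : ℝ) < B := by linarith
  set K : ℕ → ℕ → ℂ := fun m n => klSum (p ^ k) ((m : R) * ((n : ℤ) : R)) (a : R) with hK
  have hS : bilinearSum a (p ^ k) α β M N = ∑ m ∈ Icc 1 M, ∑ n ∈ Icc 1 N, α m * β n * K m n := by
    unfold bilinearSum
    refine sum_congr rfl fun m _ => sum_congr rfl fun n _ => ?_
    rw [kloostermanSum_eq_klSum]
    congr 2
    push_cast
    rfl
  have hMr : (B : ℝ) ^ 7 ≤ M := by exact_mod_cast hM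
  have hM0 : (0 : ℝ) ≤ M := Nat.cast_nonneg M
  have hσB : (B : ℝ)⁻¹ ≤ (B : ℝ) ^ (-σ) := by
    rw [← Real.rpow_neg_one]
    exact Real.rpow_le_rpow_of_exponent_le hB1 (by linarith)
  set F₂ : ℝ := 4 * p * ((C + 2) * M * (B : ℝ) ^ (-σ)) with hF₂
  have hsum := sum_sum_le_of_congruent N (B ^ 2) (by positivity) hN
    (fun n n' => ‖∑ m ∈ Icc 1 M, K m n * (starRingEnd ℂ) (K m n')‖) (M * (4 * p)) F₂
    (by positivity) (by positivity)
    (fun n n' => norm_sum_correlation_trivial hp hodd hk ha M n n') (by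
      intro n n' hnn
      rw [e2] at h
      refine (norm_sum_correlation_le_of_shifts hp hodd hk ha M τ n n' C σ
        (by rw [e2]; exact h n n' hnn)).trans ?_
      rw [hF₂, ← hB]
      have h3 : (B : ℝ) ^ 6 ≤ M * (B : ℝ) ^ (-σ) := by
        calc (B : ℝ) ^ 6 = (B : ℝ) ^ 7 * (B : ℝ)⁻¹ := by field_simp
          _ ≤ M * (B : ℝ) ^ (-σ) := by gcongr
      have h4 : C * M * (B : ℝ) ^ (-σ) + 2 * (B : ℝ) ^ 6 ≤ (C + 2) * M * (B : ℝ) ^ (-σ) := by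
        linarith
      gcongr)
  have hd : 2 / ((B ^ 2 : ℕ) : ℝ) ≤ 2 * (B : ℝ) ^ (-σ) := by
    calc 2 / ((B ^ 2 : ℕ) : ℝ) = 2 * ((B : ℝ)⁻¹ * (B : ℝ)⁻¹) := by push_cast; field_simp
      _ ≤ 2 * (1 * (B : ℝ) ^ (-σ)) := by
        gcongr
        exact inv_le_one_of_one_le₀ hB1
      _ = _ := by ring
  rw [hS]
  calc ‖∑ m ∈ Icc 1 M, ∑ n ∈ Icc 1 N, α m * β n * K m n‖ ^ 2
      ≤ #(Icc 1 M) * ∑ n ∈ Icc 1 N, ∑ n' ∈ Icc 1 N,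
          ‖∑ m ∈ Icc 1 M, K m n * (starRingEnd ℂ) (K m n')‖ :=
        norm_bilinear_sq_le _ _ K α β hα hβ
    _ ≤ M * ((N : ℝ) ^ 2 * (2 / ((B ^ 2 : ℕ) : ℝ) * (M * (4 * p)) + F₂)) := by
        rw [Nat.card_Icc, Nat.add_sub_cancel]
        gcongr
    _ ≤ M * ((N : ℝ) ^ 2 * (2 * (B : ℝ) ^ (-σ) * (M * (4 * p)) + F₂)) := by gcongr
    _ = _ := by rw [hF₂]; ring

end Correlation

/-- A prime factor `p` is absorbed by half of the saving `B ^ (-σ)`, `B = p ^ τ`, when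
`τ * σ ≥ 2`; the other half is then expressed in terms of `q = p ^ k`. -/
theorem prime_mul_rpow_neg_le {p k τ D : ℕ} (hp : 0 < p) (hD : 0 < D) {σ : ℝ} (hσ : 0 < σ)
    (hτ : 2 ≤ τ * σ) (hk : k ≤ 101 * D * τ) :
    (p : ℝ) * ((p ^ τ : ℕ) : ℝ) ^ (-σ) ≤ (((p ^ k : ℕ) : ℝ) ^ (-(σ / (404 * D)))) ^ 2 := by
  have hp1 : (1 : ℝ) ≤ p := by exact_mod_cast hp
  have hp0 : (0 : ℝ) < p := by linarith
  have hDr : (0 : ℝ) < D := by exact_mod_cast hD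
  have hkr : (k : ℝ) ≤ 101 * D * τ := by exact_mod_cast hk
  push_cast
  rw [← Real.rpow_natCast (p : ℝ) τ, ← Real.rpow_mul hp0.le, ← Real.rpow_natCast (p : ℝ) k,
    ← Real.rpow_mul hp0.le, ← Real.rpow_natCast _ 2, ← Real.rpow_mul hp0.le]
  nth_rewrite 1 [← Real.rpow_one (p : ℝ)]
  rw [← Real.rpow_add hp0]
  refine Real.rpow_le_rpow_of_exponent_le hp1 ?_
  have h1 : (k : ℝ) * (σ / (404 * D)) ≤ 101 * D * τ * (σ / (404 * D)) := by gcongr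
  have h2 : 101 * D * τ * (σ / (404 * D)) = τ * σ / 4 := by field_simp; ring
  push_cast
  linarith

end Kloosterman

theorem theorem1p1 :
    ∃ c : ℝ, 0 < c ∧
      ∀ lam : ℝ, 0 < lam → lam < 1 →
        ∃ H : ℝ, 0 < H ∧ ∃ C : ℝ, 0 < C ∧
          ∀ (p k q : ℕ), p.Prime → Odd p → q = p ^ k → H < (k : ℝ) →
          ∀ (a : ℤ), Int.gcd a (p : ℤ) = 1 →
          ∀ (M N : ℕ),
            (q : ℝ) ^ lam < (M : ℝ) → M < q →
            (q : ℝ) ^ lam < (N : ℝ) → N < q →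
          ∀ (α β : ℕ → ℂ),
            (∀ m ∈ Finset.Icc 1 M, ‖α m‖ ≤ 1) →
            (∀ n ∈ Finset.Icc 1 N, ‖β n‖ ≤ 1) →
            ‖Kloosterman.bilinearSum a q α β M N‖
              ≤ C * ((M : ℝ) * (N : ℝ) * (q : ℝ) ^ (-(c * lam ^ 3))) := by
  have hc := Kloosterman.savingConst_pos
  have hc1 : Kloosterman.savingConst ≤ 1 := by unfold Kloosterman.savingConst; norm_num
  refine ⟨Kloosterman.savingConst / 3232, by positivity, fun lam hlam0 hlam1 => ?_⟩
  -- The integer `D` lies between `1 / lam` and `2 / lam`.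
  obtain ⟨D, hDdef⟩ : ∃ D : ℕ, D = ⌈1 / lam⌉₊ := ⟨_, rfl⟩
  have hD1 : 1 / lam ≤ D := hDdef ▸ Nat.le_ceil _
  have hlam_inv : 1 ≤ 1 / lam := by rw [le_div_iff₀ hlam0]; linarith
  have hD2 : (D : ℝ) * lam ≤ 2 := by
    have : (D : ℝ) < 1 / lam + 1 := hDdef ▸ Nat.ceil_lt_add_one (by positivity)
    calc (D : ℝ) * lam ≤ (1 / lam + 1) * lam := by gcongr
      _ = 1 + lam := by field_simp
      _ ≤ 2 := by linarith
  have hDr : (1 : ℝ) ≤ D := hlam_inv.trans hD1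
  have hD0 : 0 < D := by exact_mod_cast (by linarith : (0 : ℝ) < D)
  have hDlam : 1 ≤ lam * D := by
    rw [div_le_iff₀ hlam0] at hD1; linarith
  obtain ⟨C, hC, T, hcorr⟩ := Kloosterman.exists_correlation_bound D hD0
  obtain ⟨σ, hσdef⟩ : ∃ σ : ℝ, σ = Kloosterman.savingConst / (D : ℝ) ^ 2 := ⟨_, rfl⟩
  rw [← hσdef] at hcorr
  have hσ0 : 0 < σ := by rw [hσdef]; positivity
  have hσ1 : σ ≤ 1 := by
    rw [hσdef, div_le_one (by positivity)]
    exact hc1.trans (one_le_pow₀ hDr)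
  -- The scale `τ` has to exceed `T` for the correlation bound, `2 / σ` to absorb a factor `p`, and
  -- `100` for `k ≤ 101 * D * τ` with `τ = k / (100 * D)`.
  obtain ⟨T₁, hT₁⟩ : ∃ T₁ : ℕ, T₁ = max T (max 100 ⌈2 / σ⌉₊) := ⟨_, rfl⟩
  have hT₁T : T ≤ T₁ := hT₁ ▸ le_max_left _ _
  have hT₁100 : 100 ≤ T₁ := hT₁ ▸ (le_max_left _ _).trans (le_max_right _ _)
  have hT₁σ : 2 / σ ≤ T₁ := (Nat.le_ceil _).trans
    (Nat.cast_le.2 (hT₁ ▸ (le_max_right _ _).trans (le_max_right _ _)))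
  refine ⟨((100 * D * T₁ : ℕ) : ℝ), by positivity, 4 * (C + 4), by positivity, ?_⟩
  rintro p k q hp hodd rfl hk a ha M N hM - hN - α β hα hβ
  replace hk : 100 * D * T₁ < k := by exact_mod_cast hk
  have hk0 : 0 < k := by omega
  have hppos := hp.pos
  have : NeZero (p ^ k) := ⟨by positivity⟩
  obtain ⟨τ, hτdef⟩ : ∃ τ : ℕ, τ = k / (100 * D) := ⟨_, rfl⟩
  have hτT : T₁ ≤ τ := by
    rw [hτdef, Nat.le_div_iff_mul_le (by positivity), mul_comm]
    exact hk.le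
  have hk1 : 100 * D * τ ≤ k := hτdef ▸ Nat.mul_div_le _ _
  have hk2 : k ≤ 101 * D * τ := by
    have h1 : k < 100 * D * (τ + 1) := hτdef ▸ Nat.lt_mul_div_succ _ (by positivity)
    have h2 : D * 100 ≤ D * τ := Nat.mul_le_mul_left _ (hT₁100.trans hτT)
    nlinarith
  have hτσ : 2 ≤ τ * σ := by
    rw [← div_le_iff₀ hσ0]
    exact hT₁σ.trans (Nat.cast_le.2 hτT)
  have hunit : IsUnit (a : ZMod (p ^ k)) := by
    rw [ZMod.coe_int_isUnit_iff_isCoprime]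
    push_cast
    exact (Int.isCoprime_iff_gcd_eq_one.2 ha).symm.pow_left
  have hp1 : (1 : ℝ) ≤ p := by exact_mod_cast hp.one_le
  -- Both ranges are longer than `B ^ 100`, where `B = p ^ τ`.
  have hlong : ∀ L : ℕ, ((p ^ k : ℕ) : ℝ) ^ lam < L → (p ^ τ) ^ 100 ≤ L := by
    intro L hL
    have h1 : ((p ^ τ : ℕ) : ℝ) ^ 100 ≤ ((p ^ k : ℕ) : ℝ) ^ lam := by
      push_cast
      rw [← pow_mul, ← Real.rpow_natCast, ← Real.rpow_natCast (p : ℝ) k,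
        ← Real.rpow_mul (by positivity)]
      refine Real.rpow_le_rpow_of_exponent_le hp1 ?_
      have hk1r : 100 * (D : ℝ) * τ ≤ k := by exact_mod_cast hk1
      calc ((τ * 100 : ℕ) : ℝ) = 1 * (100 * τ) := by push_cast; ring
        _ ≤ lam * D * (100 * τ) := by gcongr
        _ = 100 * D * τ * lam := by ring
        _ ≤ k * lam := by gcongr
    exact_mod_cast h1.trans hL.le
  have hBpos : 0 < p ^ τ := by positivity
  have hS := Kloosterman.norm_bilinearSum_sq_le hp hodd hk0 hunit M N τ C σ hC hσ1
    ((Nat.pow_le_pow_right hBpos (by norm_num)).trans (hlong M hM))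
    ((Nat.pow_le_pow_right hBpos (by norm_num)).trans (hlong N hN))
    (hcorr p k τ hp hodd (hT₁T.trans hτT) hk1 hk2 a hunit) α β hα hβ
  have hq := Kloosterman.prime_mul_rpow_neg_le hppos hD0 hσ0 hτσ hk2
  -- Since `σ / (404 * D)` is `savingConst / (404 * D ^ 3)` and `D * lam ≤ 2`, the constant is
  -- `404 * 2 ^ 3 = 3232`.
  have hexp : Kloosterman.savingConst / 3232 * lam ^ 3 ≤ σ / (404 * D) := by
    have h3 : ((D : ℝ) * lam) ^ 3 ≤ 2 ^ 3 := by gcongr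
    rw [hσdef, div_div, le_div_iff₀ (by positivity)]
    calc Kloosterman.savingConst / 3232 * lam ^ 3 * ((D : ℝ) ^ 2 * (404 * D))
        = Kloosterman.savingConst * (((D : ℝ) * lam) ^ 3 / 2 ^ 3) := by ring
      _ ≤ Kloosterman.savingConst * 1 := by gcongr; rwa [div_le_one (by norm_num)]
      _ = _ := mul_one _
  have hq1 : (1 : ℝ) ≤ ((p ^ k : ℕ) : ℝ) := by exact_mod_cast Nat.one_le_pow _ _ hppos
  obtain ⟨Q, hQdef⟩ : ∃ Q : ℝ, Q = ((p ^ k : ℕ) : ℝ) ^ (-(σ / (404 * D))) := ⟨_, rfl⟩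
  have hQ0 : 0 ≤ Q := hQdef ▸ by positivity
  rw [← hQdef] at hq
  have hSQ : ‖Kloosterman.bilinearSum a (p ^ k) α β M N‖ ≤ 4 * (C + 4) * (M * N * Q) := by
    refine (pow_le_pow_iff_left₀ (norm_nonneg _) (by positivity) two_ne_zero).1 (hS.trans ?_)
    calc 4 * (C + 4) * p * ((M : ℝ) * N) ^ 2 * ((p ^ τ : ℕ) : ℝ) ^ (-σ)
        = 4 * (C + 4) * ((M : ℝ) * N) ^ 2 * (p * ((p ^ τ : ℕ) : ℝ) ^ (-σ)) := by ring
      _ ≤ 4 * (C + 4) * ((M : ℝ) * N) ^ 2 * Q ^ 2 := by gcongr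
      _ ≤ (4 * (C + 4)) ^ 2 * ((M : ℝ) * N) ^ 2 * Q ^ 2 := by
        gcongr
        nlinarith
      _ = (4 * (C + 4) * (M * N * Q)) ^ 2 := by ring
  refine hSQ.trans ?_
  gcongr
  rw [hQdef]
  exact Real.rpow_le_rpow_of_exponent_le hq1 (by linarith)
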